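/- Write $D_r=\{z\in\mathbb C:|z|<r\}$ and $e(\varphi)=e^{2\pi i\varphi}$. For $1<R_2<R_1<R$ put $$B_0=\frac{1}{2\log(R/R_1)}\cdot\frac{R_1+R_2}{R_1-R_2}\cdot\begin{cases}\log R & \text{if } R^2-R_1^2>R,\\ \log\frac{R^2}{R^2-R_1^2} & \text{if } R^2-R_1^2\le R,\end{cases}\qquad B_1=B_0\,\frac{8R_2}{R_2^2-1},$$ $$B_2=B_0\,\frac{16\pi(R_2^2-1)\sqrt{16R_2^2-\bigl(\sqrt{R_2^4+34R_2^2+1}-1-R_2^2\bigr)^2}}{\bigl(3R_2^2+3-\sqrt{R_2^4+34R_2^2+1}\bigr)^2}.$$ **Theorem (effective Riesz representation).** Let $1<R_2<R_1<R$ and $B,m\in\mathbb R$. Let $v:\overline{D_R}\to\mathbb R\cup\{-\infty\}$ be subharmonic, that is, upper semicontinuous and with $v(z)\le\int_0^1 v(z+re(\theta))\,d\theta$ for every closed disk $\{|\zeta-z|\le r\}\subset\overline{D_R}$, $r>0$. Assume that $v\le B$ on $\overline{D_R}$ and $v(0)=m$. Then there are a positive Borel measure $\mu$ and a function $h$ such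 that for all $w\in D_{R_1}$ $$v(w)=\int_{D_{R_1}}\log|z-w|\,\mu(dz)+h(w)$$ (with $\log 0=-\infty$, both sides being allowed to equal $-\infty$), where 1. $\displaystyle \mu(D_{R_1})\le\frac{B-m}{\log(R/R_1)}$; 2. $h$ is real-valued and harmonic on $D_{R_1}$, and satisfies $$\min_{c\in\mathbb R}\,\max_{|w|\le R_2}|h(w)-c|\le B_0\,(B-m),\qquad \left|\frac{d^k}{d\varphi^k}h(e(\varphi))\right|\le B_k\,(B-m)\quad(\varphi\in\mathbb R,\ k=1,2).$$ -/

import Mathlib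

open MeasureTheory Metric
open scoped ENNReal

noncomputable section

namespace EffectiveRiesz

/-- The integral of an extended-real-valued function, `∫ f⁺ dμ - ∫ f⁻ dμ`, with value in `[-∞, ∞]`.
It is the usual extended integral whenever `∫ f⁺ dμ < ∞`; it is used only in that case. -/
def extIntegral {α : Type*} [MeasurableSpace α] (μ : Measure α) (f : α → EReal) : EReal :=
  ((∫⁻ x, (f x).toENNReal ∂μ : ℝ≥0∞) : EReal) - ((∫⁻ x, (-f x).toENNReal ∂μ : ℝ≥0∞) : EReal)

/-- The point `e(θ) = exp(2πiθ)` of the unit circle. -/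
def e (θ : ℝ) : ℂ := Complex.exp (2 * Real.pi * Complex.I * θ)

/-- The mean value `∫₀¹ v(z + r e(θ)) dθ` of `v` over the circle of centre `z` and radius `r`. -/
def circleMean (v : ℂ → EReal) (z : ℂ) (r : ℝ) : EReal :=
  extIntegral (volume.restrict (Set.Ioc (0 : ℝ) 1)) (fun θ => v (z + r * e θ))

/-- `v : s → ℝ ∪ {-∞}` is subharmonic: it is upper semicontinuous and satisfies the sub-mean value
property on all closed disks contained in `s`. Values of `v` outside `s` are irrelevant. -/
structure SubharmonicOn (v : ℂ → EReal) (s : Set ℂ) : Prop where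
  lt_top : ∀ z ∈ s, v z < ⊤
  upperSemicontinuousOn : UpperSemicontinuousOn v s
  le_circleMean : ∀ (z : ℂ) (r : ℝ), 0 < r → closedBall z r ⊆ s → v z ≤ circleMean v z r

/-- The logarithmic potential `∫_s log |z - w| μ(dz) ∈ [-∞, ∞]`, where `log 0 = -∞`. -/
def logPotential (μ : Measure ℂ) (s : Set ℂ) (w : ℂ) : EReal :=
  extIntegral (μ.restrict s) (fun z => ENNReal.log ‖z - w‖ₑ)

/-- In the borderline case `R² - R₁² = R` the two branches agree. -/
def B₀ (R R₁ R₂ : ℝ) : ℝ :=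
  1 / (2 * Real.log (R / R₁)) * ((R₁ + R₂) / (R₁ - R₂)) *
    (if R < R ^ 2 - R₁ ^ 2 then Real.log R else Real.log (R ^ 2 / (R ^ 2 - R₁ ^ 2)))

def B₁ (R R₁ R₂ : ℝ) : ℝ :=
  B₀ R R₁ R₂ * (8 * R₂ / (R₂ ^ 2 - 1))

def B₂ (R R₁ R₂ : ℝ) : ℝ :=
  B₀ R R₁ R₂ *
    (16 * Real.pi * (R₂ ^ 2 - 1) *
        √(16 * R₂ ^ 2 - (√(R₂ ^ 4 + 34 * R₂ ^ 2 + 1) - 1 - R₂ ^ 2) ^ 2) /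
      (3 * R₂ ^ 2 + 3 - √(R₂ ^ 4 + 34 * R₂ ^ 2 + 1)) ^ 2)

end EffectiveRiesz

end

/-! Put `p = B - v` on the open disc `D_R`. This is a nonnegative superharmonic function, finite at
`0`, and its values in `[0, ∞]` let Tonelli's theorem apply freely. The core is the Riesz
decomposition `p = P + H` on `D_{R₁}` (`exists_riesz_decomposition`): `P` is the potential of a
positive measure `μ` for the Green function of the larger disc `D_R`, and `H ≥ 0` is harmonic.
Writing the Green function as `log |R² - z̄w| - log R - log |z - w|` gives `v = ∫ log |z - w| dμ +
h` with `h = B - H - I`, where `I(w) = ∫ (log |R² - z̄w| - log R) dμ(z)` is harmonic.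

To construct `μ`, let `A_r` be the mean over circles of radius `r`. The defect `f - A_r f` of a
potential of `μ` is the convolution of `μ` with `lam r = log⁺ (r / |·|)`, so `(p - A_r p) / ∫ lam r`
should tend to `μ`. Since `A_r` is self-adjoint, the Green potentials of these densities stay below
`p`; at the centre this bounds their masses, and a weak limit exists. The identity `(1 - A_r) lam ρ
= (1 - A_ρ) lam r` survives the limit `r → 0` and shows that the mollified `p` and the mollified `P`
have the same defect at every scale `ρ`. Their difference is smooth with the mean value property,
hence harmonic. Letting the mollifier shrink recovers `p` and `P` at every point, also where they
are infinite, because both are lower semicontinuous with the super-mean value property.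

The constants come from the centre. There the Green function is `log (R / |z|) ≥ log (R / R₁)`, so
`μ(D_{R₁}) log (R / R₁) + H(0) ≤ B - m`. This is the mass bound, and with `H ≥ 0` and `|R² - z̄w| ≥
R² - R₁²` it bounds `h - h(0)` above (`growth_le`). Harnack's inequality turns the one-sided bound
into a bound for the oscillation on `|w| ≤ R₂`. Poisson's formula on `|w| = R₂` then writes `h(e(φ))
- c` as a convolution, and `B₁`, `B₂` are `B₀` times the `L¹` norms of the first two derivatives of
the Poisson kernel. -/

noncomputable section

namespace EffectiveRiesz

open Set Filter Topology

/-! ### The points `e θ` -/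

lemma e_eq_exp_mul_I (θ : ℝ) : e θ = Complex.exp ((2 * Real.pi * θ : ℝ) * Complex.I) := by
  rw [e]; congr 1; push_cast; ring

@[simp] lemma norm_e (θ : ℝ) : ‖e θ‖ = 1 := by
  rw [e_eq_exp_mul_I, Complex.norm_exp_ofReal_mul_I]

lemma e_add (s t : ℝ) : e (s + t) = e s * e t := by
  simp only [e, ← Complex.exp_add]; congr 1; push_cast; ring

@[simp] lemma e_one : e 1 = 1 := by
  simp [e, Complex.exp_two_pi_mul_I]

lemma e_half : e (1 / 2) = -1 := by
  rw [e, ← Complex.exp_pi_mul_I]; congr 1; push_cast; ring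

lemma e_periodic : Function.Periodic e 1 := fun θ => by rw [e_add, e_one, mul_one]

@[fun_prop] lemma continuous_e : Continuous e := by unfold e; fun_prop

@[fun_prop] lemma measurable_e : Measurable e := continuous_e.measurable

lemma exists_eq_norm_mul_e (z : ℂ) : ∃ ψ : ℝ, z = ‖z‖ * e ψ := by
  refine ⟨z.arg / (2 * Real.pi), ?_⟩
  rw [e_eq_exp_mul_I, mul_div_cancel₀ _ (by positivity), Complex.norm_mul_exp_arg_mul_I]

/-! ### Circle means of `[0, ∞]`-valued functions -/

lemma lintegral_Ioc_add_of_periodic {f : ℝ → ℝ≥0∞} (hf : Function.Periodic f 1) (c : ℝ) :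
    ∫⁻ θ in Ioc (0 : ℝ) 1, f (θ + c) = ∫⁻ θ in Ioc (0 : ℝ) 1, f θ := by
  have h1 : ∫⁻ θ in Ioc (0 : ℝ) 1, f (θ + c) = ∫⁻ θ in Ioc c (c + 1), f θ := by
    have := (measurePreserving_add_right volume c).setLIntegral_comp_preimage_emb
      (measurableEmbedding_addRight c) f (Ioc c (c + 1))
    rw [← this]; simp
  have h2 := (isAddFundamentalDomain_Ioc (T := 1) one_pos c).setLIntegral_eq
    (isAddFundamentalDomain_Ioc (T := 1) one_pos 0) f (by
      rintro ⟨g, hg⟩ x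
      obtain ⟨n, rfl⟩ := AddSubgroup.mem_zmultiples_iff.1 hg
      have := hf.zsmul n x
      simpa [AddSubgroup.vadd_def, add_comm] using this)
  rw [h1, h2, zero_add]

/-- The mean of `f` over the circle of centre `z` and radius `r`. -/
def lmean (f : ℂ → ℝ≥0∞) (z : ℂ) (r : ℝ) : ℝ≥0∞ := ∫⁻ θ in Ioc (0 : ℝ) 1, f (z + r * e θ)

@[fun_prop] lemma measurable_lmean {f : ℂ → ℝ≥0∞} (hf : Measurable f) (r : ℝ) :
    Measurable fun z => lmean f z r := by
  unfold lmean
  exact Measurable.lintegral_prod_right' (f := fun q : ℂ × ℝ => f (q.1 + r * e q.2)) (by fun_prop)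

lemma lintegral_e_mul (f : ℂ → ℝ≥0∞) (w z : ℂ) :
    ∫⁻ θ in Ioc (0 : ℝ) 1, f (w + e θ * z) = lmean f w ‖z‖ := by
  obtain ⟨ψ, hψ⟩ := exists_eq_norm_mul_e z
  rw [lmean, ← lintegral_Ioc_add_of_periodic (f := fun θ => f (w + ‖z‖ * e θ)) (c := ψ)]
  · refine lintegral_congr fun θ => ?_
    nth_rewrite 1 [hψ]; rw [e_add]; congr 2; ring
  · intro θ; simp only [e_periodic θ]

/-- The circle is invariant under a half turn. This is the symmetry behind `lconv_lmean_left`. -/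
lemma lmean_eq_lintegral_sub (f : ℂ → ℝ≥0∞) (z : ℂ) (r : ℝ) :
    lmean f z r = ∫⁻ θ in Ioc (0 : ℝ) 1, f (z - r * e θ) := by
  rw [lmean, ← lintegral_Ioc_add_of_periodic (f := fun θ => f (z + r * e θ)) (c := 1 / 2)]
  · refine lintegral_congr fun θ => ?_
    rw [e_add, e_half]; congr 1; ring
  · intro θ; simp only [e_periodic θ]

lemma lmean_mono {f g : ℂ → ℝ≥0∞} {z : ℂ} {r : ℝ} (hr : 0 ≤ r)
    (h : ∀ x ∈ sphere z r, f x ≤ g x) : lmean f z r ≤ lmean g z r :=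
  lintegral_mono fun θ => h _ (by simp [abs_of_nonneg hr])

lemma lmean_congr {f g : ℂ → ℝ≥0∞} {z : ℂ} {r : ℝ} (hr : 0 ≤ r)
    (h : ∀ x ∈ sphere z r, f x = g x) : lmean f z r = lmean g z r :=
  lintegral_congr fun θ => h _ (by simp [abs_of_nonneg hr])

@[simp] lemma lmean_const (c : ℝ≥0∞) (z : ℂ) (r : ℝ) : lmean (fun _ => c) z r = c := by
  simp [lmean]

lemma lmean_add {f : ℂ → ℝ≥0∞} (hf : Measurable f) (g : ℂ → ℝ≥0∞) (z : ℂ) (r : ℝ) :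
    lmean (fun x => f x + g x) z r = lmean f z r + lmean g z r :=
  lintegral_add_left (by fun_prop) _

lemma lmean_comm {f : ℂ → ℝ≥0∞} (hf : Measurable f) (z : ℂ) (r s : ℝ) :
    lmean (fun x => lmean f x r) z s = lmean (fun x => lmean f x s) z r := by
  simp only [lmean]
  rw [lintegral_lintegral_swap (by fun_prop)]
  simp only [add_right_comm]

lemma lmean_lintegral {α : Type*} [MeasurableSpace α] {μ : Measure α} [SFinite μ]
    {F : α → ℂ → ℝ≥0∞} (hF : Measurable (Function.uncurry F)) (w : ℂ) (r : ℝ) :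
    lmean (fun x => ∫⁻ a, F a x ∂μ) w r = ∫⁻ a, lmean (F a) w r ∂μ := by
  simp only [lmean]
  rw [lintegral_lintegral_swap]
  exact (hF.comp (f := fun q : ℝ × α => (q.2, w + r * e q.1)) (by fun_prop)).aemeasurable

/-! ### Averages with respect to a weight -/

/-- The average `∫ a(z) f(w + z) dA(z)` of the translates of `f`. -/
def lconv (a f : ℂ → ℝ≥0∞) (w : ℂ) : ℝ≥0∞ := ∫⁻ z, a z * f (w + z)

variable {a b f g : ℂ → ℝ≥0∞}

lemma lconv_eq_lintegral_sub (a f : ℂ → ℝ≥0∞) (w : ℂ) :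
    lconv a f w = ∫⁻ z, a (z - w) * f z := by
  rw [lconv, ← lintegral_add_left_eq_self (fun z => a (z - w) * f z) w]
  simp

@[fun_prop] lemma measurable_lconv (ha : Measurable a) (hf : Measurable f) :
    Measurable (lconv a f) := by
  unfold lconv
  exact Measurable.lintegral_prod_right' (f := fun q : ℂ × ℂ => a q.2 * f (q.1 + q.2)) (by fun_prop)

lemma lconv_add (ha : Measurable a) (hf : Measurable f) (g : ℂ → ℝ≥0∞) (w : ℂ) :
    lconv a (fun x => f x + g x) w = lconv a f w + lconv a g w := by
  simp only [lconv, mul_add]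
  rw [lintegral_add_left (by fun_prop)]

lemma lconv_add_left (ha : Measurable a) (hf : Measurable f) (b : ℂ → ℝ≥0∞) (w : ℂ) :
    lconv (fun x => a x + b x) f w = lconv a f w + lconv b f w := by
  simp only [lconv, add_mul]
  rw [lintegral_add_left (by fun_prop)]

lemma lconv_mono {w : ℂ} (h : ∀ z, a z ≠ 0 → f (w + z) ≤ g (w + z)) :
    lconv a f w ≤ lconv a g w := by
  refine lintegral_mono fun z => ?_
  by_cases hz : a z = 0
  · simp [hz]
  · exact mul_le_mul_right (h z hz) _

lemma lconv_congr {w : ℂ} (h : ∀ z, a z ≠ 0 → f (w + z) = g (w + z)) :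
    lconv a f w = lconv a g w :=
  le_antisymm (lconv_mono fun z hz => (h z hz).le) (lconv_mono fun z hz => (h z hz).ge)

lemma lmean_lconv (ha : Measurable a) (hf : Measurable f) (w : ℂ) (r : ℝ) :
    lmean (lconv a f) w r = lconv a (fun x => lmean f x r) w := by
  unfold lconv
  rw [lmean_lintegral (F := fun z x => a z * f (x + z)) (by fun_prop)]
  refine lintegral_congr fun z => ?_
  simp only [lmean]
  rw [lintegral_const_mul _ (by fun_prop)]
  simp only [add_right_comm]

/-- Circle averaging is self-adjoint: translating `z` by `r e(θ)` moves the mean from the weight to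
the function. This plays the part of Green's identity. -/
lemma lconv_lmean_left (ha : Measurable a) (hf : Measurable f) (w : ℂ) (r : ℝ) :
    lconv (fun x => lmean a x r) f w = lconv a (fun x => lmean f x r) w := by
  have h1 : ∀ z, lmean a z r * f (w + z) =
      ∫⁻ θ in Ioc (0 : ℝ) 1, a (z + r * e θ) * f (w + z) := fun z => by
    rw [lmean, lintegral_mul_const _ (by fun_prop)]
  have h2 : ∀ z, a z * lmean f (w + z) r =
      ∫⁻ θ in Ioc (0 : ℝ) 1, a z * f (w + z - r * e θ) := fun z => by
    rw [lmean_eq_lintegral_sub, lintegral_const_mul _ (by fun_prop)]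
  simp only [lconv, h1, h2]
  conv_lhs => rw [lintegral_lintegral_swap (by fun_prop)]
  conv_rhs => rw [lintegral_lintegral_swap (by fun_prop)]
  refine lintegral_congr fun θ => ?_
  rw [← lintegral_add_right_eq_self (fun z => a z * f (w + z - r * e θ)) (r * e θ)]
  refine lintegral_congr fun z => ?_
  congr 2; ring

lemma lconv_lconv_comm (ha : Measurable a) (hb : Measurable b) (hf : Measurable f) (w : ℂ) :
    lconv a (lconv b f) w = lconv b (lconv a f) w := by
  simp only [lconv]
  have h1 : ∀ (a b : ℂ → ℝ≥0∞), Measurable b → ∀ z, a z * ∫⁻ y, b y * f (w + z + y) =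
      ∫⁻ y, a z * (b y * f (w + z + y)) := fun a b hb z => by
    rw [lintegral_const_mul _ (by fun_prop)]
  simp only [h1 a b hb, h1 b a ha]
  rw [lintegral_lintegral_swap (by fun_prop)]
  refine lintegral_congr fun y => lintegral_congr fun z => ?_
  rw [mul_left_comm, add_right_comm]

lemma lconv_lconv (ha : Measurable a) (hb : Measurable b) (hf : Measurable f) (w : ℂ) :
    lconv a (lconv b f) w = ∫⁻ x, (∫⁻ y, a y * b (x - y)) * f (w + x) := by
  have h1 : ∀ y, a y * lconv b f (w + y) = ∫⁻ x, a y * b (x - y) * f (w + x) := fun y => by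
    rw [lconv, ← lintegral_const_mul _ (by fun_prop),
      ← lintegral_add_right_eq_self (fun x => a y * b (x - y) * f (w + x)) y]
    refine lintegral_congr fun x => ?_
    rw [add_sub_cancel_right, mul_assoc]; congr 3; ring
  rw [lconv]
  simp only [h1]
  rw [lintegral_lintegral_swap (by fun_prop)]
  exact lintegral_congr fun x => lintegral_mul_const _ (by fun_prop)

/-- A weight is radial if it depends only on the modulus. -/
def IsRadial (a : ℂ → ℝ≥0∞) : Prop := ∀ z w : ℂ, ‖z‖ = ‖w‖ → a z = a w

/-- Rotations preserve both area and a radial weight, so `z` may be replaced by `e(θ) z`; averaging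
over `θ` produces circle means. -/
lemma IsRadial.lconv_eq (h : IsRadial a) (ha : Measurable a) (hf : Measurable f) (w : ℂ) :
    lconv a f w = ∫⁻ z, a z * lmean f w ‖z‖ := by
  have h1 : ∀ θ : ℝ, lconv a f w = ∫⁻ z, a z * f (w + e θ * z) := fun θ => by
    have hmp := (rotation (Circle.exp (2 * Real.pi * θ))).measurePreserving
    have he : ∀ z, rotation (Circle.exp (2 * Real.pi * θ)) z = e θ * z := fun z => by
      rw [rotation_apply, e_eq_exp_mul_I, Circle.coe_exp]
    have := hmp.lintegral_comp (f := fun z => a z * f (w + z)) (by fun_prop)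
    rw [lconv, ← this]
    refine lintegral_congr fun z => ?_
    rw [he, h (e θ * z) z (by simp)]
  have h2 : lconv a f w = ∫⁻ θ in Ioc (0 : ℝ) 1, ∫⁻ z, a z * f (w + e θ * z) := by
    rw [← lintegral_congr h1]; simp
  rw [h2, lintegral_lintegral_swap (by fun_prop)]
  refine lintegral_congr fun z => ?_
  rw [lintegral_const_mul _ (by fun_prop), lintegral_e_mul]

lemma IsRadial.lconv_le (h : IsRadial a) (ha : Measurable a) (hf : Measurable f) {w : ℂ}
    (hfw : ∀ z, z ≠ 0 → a z ≠ 0 → lmean f w ‖z‖ ≤ f w) : lconv a f w ≤ (∫⁻ z, a z) * f w := by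
  rw [h.lconv_eq ha hf, ← lintegral_mul_const _ ha]
  refine lintegral_mono fun z => ?_
  by_cases hz : a z = 0
  · simp [hz]
  rcases eq_or_ne z 0 with rfl | h0
  · simp [lmean]
  · exact mul_le_mul_right (hfw z h0 hz) _

lemma IsRadial.lconv_eq_of_mean_eq (h : IsRadial a) (ha : Measurable a) (hf : Measurable f) {w : ℂ}
    (hfw : ∀ z, z ≠ 0 → a z ≠ 0 → lmean f w ‖z‖ = f w) : lconv a f w = (∫⁻ z, a z) * f w := by
  rw [h.lconv_eq ha hf, ← lintegral_mul_const _ ha]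
  refine lintegral_congr fun z => ?_
  by_cases hz : a z = 0
  · simp [hz]
  rcases eq_or_ne z 0 with rfl | h0
  · simp [lmean]
  · rw [hfw z h0 hz]

lemma IsRadial.neg (h : IsRadial a) (z : ℂ) : a (-z) = a z := h _ _ (norm_neg z)

/-- Averages over shrinking discs converge for lower semicontinuous functions with the
super-mean value property. -/
lemma tendsto_lconv {a : ℕ → ℂ → ℝ≥0∞} {δ : ℕ → ℝ} (hδ : Tendsto δ atTop (𝓝 0))
    (ham : ∀ n, Measurable (a n)) (har : ∀ n, IsRadial (a n))
    (ha1 : ∀ᶠ n in atTop, ∫⁻ z, a n z = 1) (has : ∀ n z, a n z ≠ 0 → ‖z‖ ≤ δ n)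
    (hf : Measurable f) {w : ℂ} (hlsc : LowerSemicontinuousAt f w) {ε : ℝ} (hε : 0 < ε)
    (hmean : ∀ t, 0 < t → t < ε → lmean f w t ≤ f w) :
    Tendsto (fun n => lconv (a n) f w) atTop (𝓝 (f w)) := by
  refine tendsto_order.2 ⟨fun y hy => ?_, fun y hy => ?_⟩
  · obtain ⟨y', hy1, hy2⟩ := exists_between hy
    obtain ⟨d, hd, hball⟩ := Metric.eventually_nhds_iff.1 (hlsc y' hy2)
    filter_upwards [ha1, hδ.eventually (gt_mem_nhds hd)] with n h1 h2
    refine hy1.trans_le ?_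
    calc y' = lconv (a n) (fun _ => y') w := by
          rw [lconv, lintegral_mul_const _ (ham n), h1, one_mul]
      _ ≤ lconv (a n) f w := lconv_mono fun z hz => (hball (by
          simpa using (has n z hz).trans_lt h2)).le
  · filter_upwards [ha1, hδ.eventually (gt_mem_nhds hε)] with n h1 h2
    refine lt_of_le_of_lt ?_ hy
    have := (har n).lconv_le (ham n) hf (w := w) fun z h0 hz =>
      hmean _ (norm_pos_iff.2 h0) ((has n z hz).trans_lt h2)
    rwa [h1, one_mul] at this

/-- Fatou's lemma as lower semicontinuity of parametric integrals. -/
lemma lowerSemicontinuousAt_lintegral {α : Type*} [MeasurableSpace α] {μ : Measure α}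
    {F : α → ℂ → ℝ≥0∞} {w : ℂ} (hF : ∀ x, Measurable fun a => F a x)
    (h : ∀ a, LowerSemicontinuousAt (F a) w) :
    LowerSemicontinuousAt (fun x => ∫⁻ a, F a x ∂μ) w := by
  rw [lowerSemicontinuousAt_iff_le_liminf]
  refine le_trans (lintegral_mono fun a => ?_) (lintegral_liminf_le hF)
  exact lowerSemicontinuousAt_iff_le_liminf.1 (h a)

end EffectiveRiesz

end

noncomputable section

namespace EffectiveRiesz

open Set Filter Topology

/-! ### Circle means of real functions -/

lemma circleMap_two_pi_mul (z : ℂ) (r θ : ℝ) : circleMap z r (2 * Real.pi * θ) = z + r * e θ := by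
  rw [circleMap, e_eq_exp_mul_I]

lemma circleAverage_eq_integral_e (f : ℂ → ℝ) (z : ℂ) (r : ℝ) :
    Real.circleAverage f z r = ∫ θ in Ioc (0 : ℝ) 1, f (z + r * e θ) := by
  have := intervalIntegral.integral_comp_mul_left (a := 0) (b := 1) (c := 2 * Real.pi)
    (fun θ => f (circleMap z r θ)) (by positivity)
  rw [Real.circleAverage_def, ← intervalIntegral.integral_of_le zero_le_one]
  simp only [circleMap_two_pi_mul, mul_zero, mul_one] at this
  rw [this]

lemma integrableOn_comp_e {f : ℂ → ℝ} {z : ℂ} {r : ℝ} (hf : CircleIntegrable f z r) :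
    IntegrableOn (fun θ => f (z + r * e θ)) (Ioc (0 : ℝ) 1) := by
  have := IntervalIntegrable.comp_mul_left (c := 2 * Real.pi) hf
  simp only [circleMap_two_pi_mul] at this
  rw [zero_div, div_self (by positivity), intervalIntegrable_iff_integrableOn_Ioc_of_le
    zero_le_one] at this
  exact this

lemma countable_setOf_add_mul_e_eq (z a : ℂ) {r : ℝ} (hr : 0 < r) :
    {θ : ℝ | z + r * e θ = a}.Countable := by
  rcases Set.eq_empty_or_nonempty {θ : ℝ | z + r * e θ = a} with h | ⟨θ₀, h₀⟩
  · simp [h]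
  · refine (Set.countable_range fun n : ℤ => θ₀ + n).mono fun θ hθ => ?_
    have h1 : e θ = e θ₀ := by
      have h2 : z + r * e θ = z + r * e θ₀ := hθ.trans h₀.symm
      exact mul_left_cancel₀ (by exact_mod_cast hr.ne') (add_left_cancel h2)
    rw [e, e, Complex.exp_eq_exp_iff_exists_int] at h1
    obtain ⟨n, hn⟩ := h1
    refine ⟨n, ?_⟩
    have h3 : (2 * Real.pi * Complex.I) * ((θ₀ + n : ℝ) : ℂ) = (2 * Real.pi * Complex.I) * θ := by
      rw [hn]; push_cast; ring
    exact_mod_cast mul_left_cancel₀ Complex.two_pi_I_ne_zero h3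

lemma ae_add_mul_e_ne (z a : ℂ) {r : ℝ} (hr : 0 < r) (s : Set ℝ) :
    ∀ᵐ θ ∂volume.restrict s, z + r * e θ ≠ a := by
  simpa [ae_iff] using (countable_setOf_add_mul_e_eq z a hr).measure_zero (volume.restrict s)

/-- The exceptional point `a` is meant to be the pole of a logarithm, where `F` is infinite and the
real-valued `f` has a conventional value. Only countably many `θ` hit it. -/
lemma lmean_eq_ofReal {F : ℂ → ℝ≥0∞} {f : ℂ → ℝ} {z : ℂ} {r : ℝ} (a : ℂ) (hr : 0 < r)
    (hf : CircleIntegrable f z r)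
    (h : ∀ x ∈ sphere z r, x ≠ a → F x = ENNReal.ofReal (f x) ∧ 0 ≤ f x) :
    lmean F z r = ENNReal.ofReal (Real.circleAverage f z r) := by
  have hs : ∀ θ, z + r * e θ ∈ sphere z r := fun θ => by simp [abs_of_pos hr]
  rw [circleAverage_eq_integral_e, ofReal_integral_eq_lintegral_ofReal (integrableOn_comp_e hf)]
  · refine lintegral_congr_ae ?_
    filter_upwards [ae_add_mul_e_ne z a hr _] with θ hθ using (h _ (hs θ) hθ).1
  · filter_upwards [ae_add_mul_e_ne z a hr _] with θ hθ using (h _ (hs θ) hθ).2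

lemma ofReal_circleAverage_le_lmean {F : ℂ → ℝ≥0∞} {f : ℂ → ℝ} {z : ℂ} {r : ℝ} (a : ℂ) (hr : 0 < r)
    (hf : CircleIntegrable f z r)
    (h : ∀ x ∈ sphere z r, x ≠ a → ENNReal.ofReal (f x) ≤ F x) :
    ENNReal.ofReal (Real.circleAverage f z r) ≤ lmean F z r := by
  have hs : ∀ θ, z + r * e θ ∈ sphere z r := fun θ => by simp [abs_of_pos hr]
  have hi := integrableOn_comp_e hf
  rw [circleAverage_eq_integral_e]
  calc ENNReal.ofReal (∫ θ in Ioc (0 : ℝ) 1, f (z + r * e θ))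
      ≤ ENNReal.ofReal (∫ θ in Ioc (0 : ℝ) 1, max (f (z + r * e θ)) 0) :=
        ENNReal.ofReal_le_ofReal (integral_mono hi hi.pos_part fun θ => le_max_left _ _)
    _ = ∫⁻ θ in Ioc (0 : ℝ) 1, ENNReal.ofReal (max (f (z + r * e θ)) 0) :=
        ofReal_integral_eq_lintegral_ofReal hi.pos_part (.of_forall fun θ => le_max_right _ _)
    _ ≤ lmean F z r := by
        refine lintegral_mono_ae ?_
        filter_upwards [ae_add_mul_e_ne z a hr _] with θ hθ
        simpa using h _ (hs θ) hθ

lemma circleIntegrable_log_norm_sub (a z : ℂ) (r : ℝ) :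
    CircleIntegrable (fun x => Real.log ‖x - a‖) z r :=
  MeromorphicOn.circleIntegrable_log_norm (f := fun x => x - a) (fun _ _ ↦ by fun_prop)

/-! ### The truncated logarithmic kernel -/

/-- The kernel `log⁺ (r / |z|)`. -/
def lam (r : ℝ) (z : ℂ) : ℝ≥0∞ := if z = 0 then ⊤ else ENNReal.ofReal (Real.log r - Real.log ‖z‖)

@[fun_prop] lemma measurable_lam (r : ℝ) : Measurable (lam r) := by
  unfold lam
  exact Measurable.ite (measurableSet_singleton 0) measurable_const (by fun_prop)

lemma isRadial_lam (r : ℝ) : IsRadial (lam r) := fun z w h => by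
  have : z = 0 ↔ w = 0 := by rw [← norm_eq_zero, h, norm_eq_zero]
  simp only [lam, this, h]

lemma lam_of_ne_zero {r : ℝ} {z : ℂ} (hz : z ≠ 0) :
    lam r z = ENNReal.ofReal (Real.log r - Real.log ‖z‖) := if_neg hz

@[simp] lemma lam_zero (r : ℝ) : lam r 0 = ⊤ := if_pos rfl

lemma norm_lt_of_lam_ne_zero {r : ℝ} (hr : 0 < r) {z : ℂ} (h : lam r z ≠ 0) : ‖z‖ < r := by
  rcases eq_or_ne z 0 with rfl | hz
  · simpa
  rw [lam_of_ne_zero hz, ne_eq, ENNReal.ofReal_eq_zero, not_le, sub_pos] at h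
  exact (Real.log_lt_log_iff (norm_pos_iff.2 hz) hr).1 h

/-- The circle lies in the closed disc of radius `C`, where the truncation is inactive, so this is
Jensen's formula for `log |x|`. -/
lemma lmean_lam_eq {C r : ℝ} {z : ℂ} (hr : 0 < r) (hC : ‖z‖ + r ≤ C) :
    lmean (lam C) z r =
      ENNReal.ofReal (Real.log C - (Real.log r + Real.posLog (r⁻¹ * ‖z‖))) := by
  have hi := circleIntegrable_log_norm_sub 0 z r
  have h := lmean_eq_ofReal (F := lam C) (f := fun x => Real.log C - Real.log ‖x - 0‖) (z := z)
    0 hr ((circleIntegrable_const _ _ _).sub hi) (fun x hx h0 => by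
      simp only [sub_zero]
      refine ⟨lam_of_ne_zero h0, sub_nonneg.2 (Real.log_le_log (norm_pos_iff.2 h0) ?_)⟩
      have : ‖x‖ ≤ ‖z‖ + ‖x - z‖ := by simpa using norm_add_le z (x - z)
      rw [mem_sphere_iff_norm.1 hx] at this
      linarith)
  rw [h, Real.circleAverage_fun_sub (circleIntegrable_const _ _ _) hi, Real.circleAverage_const,
    circleAverage_log_norm_sub_const_eq_log_radius_add_posLog hr.ne', sub_zero]

lemma posLog_inv_mul {r t : ℝ} (hr : 0 < r) (ht : 0 < t) :
    Real.posLog (r⁻¹ * t) = max 0 (Real.log t - Real.log r) := by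
  rw [Real.posLog, Real.log_mul (inv_ne_zero hr.ne') ht.ne', Real.log_inv]
  congr 1; ring

/-- The mean value defect of `log (1 / |z|)` at scale `r` is `lam r`. The constant `C` serves only
to keep the kernel nonnegative on the points involved. -/
lemma lam_eq_lmean_add {C r : ℝ} {z : ℂ} (hr : 0 < r) (hC : ‖z‖ + r ≤ C) :
    lam C z = lmean (lam C) z r + lam r z := by
  rcases eq_or_ne z 0 with rfl | hz
  · simp
  have hz' := norm_pos_iff.2 hz
  have h1 : Real.log ‖z‖ ≤ Real.log C := Real.log_le_log hz' (by linarith)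
  have h2 : Real.log r ≤ Real.log C := Real.log_le_log hr (by linarith)
  rw [lmean_lam_eq hr hC, lam_of_ne_zero hz, lam_of_ne_zero hz, posLog_inv_mul hr hz']
  rcases le_total (Real.log ‖z‖) (Real.log r) with h | h
  · rw [max_eq_left (by linarith), ← ENNReal.ofReal_add (by linarith) (by linarith)]
    congr 1; ring
  · rw [max_eq_right (by linarith), ENNReal.ofReal_of_nonpos (sub_nonpos.2 h)]
    rw [add_zero]; congr 1; ring

/-- This is `(1 - A_r) lam ρ = (1 - A_ρ) lam r` without subtractions. Both sides come from `(1 -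
A_r)(1 - A_ρ) lam C` for a large `C`, and circle means commute. -/
lemma lam_add_lmean_lam {r ρ : ℝ} (hr : 0 < r) (hρ : 0 < ρ) (z : ℂ) :
    lam ρ z + lmean (lam r) z ρ = lmean (lam ρ) z r + lam r z := by
  set C := ‖z‖ + r + ρ
  have key : ∀ {r ρ : ℝ}, 0 < r → 0 < ρ → C = ‖z‖ + r + ρ → lam C z =
      lam ρ z + lmean (lam r) z ρ + lmean (fun x => lmean (lam C) x r) z ρ := by
    intro r ρ hr hρ hC
    rw [lam_eq_lmean_add (z := z) hρ (by linarith : _ ≤ C), add_assoc, add_comm]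
    congr 1
    rw [add_comm, ← lmean_add (by fun_prop)]
    refine lmean_congr hρ.le fun x hx => ?_
    refine lam_eq_lmean_add hr ?_
    have : ‖x‖ ≤ ‖z‖ + ‖x - z‖ := by simpa using norm_add_le z (x - z)
    rw [mem_sphere_iff_norm.1 hx] at this
    linarith
  have h1 := key hr hρ rfl
  have h2 := key hρ hr (by simp only [C]; ring)
  rw [lmean_comm (by fun_prop)] at h2
  -- The common term has to be finite to cancel. Means of `lam C` over circles of radius `r` stay
  -- below `log C - log r`, even through the pole.
  have h3 : lmean (fun x => lmean (lam C) x r) z ρ ≠ ⊤ := by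
    refine ne_top_of_le_ne_top (b := ENNReal.ofReal (Real.log C - Real.log r)) (by simp) ?_
    rw [← lmean_const (ENNReal.ofReal (Real.log C - Real.log r)) z ρ]
    refine lmean_mono hρ.le fun x hx => ?_
    have : ‖x‖ ≤ ‖z‖ + ‖x - z‖ := by simpa using norm_add_le z (x - z)
    rw [mem_sphere_iff_norm.1 hx] at this
    rw [lmean_lam_eq hr (by simp only [C]; linarith)]
    gcongr
    linarith [Real.posLog_nonneg (x := r⁻¹ * ‖x‖)]
  rw [h1, ENNReal.add_left_inj h3] at h2
  rw [h2, add_comm]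

lemma lintegral_lam_ne_top {r : ℝ} (hr : 0 < r) : ∫⁻ z, lam r z ≠ ⊤ := by
  set f : ℝ → ℝ := fun y => max (Real.log r - Real.log y) 0
  have hf : Integrable (fun z : ℂ => f ‖z‖) := by
    rw [integrable_fun_norm_addHaar, Complex.finrank_real_complex]
    have h1 : IntegrableOn (fun _ : ℝ => r) (Ioc 0 r) := integrableOn_const (by simp)
    have h2 := h1.integrable_indicator measurableSet_Ioc
    refine Integrable.mono' h2.integrableOn (by fun_prop) ?_
    refine (ae_restrict_iff' measurableSet_Ioi).2 (.of_forall fun y (hy : 0 < y) => ?_)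
    simp only [f, Nat.add_one_sub_one, pow_one, smul_eq_mul]
    rw [Real.norm_of_nonneg (by positivity)]
    by_cases hyr : y ≤ r
    · rw [indicator_of_mem (by exact ⟨hy, hyr⟩),
        max_eq_left (sub_nonneg.2 (Real.log_le_log hy hyr)), ← Real.log_div hr.ne' hy.ne']
      calc y * Real.log (r / y) ≤ y * (r / y) := by
            gcongr; exact Real.log_le_self (by positivity)
        _ = r := by field_simp
    · rw [indicator_of_notMem (by simp [hyr]), max_eq_right, mul_zero]
      exact sub_nonpos.2 (Real.log_le_log hr (not_le.1 hyr).le)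
  have h3 : ∫⁻ z, lam r z = ∫⁻ z : ℂ, ENNReal.ofReal (f ‖z‖) := by
    refine lintegral_congr_ae ?_
    have : ∀ᵐ z : ℂ, z ≠ 0 := by simp [ae_iff]
    filter_upwards [this] with z hz
    rw [lam_of_ne_zero hz]
    simp [f, ENNReal.ofReal_max]
  rw [h3]
  exact hf.lintegral_lt_top.ne

lemma lintegral_lam_ne_zero {r : ℝ} (hr : 0 < r) : ∫⁻ z, lam r z ≠ 0 := by
  rw [ne_eq, lintegral_eq_zero_iff (by fun_prop)]
  intro h
  have h1 : ball (0 : ℂ) r ⊆ {z | ¬ lam r z = (0 : ℂ → ℝ≥0∞) z} := fun z hz => by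
    rcases eq_or_ne z 0 with rfl | hz0
    · simp
    · simp only [mem_ofPred_eq, lam_of_ne_zero hz0, Pi.zero_apply, ENNReal.ofReal_eq_zero, not_le,
        sub_pos]
      exact Real.log_lt_log (norm_pos_iff.2 hz0) (by simpa using hz)
  have h2 : volume (ball (0 : ℂ) r) = 0 := measure_mono_null h1 h
  exact (measure_ball_pos volume (0 : ℂ) hr).ne' h2

/-! ### The Green function of a disc -/

/-- The positive part of the Green function `log |(R² - z̄ w) / (R (z - w))|` of the disc of
radius `R`. -/
def green (R : ℝ) (z w : ℂ) : ℝ≥0∞ :=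
  if z = w then ⊤ else ENNReal.ofReal
    (Real.log ‖(R : ℂ) ^ 2 - starRingEnd ℂ z * w‖ - Real.log R - Real.log ‖z - w‖)

lemma norm_sq_sub_conj_mul_comm (R : ℝ) (z w : ℂ) :
    ‖(R : ℂ) ^ 2 - starRingEnd ℂ z * w‖ = ‖(R : ℂ) ^ 2 - starRingEnd ℂ w * z‖ := by
  rw [← Complex.norm_conj]
  simp [mul_comm]

lemma green_of_ne {R : ℝ} {z w : ℂ} (h : z ≠ w) : green R z w = ENNReal.ofReal
    (Real.log ‖(R : ℂ) ^ 2 - starRingEnd ℂ z * w‖ - Real.log R - Real.log ‖z - w‖) := if_neg h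

@[simp] lemma green_self (R : ℝ) (z : ℂ) : green R z z = ⊤ := if_pos rfl

lemma measurable_green (R : ℝ) : Measurable (Function.uncurry (green R)) := by
  unfold green Function.uncurry
  refine Measurable.ite (measurableSet_eq_fun (by fun_prop) (by fun_prop)) measurable_const ?_
  have : Continuous fun z : ℂ => starRingEnd ℂ z := Complex.continuous_conj
  have := this.measurable
  fun_prop

/-- The product on the right decides the sign of the Green expression: nonnegative for two points of
the disc, nonpositive if exactly one lies outside. -/
lemma norm_sq_identity (R : ℝ) (z w : ℂ) :
    ‖(R : ℂ) ^ 2 - starRingEnd ℂ z * w‖ ^ 2 =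
      (R * ‖z - w‖) ^ 2 + (R ^ 2 - ‖z‖ ^ 2) * (R ^ 2 - ‖w‖ ^ 2) := by
  have h : ((R : ℂ) ^ 2).re = R ^ 2 ∧ ((R : ℂ) ^ 2).im = 0 := by
    constructor <;> simp [pow_two]
  rw [mul_pow]
  simp only [← Complex.normSq_eq_norm_sq, Complex.normSq_apply]
  simp only [Complex.sub_re, Complex.sub_im, Complex.mul_re, Complex.mul_im, Complex.conj_re,
    Complex.conj_im, h.1, h.2]
  ring

lemma le_norm_sq_sub_conj_mul {R : ℝ} {z w : ℂ} (hz : ‖z‖ ≤ R) (hw : ‖w‖ ≤ R) :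
    R * ‖z - w‖ ≤ ‖(R : ℂ) ^ 2 - starRingEnd ℂ z * w‖ := by
  have hR : 0 ≤ R := (norm_nonneg z).trans hz
  refine le_of_sq_le_sq ?_ (norm_nonneg _) 
  rw [norm_sq_identity]
  have h1 : ‖z‖ ^ 2 ≤ R ^ 2 := by gcongr
  have h2 : ‖w‖ ^ 2 ≤ R ^ 2 := by gcongr
  nlinarith [mul_nonneg (sub_nonneg.2 h1) (sub_nonneg.2 h2)]

lemma norm_sq_sub_conj_mul_le {R : ℝ} {z w : ℂ} (hz : R ≤ ‖z‖) (hw : ‖w‖ ≤ R) (hR : 0 ≤ R) :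
    ‖(R : ℂ) ^ 2 - starRingEnd ℂ z * w‖ ≤ R * ‖z - w‖ := by
  refine le_of_sq_le_sq ?_ (by positivity)
  rw [norm_sq_identity]
  have h1 : R ^ 2 ≤ ‖z‖ ^ 2 := by gcongr
  have h2 : ‖w‖ ^ 2 ≤ R ^ 2 := by gcongr
  nlinarith [mul_nonneg (sub_nonneg.2 h1) (sub_nonneg.2 h2)]

lemma sub_le_norm_sq_sub_conj_mul (R : ℝ) (z w : ℂ) :
    R ^ 2 - ‖z‖ * ‖w‖ ≤ ‖(R : ℂ) ^ 2 - starRingEnd ℂ z * w‖ := by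
  have := norm_sub_norm_le ((R : ℂ) ^ 2) (starRingEnd ℂ z * w)
  simpa using this

lemma green_real_nonneg {R : ℝ} {z w : ℂ} (hR : 0 < R) (hz : ‖z‖ ≤ R) (hw : ‖w‖ ≤ R) (h : z ≠ w) :
    0 ≤ Real.log ‖(R : ℂ) ^ 2 - starRingEnd ℂ z * w‖ - Real.log R - Real.log ‖z - w‖ := by
  have h1 : 0 < ‖z - w‖ := norm_pos_iff.2 (sub_ne_zero.2 h)
  have := Real.log_le_log (by positivity) (le_norm_sq_sub_conj_mul hz hw)
  rw [Real.log_mul hR.ne' h1.ne'] at this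
  linarith

lemma circleIntegrable_green {R r : ℝ} (z w : ℂ) :
    CircleIntegrable (fun x => Real.log ‖(R : ℂ) ^ 2 - starRingEnd ℂ z * x‖ - Real.log R -
      Real.log ‖x - z‖) w r :=
  ((MeromorphicOn.circleIntegrable_log_norm (f := fun x => (R : ℂ) ^ 2 - starRingEnd ℂ z * x)
    (fun _ _ ↦ by fun_prop)).sub (circleIntegrable_const _ _ _)).sub
    (circleIntegrable_log_norm_sub z w r)

/-- The hypothesis keeps the zero of `R² - z̄x` off the closed disc, so that its logarithm is
harmonic there; `log |x - z|` is averaged by Jensen's formula, whether or not the circle encloses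
`z`. -/
lemma circleAverage_green {R r : ℝ} {z w : ℂ} (hr : 0 < r) (h : ‖z‖ * (‖w‖ + r) < R ^ 2) :
    Real.circleAverage (fun x => Real.log ‖(R : ℂ) ^ 2 - starRingEnd ℂ z * x‖ - Real.log R -
      Real.log ‖x - z‖) w r = Real.log ‖(R : ℂ) ^ 2 - starRingEnd ℂ z * w‖ - Real.log R -
      (Real.log r + Real.posLog (r⁻¹ * ‖w - z‖)) := by
  have h1 := MeromorphicOn.circleIntegrable_log_norm (c := w) (R := r)
    (f := fun x => (R : ℂ) ^ 2 - starRingEnd ℂ z * x) (fun _ _ ↦ by fun_prop)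
  have h2 := h1.sub (circleIntegrable_const (Real.log R) w r)
  have h3 := Real.circleAverage_sub h2 (circleIntegrable_log_norm_sub z w r)
  have h4 := Real.circleAverage_sub h1 (circleIntegrable_const (Real.log R) w r)
  have h5 : InnerProductSpace.HarmonicOnNhd
      (fun x => Real.log ‖(R : ℂ) ^ 2 - starRingEnd ℂ z * x‖) (closedBall w |r|) := fun x hx => by
    refine AnalyticAt.harmonicAt_log_norm (f := fun x => (R : ℂ) ^ 2 - starRingEnd ℂ z * x)
      (by fun_prop) fun h0 => ?_
    rw [abs_of_pos hr, mem_closedBall_iff_norm] at hx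
    have h6 : ‖x‖ ≤ ‖w‖ + ‖x - w‖ := by simpa using norm_add_le w (x - w)
    have h7 := sub_le_norm_sq_sub_conj_mul R z x
    rw [h0, norm_zero] at h7
    nlinarith [norm_nonneg z]
  rw [h5.circleAverage_eq, Real.circleAverage_const] at h4
  rw [h4, circleAverage_log_norm_sub_const_eq_log_radius_add_posLog hr.ne'] at h3
  exact h3

lemma green_eq_lmean_add {R r : ℝ} {z w : ℂ} (hr : 0 < r) (hz : ‖z‖ < R) (hw : ‖w‖ + r ≤ R) :
    green R z w = lmean (green R z) w r + lam r (z - w) := by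
  rcases eq_or_ne z w with rfl | h
  · simp
  have hR : 0 < R := (norm_nonneg z).trans_lt hz
  have h1 : ‖z‖ * (‖w‖ + r) < R ^ 2 := by
    calc ‖z‖ * (‖w‖ + r) ≤ ‖z‖ * R := by gcongr
      _ < R * R := by gcongr
      _ = R ^ 2 := by ring
  have hzw : 0 < ‖z - w‖ := norm_pos_iff.2 (sub_ne_zero.2 h)
  have hn : ∀ x ∈ closedBall w r, ‖x‖ ≤ R := fun x hx => by
    have h6 : ‖x‖ ≤ ‖w‖ + ‖x - w‖ := by simpa using norm_add_le w (x - w)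
    have := mem_closedBall_iff_norm.1 hx
    linarith
  have h2 := lmean_eq_ofReal (F := green R z) z hr (circleIntegrable_green (R := R) z w)
    (fun x hx hxz => by
      have h3 := green_real_nonneg hR hz.le (hn x (sphere_subset_closedBall hx)) hxz.symm
      have h4 := green_of_ne (R := R) hxz.symm
      rw [norm_sub_rev z x] at h3 h4
      exact ⟨h4, h3⟩)
  have hA : 0 ≤ Real.circleAverage (fun x => Real.log ‖(R : ℂ) ^ 2 - starRingEnd ℂ z * x‖ -
      Real.log R - Real.log ‖x - z‖) w r := by
    rw [circleAverage_eq_integral_e]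
    refine integral_nonneg_of_ae ?_
    filter_upwards [ae_add_mul_e_ne w z hr _] with θ hθ
    have := green_real_nonneg hR hz.le (hn (w + r * e θ) (by simp [abs_of_pos hr])) hθ.symm
    rwa [norm_sub_rev z] at this
  rw [circleAverage_green hr h1] at h2 hA
  rw [h2, green_of_ne h, lam_of_ne_zero (sub_ne_zero.2 h)]
  rw [norm_sub_rev w z, posLog_inv_mul hr hzw] at hA ⊢
  rcases le_total (Real.log ‖z - w‖) (Real.log r) with h | h
  · rw [max_eq_left (by linarith)] at hA ⊢
    rw [← ENNReal.ofReal_add (by linarith) (by linarith)]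
    congr 1; ring
  · rw [max_eq_right (by linarith), ENNReal.ofReal_of_nonpos (sub_nonpos.2 h)]
    rw [add_zero]; congr 1; ring

end EffectiveRiesz

end

noncomputable section

namespace EffectiveRiesz

open Set Filter Topology

/-! ### The mean value property and the Laplacian -/

/-- Second order Taylor expansion with Peano remainder. -/
lemma exists_taylor_two_bound {f : ℂ → ℝ} {z : ℂ} (hf : ContDiffAt ℝ 2 f z) {ε : ℝ} (hε : 0 < ε) :
    ∃ δ > 0, ∀ h : ℂ, ‖h‖ < δ → |f (z + h) - f z - fderiv ℝ f z h -
      (1 / 2) * fderiv ℝ (fderiv ℝ f) z h h| ≤ ε * ‖h‖ ^ 2 := by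
  set L := fderiv ℝ (fderiv ℝ f) z
  have hsymm : IsSymmSndFDerivAt ℝ f z := hf.isSymmSndFDerivAt (by simp)
  have hd : ∀ᶠ x in 𝓝 z, DifferentiableAt ℝ f x := by
    filter_upwards [hf.eventually (by simp)] with x hx using hx.differentiableAt (by simp)
  have hD : HasFDerivAt (fderiv ℝ f) L z :=
    ((hf.fderiv_right (m := 1) (by norm_num)).differentiableAt (by simp)).hasFDerivAt
  have ho := (hasFDerivAt_iff_isLittleO_nhds_zero.1 hD).def hε
  have hd' : ∀ᶠ h in 𝓝 (0 : ℂ), DifferentiableAt ℝ f (z + h) := by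
    have : Tendsto (fun h => z + h) (𝓝 (0 : ℂ)) (𝓝 z) := by
      simpa using (continuous_const_add z).tendsto 0
    exact this.eventually hd
  obtain ⟨δ, hδ, hb⟩ := Metric.eventually_nhds_iff.1 (ho.and hd')
  refine ⟨δ, hδ, fun h hh => ?_⟩
  have hsub : ∀ y ∈ closedBall (0 : ℂ) ‖h‖, dist y 0 < δ := fun y hy => by
    have : ‖y‖ ≤ ‖h‖ := by simpa using hy
    simpa using this.trans_lt hh
  -- Mean value inequality for the remainder itself. Since `L` is symmetric, its derivative is the
  -- first-order remainder of `fderiv ℝ f`, at most `ε * ‖h‖` on this ball.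
  have key := (convex_closedBall (0 : ℂ) ‖h‖).norm_image_sub_le_of_norm_hasFDerivWithin_le
    (f := fun y => f (z + y) - f z - fderiv ℝ f z y - (1 / 2) * L y y)
    (f' := fun y => fderiv ℝ f (z + y) - fderiv ℝ f z - L y) (C := ε * ‖h‖) (x := 0) (y := h)
    (fun y hy => ?_) (fun y hy => ?_) (by simp) (by simp)
  · simp only [add_zero, sub_self, map_zero, mul_zero, sub_zero] at key
    rw [Real.norm_eq_abs] at key
    calc _ ≤ _ := key
      _ = _ := by ring
  · have h1 : HasFDerivAt (fun y => f (z + y)) (fderiv ℝ f (z + y)) y := by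
      have := ((hb (hsub y hy)).2).hasFDerivAt.comp y ((hasFDerivAt_id y).const_add z)
      simpa [Function.comp_def] using this
    have h2 : HasFDerivAt (fun y => L y y) (L y + L.flip y) y := by
      have := (L.hasFDerivAt (x := y)).clm_apply (hasFDerivAt_id y)
      simpa using this
    have h3 : L.flip y = L y := by
      ext x; exact hsymm.eq x y
    refine HasFDerivAt.hasFDerivWithinAt ?_
    have h4 := ((h1.sub_const (f z)).sub (fderiv ℝ f z).hasFDerivAt).sub (h2.const_mul (1 / 2))
    rw [h3, ← two_smul ℝ (L y), smul_smul] at h4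
    norm_num at h4
    exact h4
  · refine ((hb (hsub y hy)).1).trans ?_
    have : ‖y‖ ≤ ‖h‖ := by simpa using hy
    gcongr

/-- Sum `f` over the square `z ± h`, `z ± ih`. The first-order terms cancel and the second-order
terms add up to `|h|² Δf(z)` for every direction of `h`. Averaging over directions removes the sum
by the mean value property and leaves `r² |Δf(z)| ≤ ε r²`. -/
lemma laplacian_eq_zero_of_circleAverage_eq {f : ℂ → ℝ} {z : ℂ} (hf : ContDiffAt ℝ 2 f z)
    (hmean : ∀ᶠ r in 𝓝[>] (0 : ℝ), Real.circleAverage f z r = f z) :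
    Laplacian.laplacian f z = 0 := by
  set L := fderiv ℝ (fderiv ℝ f) z
  have hlap : Laplacian.laplacian f z = L 1 1 + L Complex.I Complex.I := by
    rw [InnerProductSpace.laplacian_eq_iteratedFDeriv_complexPlane]
    simp [iteratedFDeriv_two_apply, L]
  set lap := Laplacian.laplacian f z
  refine abs_eq_zero.1 (le_antisymm (le_of_forall_pos_le_add fun ε hε => ?_) (abs_nonneg _))
  -- A quarter of `ε` for each vertex of the square.
  obtain ⟨δ, hδ, hT⟩ := exists_taylor_two_bound hf (ε := ε / 4) (by positivity)
  have hcont : ∀ᶠ x in 𝓝 z, ContinuousAt f x := by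
    filter_upwards [hf.eventually (by simp)] with x hx using hx.continuousAt
  obtain ⟨δ', hδ', hc⟩ := Metric.eventually_nhds_iff.1 hcont
  have h1 : ∀ᶠ r in 𝓝[>] (0 : ℝ), r < min δ δ' :=
    nhdsWithin_le_nhds (gt_mem_nhds (lt_min hδ hδ'))
  obtain ⟨r, hr0, hrm, hr⟩ := (eventually_mem_nhdsWithin.and (hmean.and h1)).exists
  have hr0 : 0 < r := hr0
  set h : ℝ → ℂ := fun θ => circleMap 0 r θ
  have hnorm : ∀ θ, ‖h θ‖ = r := fun θ => by simp [h, abs_of_pos hr0]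
  set S : ℝ → ℝ := fun θ => f (z + h θ) + f (z + Complex.I * h θ) + f (z + -h θ) +
    f (z + Complex.I * -h θ) - 4 * f z
  have hS : ∀ θ, |S θ - r ^ 2 * lap| ≤ ε * r ^ 2 := fun θ => by
    have t1 := hT (h θ) (by rw [hnorm]; exact hr.trans_le (min_le_left _ _))
    have t2 := hT (Complex.I * h θ) (by
      rw [norm_mul, Complex.norm_I, one_mul, hnorm]; exact hr.trans_le (min_le_left _ _))
    have t3 := hT (-h θ) (by rw [norm_neg, hnorm]; exact hr.trans_le (min_le_left _ _))
    have t4 := hT (Complex.I * -h θ) (by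
      rw [norm_mul, Complex.norm_I, one_mul, norm_neg, hnorm]; exact hr.trans_le (min_le_left _ _))
    have hLL : L (h θ) (h θ) + L (Complex.I * h θ) (Complex.I * h θ) = r ^ 2 * lap := by
      rw [hlap, ← hnorm θ, ← Complex.normSq_eq_norm_sq, Complex.normSq_apply]
      generalize h θ = x
      have h1 : x = x.re • (1 : ℂ) + x.im • Complex.I := by apply Complex.ext <;> simp
      have h2 : Complex.I * x = -x.im • (1 : ℂ) + x.re • Complex.I := by
        apply Complex.ext <;> simp
      have h3 : ∀ a b : ℝ, L (a • (1 : ℂ) + b • Complex.I) (a • (1 : ℂ) + b • Complex.I) =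
          a * a * L 1 1 + a * b * (L 1 Complex.I + L Complex.I 1) +
            b * b * L Complex.I Complex.I := fun a b => by
        simp only [map_add, map_smul, add_apply, smul_apply, smul_eq_mul]
        ring
      rw [h2, h3]
      have h4 := h3 x.re x.im
      rw [← h1] at h4
      rw [h4]; ring
    simp only [mul_neg, map_neg, neg_apply, neg_neg, norm_neg, norm_mul,
      Complex.norm_I, one_mul, hnorm] at t1 t2 t3 t4
    simp only [S, mul_neg]
    rw [abs_le] at *
    constructor <;> linarith [t1.1, t1.2, t2.1, t2.2, t3.1, t3.2, t4.1, t4.2]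
  have hcirc : ∀ η : ℝ, IntervalIntegrable (fun θ => f (circleMap z r (θ + η))) volume 0
      (2 * Real.pi) := fun η => by
    refine (continuous_iff_continuousAt.2 fun θ => ?_).intervalIntegrable _ _
    refine ContinuousAt.comp (f := fun θ => circleMap z r (θ + η)) (g := f) (hc ?_) (by fun_prop)
    rw [mem_sphere.1 (circleMap_mem_sphere z hr0.le (θ + η))]
    exact hr.trans_le (min_le_right _ _)
  have hav : ∀ η : ℝ, ∫ θ in (0)..(2 * Real.pi), f (circleMap z r (θ + η)) =
      2 * Real.pi * f z := fun η => by
    have := Real.circleAverage_eq_integral_add (f := f) (c := z) (R := r) η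
    rw [hrm, smul_eq_mul] at this
    rw [this, mul_inv_cancel_left₀ (by positivity)]
  have hrot : ∀ θ, S θ = f (circleMap z r (θ + 0)) + f (circleMap z r (θ + Real.pi / 2)) +
      f (circleMap z r (θ + Real.pi)) + f (circleMap z r (θ + (Real.pi / 2 + Real.pi))) -
      4 * f z := fun θ => by
    have r0 : circleMap z r (θ + 0) = z + h θ := by simp [h, circleMap]
    have r1 : ∀ t, circleMap z r (t + Real.pi / 2) = z + Complex.I * h t := fun t => by
      simp only [h, circleMap]; push_cast
      rw [add_mul, Complex.exp_add, Complex.exp_pi_div_two_mul_I]; ring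
    have r2 : h (θ + Real.pi) = -h θ := by
      simp only [h, circleMap]; push_cast
      rw [add_mul, Complex.exp_add, Complex.exp_pi_mul_I]; ring
    have r3 : circleMap z r (θ + Real.pi) = z + h (θ + Real.pi) := by simp [h, circleMap]
    rw [r0, r1, r3, add_comm (Real.pi / 2), ← add_assoc, r1, r2]
  have hSint : ∫ θ in (0)..(2 * Real.pi), (S θ - r ^ 2 * lap) = -(2 * Real.pi) * (r ^ 2 * lap) := by
    simp only [hrot]
    rw [intervalIntegral.integral_sub
      (((((hcirc _).add (hcirc _)).add (hcirc _)).add (hcirc _)).sub (by simp)) (by simp),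
      intervalIntegral.integral_sub ((((hcirc _).add (hcirc _)).add (hcirc _)).add (hcirc _))
      (by simp), intervalIntegral.integral_add (((hcirc _).add (hcirc _)).add (hcirc _)) (hcirc _),
      intervalIntegral.integral_add ((hcirc _).add (hcirc _)) (hcirc _),
      intervalIntegral.integral_add (hcirc _) (hcirc _), hav, hav, hav, hav]
    simp only [intervalIntegral.integral_const, smul_eq_mul]
    ring
  have hle := intervalIntegral.norm_integral_le_of_norm_le_const (a := 0) (b := 2 * Real.pi)
    (f := fun θ => S θ - r ^ 2 * lap) (C := ε * r ^ 2) fun θ _ => hS θ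
  rw [hSint, Real.norm_eq_abs, abs_mul, abs_neg, sub_zero, abs_of_pos Real.two_pi_pos, abs_mul,
    abs_of_pos (by positivity : 0 < r ^ 2)] at hle
  have h5 : (2 * Real.pi * r ^ 2) * |lap| ≤ (2 * Real.pi * r ^ 2) * ε := by linarith
  rw [zero_add]
  exact le_of_mul_le_mul_left h5 (by positivity)

end EffectiveRiesz

end

noncomputable section

namespace EffectiveRiesz

open Set Filter Topology

/-! ### Radial mollifiers -/

/-- An unnormalised smooth radial bump supported in the disc of radius `δ`. -/
def bump (δ : ℝ) (z : ℂ) : ℝ := Real.smoothTransition (1 - ‖z‖ ^ 2 / δ ^ 2)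

/-- The normalised smooth radial mollifier, supported in the disc of radius `δ`. -/
def mollReal (δ : ℝ) (z : ℂ) : ℝ := bump δ z / ∫ y, bump δ y

/-- The mollifier as a `[0, ∞]`-valued weight. -/
def moll (δ : ℝ) (z : ℂ) : ℝ≥0∞ := ENNReal.ofReal (mollReal δ z)

lemma contDiff_bump (δ : ℝ) : ContDiff ℝ 2 (bump δ) := by
  unfold bump
  exact (Real.smoothTransition.contDiff (n := 2)).comp
    (contDiff_const.sub ((contDiff_norm_sq ℝ).div_const _))

lemma bump_nonneg (δ : ℝ) (z : ℂ) : 0 ≤ bump δ z := Real.smoothTransition.nonneg _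

lemma bump_ne_zero_iff {δ : ℝ} (hδ : 0 < δ) {z : ℂ} : bump δ z ≠ 0 ↔ ‖z‖ < δ := by
  rw [bump, ne_eq, Real.smoothTransition.zero_iff_nonpos, not_le, sub_pos,
    div_lt_one (by positivity), sq_lt_sq₀ (norm_nonneg _) hδ.le]

lemma hasCompactSupport_bump {δ : ℝ} (hδ : 0 < δ) : HasCompactSupport (bump δ) :=
  HasCompactSupport.intro (isCompact_closedBall 0 δ) fun z hz => by
    by_contra h
    exact hz (by simpa using ((bump_ne_zero_iff hδ).1 h).le)

lemma integral_bump_pos {δ : ℝ} (hδ : 0 < δ) : 0 < ∫ y, bump δ y :=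
  (contDiff_bump δ).continuous.integral_pos_of_hasCompactSupport_nonneg_nonzero
    (hasCompactSupport_bump hδ) (bump_nonneg δ) ((bump_ne_zero_iff (z := 0) hδ).2 (by simpa))

lemma contDiff_mollReal (δ : ℝ) : ContDiff ℝ 2 (mollReal δ) := (contDiff_bump δ).div_const _

lemma hasCompactSupport_mollReal {δ : ℝ} (hδ : 0 < δ) : HasCompactSupport (mollReal δ) := by
  have := (hasCompactSupport_bump hδ).mul_right (f' := fun _ => (∫ y, bump δ y)⁻¹)
  exact this

lemma mollReal_nonneg {δ : ℝ} (hδ : 0 < δ) (z : ℂ) : 0 ≤ mollReal δ z :=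
  div_nonneg (bump_nonneg δ z) (integral_bump_pos hδ).le

lemma mollReal_neg (δ : ℝ) (z : ℂ) : mollReal δ (-z) = mollReal δ z := by simp [mollReal, bump]

@[fun_prop] lemma measurable_moll (δ : ℝ) : Measurable (moll δ) := by
  have := (contDiff_mollReal δ).continuous.measurable
  unfold moll; fun_prop

lemma isRadial_moll (δ : ℝ) : IsRadial (moll δ) := fun z w h => by
  simp [moll, mollReal, bump, h]

lemma norm_lt_of_moll_ne_zero {δ : ℝ} (hδ : 0 < δ) {z : ℂ} (h : moll δ z ≠ 0) : ‖z‖ < δ := by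
  refine (bump_ne_zero_iff hδ).1 fun h0 => h ?_
  simp [moll, mollReal, h0]

lemma lintegral_moll {δ : ℝ} (hδ : 0 < δ) : ∫⁻ z, moll δ z = 1 := by
  unfold moll
  rw [← ofReal_integral_eq_lintegral_ofReal
    ((contDiff_mollReal δ).continuous.integrable_of_hasCompactSupport
      (hasCompactSupport_mollReal hδ)) (.of_forall fun z => mollReal_nonneg hδ z)]
  simp only [mollReal]
  rw [integral_div, div_self (integral_bump_pos hδ).ne', ENNReal.ofReal_one]

lemma exists_moll_le {δ : ℝ} (hδ : 0 < δ) : ∃ C : ℝ≥0∞, C ≠ ⊤ ∧ ∀ z, moll δ z ≤ C := by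
  obtain ⟨C, hC⟩ := (hasCompactSupport_mollReal hδ).exists_bound_of_continuous
    (contDiff_mollReal δ).continuous
  exact ⟨ENNReal.ofReal C, by simp, fun z =>
    ENNReal.ofReal_le_ofReal ((Real.le_norm_self _).trans (hC z))⟩

variable {f : ℂ → ℝ≥0∞}

lemma exists_lconv_moll_le {δ : ℝ} (hδ : 0 < δ) (hint : ∫⁻ z, f z ≠ ⊤) :
    ∃ C : ℝ≥0∞, C ≠ ⊤ ∧ ∀ w, lconv (moll δ) f w ≤ C := by
  obtain ⟨C, hC, hb⟩ := exists_moll_le hδ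
  refine ⟨C * ∫⁻ z, f z, ENNReal.mul_ne_top hC hint, fun w => ?_⟩
  rw [← lintegral_add_left_eq_self f w, ← lintegral_const_mul' _ _ hC]
  exact lintegral_mono fun z => mul_le_mul_left (hb z) _

lemma lconv_moll_ne_top {δ : ℝ} (hδ : 0 < δ) (hint : ∫⁻ z, f z ≠ ⊤) (w : ℂ) :
    lconv (moll δ) f w ≠ ⊤ := by
  obtain ⟨C, hC, hb⟩ := exists_lconv_moll_le hδ hint
  exact ne_top_of_le_ne_top hC (hb w)

lemma contDiff_toReal_lconv_moll {δ : ℝ} (hδ : 0 < δ) (hf : Measurable f) (hint : ∫⁻ z, f z ≠ ⊤) :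
    ContDiff ℝ 2 fun w => (lconv (moll δ) f w).toReal := by
  have hi : Integrable fun z => (f z).toReal := integrable_toReal_of_lintegral_ne_top
    hf.aemeasurable hint
  have h := (hasCompactSupport_mollReal hδ).contDiff_convolution_right
    (ContinuousLinearMap.mul ℝ ℝ) (n := 2) hi.locallyIntegrable (contDiff_mollReal δ)
  have heq : (fun w => (lconv (moll δ) f w).toReal) =
      convolution (fun z => (f z).toReal) (mollReal δ) (ContinuousLinearMap.mul ℝ ℝ) volume := by
    ext w
    rw [convolution_def, lconv_eq_lintegral_sub, ← integral_toReal]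
    · refine integral_congr_ae (.of_forall fun z => ?_)
      simp only [ENNReal.toReal_mul, ContinuousLinearMap.mul_apply']
      rw [moll, ENNReal.toReal_ofReal (mollReal_nonneg hδ _), ← mollReal_neg, neg_sub, mul_comm]
    · fun_prop
    · refine ae_lt_top (by fun_prop) ?_
      rw [← lconv_eq_lintegral_sub]
      exact lconv_moll_ne_top hδ hint w
  rw [heq]
  exact_mod_cast h

lemma lconv_moll_eq_ofReal {δ : ℝ} (hδ : 0 < δ) (hint : ∫⁻ z, f z ≠ ⊤) (w : ℂ) :
    lconv (moll δ) f w = ENNReal.ofReal (lconv (moll δ) f w).toReal :=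
  (ENNReal.ofReal_toReal (lconv_moll_ne_top hδ hint w)).symm

lemma lmean_lconv_moll {δ : ℝ} (hδ : 0 < δ) (hf : Measurable f) (hint : ∫⁻ z, f z ≠ ⊤) (w : ℂ)
    {r : ℝ} (hr : 0 < r) : lmean (lconv (moll δ) f) w r =
      ENNReal.ofReal (Real.circleAverage (fun x => (lconv (moll δ) f x).toReal) w r) :=
  lmean_eq_ofReal w hr
    ((contDiff_toReal_lconv_moll hδ hf hint).continuous.continuousOn.circleIntegrable hr.le)
    fun x _ _ => ⟨lconv_moll_eq_ofReal hδ hint x, ENNReal.toReal_nonneg⟩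

lemma lowerSemicontinuous_lconv_moll (δ : ℝ) (hf : LowerSemicontinuous f) :
    LowerSemicontinuous (lconv (moll δ) f) := fun w => by
  have hm := hf.measurable
  refine lowerSemicontinuousAt_lintegral (F := fun z x => moll δ z * f (x + z))
    (fun x => by fun_prop) fun z => ?_
  have h1 : LowerSemicontinuous fun x => f (x + z) := hf.comp (by fun_prop)
  exact (Continuous.comp_lowerSemicontinuous (g := fun y => moll δ z * y)
    (ENNReal.continuous_const_mul (by simp [moll])) h1 fun a b h => mul_le_mul_right h _) w

lemma lowerSemicontinuous_lmean (hf : LowerSemicontinuous f) (r : ℝ) :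
    LowerSemicontinuous fun w => lmean f w r := fun w => by
  have hm := hf.measurable
  refine lowerSemicontinuousAt_lintegral (F := fun (θ : ℝ) (x : ℂ) => f (x + r * e θ))
    (fun x => by fun_prop) fun θ => ?_
  exact (hf.comp (g := fun x : ℂ => x + r * e θ) (by fun_prop)) w

/-- Moves the mollifier from the function to the kernel. For `b = lam ρ` the new kernel is
continuous, so it can be tested against weak limits. -/
lemma lconv_lconv_moll {b : ℂ → ℝ≥0∞} {δ : ℝ} (hb : Measurable b) (hf : Measurable f) (w : ℂ) :
    lconv b (lconv (moll δ) f) w = ∫⁻ x, lconv (moll δ) b x * f (w + x) := by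
  rw [lconv_lconv_comm hb (by fun_prop) hf, lconv_lconv (by fun_prop) hb hf]
  refine lintegral_congr fun x => ?_
  congr 1
  rw [lconv, ← lintegral_neg_eq_self]
  simp only [(isRadial_moll δ).neg, sub_neg_eq_add]

lemma norm_lt_of_lconv_moll_ne_zero {b : ℂ → ℝ≥0∞} {δ ρ : ℝ} (hδ : 0 < δ)
    (hb : ∀ z, b z ≠ 0 → ‖z‖ < ρ) {x : ℂ} (h : lconv (moll δ) b x ≠ 0) : ‖x‖ < ρ + δ := by
  by_contra! hx
  refine h ?_
  rw [lconv]
  refine (lintegral_congr fun z => ?_).trans lintegral_zero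
  by_contra hz
  obtain ⟨h1, h2⟩ := mul_ne_zero_iff.1 hz
  have h3 := norm_lt_of_moll_ne_zero hδ h1
  have h4 := hb _ h2
  have h5 : ‖x‖ ≤ ‖x + z‖ + ‖z‖ := by simpa using norm_sub_le (x + z) z
  linarith

/-! ### Weak limits of bounded sequences of measures -/

open CompactlySupported in
/-- A bounded sequence of measures on the plane has a weak limit along an ultrafilter. -/
lemma exists_weak_limit (ν : ℕ → Measure ℂ) {C : ℝ≥0∞} (hC : C ≠ ⊤) (hν : ∀ n, ν n univ ≤ C) :
    ∃ (μ : Measure ℂ) (U : Filter ℕ), IsFiniteMeasureOnCompacts μ ∧ U.NeBot ∧ U ≤ atTop ∧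
      ∀ f : ℂ → ℝ, Continuous f → HasCompactSupport f → (∀ z, 0 ≤ f z) →
        Tendsto (fun n => ∫⁻ z, ENNReal.ofReal (f z) ∂ν n) U
          (𝓝 (∫⁻ z, ENNReal.ofReal (f z) ∂μ)) := by
  have hfin : ∀ n, IsFiniteMeasure (ν n) := fun n => ⟨(hν n).trans_lt hC.lt_top⟩
  have hint : ∀ (f : C_c(ℂ, ℝ)) (n), Integrable f (ν n) := fun f n =>
    f.continuous.integrable_of_hasCompactSupport f.hasCompactSupport
  -- The integrals of a fixed `f` stay in a compact interval. A single ultrafilter serves all `f` at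
  -- once, so no diagonal subsequence is needed and the limit is linear and positive in `f`;
  -- Riesz–Markov–Kakutani then gives the measure.
  have hlim : ∀ f : C_c(ℂ, ℝ), ∃ y : ℝ,
      Tendsto (fun n => ∫ z, f z ∂ν n) (hyperfilter ℕ) (𝓝 y) := fun f => by
    obtain ⟨M, hM⟩ := f.hasCompactSupport.exists_bound_of_continuous f.continuous
    have h1 : ∀ n, ∫ z, f z ∂ν n ∈ closedBall (0 : ℝ) (|M| * C.toReal) := fun n => by
      rw [mem_closedBall_zero_iff]
      refine (norm_integral_le_of_norm_le_const (C := |M|)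
        (.of_forall fun z => (hM z).trans (le_abs_self M))).trans ?_
      gcongr
      exact ENNReal.toReal_mono hC (hν n)
    obtain ⟨y, -, hy⟩ := (isCompact_closedBall (0 : ℝ) (|M| * C.toReal)).ultrafilter_le_nhds
      ((hyperfilter ℕ).map fun n => ∫ z, f z ∂ν n)
      (le_principal_iff.2 (Ultrafilter.mem_map.2 (univ_mem' h1)))
    exact ⟨y, hy⟩
  choose Λ hΛ using hlim
  let L : C_c(ℂ, ℝ) →ₗ[ℝ] ℝ :=
    { toFun := Λ
      map_add' := fun f g => tendsto_nhds_unique (hΛ (f + g)) (by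
        refine ((hΛ f).add (hΛ g)).congr fun n => ?_
        rw [← integral_add (hint f n) (hint g n)]; rfl)
      map_smul' := fun c f => tendsto_nhds_unique (hΛ (c • f)) (by
        refine ((hΛ f).const_smul c).congr fun n => ?_
        rw [← integral_smul]; rfl) }
  let L' : C_c(ℂ, ℝ) →ₚ[ℝ] ℝ := PositiveLinearMap.mk₀ L fun f hf =>
    ge_of_tendsto' (hΛ f) fun n => integral_nonneg hf
  refine ⟨RealRMK.rieszMeasure L', hyperfilter ℕ, inferInstance, inferInstance,
    Nat.hyperfilter_le_atTop, fun f hf hfc h0 => ?_⟩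
  let F : C_c(ℂ, ℝ) := ⟨⟨f, hf⟩, hfc⟩
  have h1 : ∫ z, f z ∂(RealRMK.rieszMeasure L') = Λ F := RealRMK.integral_rieszMeasure L' F
  have h2 := hΛ F
  rw [← h1] at h2
  have h3 := ENNReal.tendsto_ofReal h2
  rw [ofReal_integral_eq_lintegral_ofReal (hf.integrable_of_hasCompactSupport hfc)
    (.of_forall h0)] at h3
  refine h3.congr fun n => ?_
  exact ofReal_integral_eq_lintegral_ofReal (hint F n) (.of_forall h0)

end EffectiveRiesz

end

noncomputable section

namespace EffectiveRiesz

open Set Filter Topology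

/-! ### Nonnegative superharmonic functions on a disc -/

/-- `p` is superharmonic and nonnegative on the disc of radius `R`, extended by zero, and finite at
the centre. -/
structure IsSuperharmonicDisc (p : ℂ → ℝ≥0∞) (R : ℝ) : Prop where
  lsc : LowerSemicontinuous p
  mean : ∀ (z : ℂ) (r : ℝ), 0 < r → ‖z‖ + r < R → lmean p z r ≤ p z
  outside : ∀ z, R ≤ ‖z‖ → p z = 0
  finite : p 0 ≠ ⊤

/-- The mean value defect of a superharmonic function. -/
def defect (p : ℂ → ℝ≥0∞) (r : ℝ) (z : ℂ) : ℝ≥0∞ := p z - lmean p z r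

variable {p : ℂ → ℝ≥0∞} {R : ℝ}

namespace IsSuperharmonicDisc

lemma measurable (hp : IsSuperharmonicDisc p R) : Measurable p := hp.lsc.measurable

lemma measurable_defect (hp : IsSuperharmonicDisc p R) (r : ℝ) : Measurable (defect p r) := by
  have := hp.measurable
  unfold defect; fun_prop

lemma defect_add (hp : IsSuperharmonicDisc p R) {z : ℂ} {r : ℝ} (hr : 0 < r) (hz : ‖z‖ + r < R) :
    defect p r z + lmean p z r = p z := tsub_add_cancel_of_le (hp.mean z r hr hz)

/-- Integrating the super-mean value inequality at `0` over all radii below `R` bounds the integral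
by the area of the disc times `p 0`. -/
lemma lintegral_ne_top (hp : IsSuperharmonicDisc p R) : ∫⁻ z, p z ≠ ⊤ := by
  set a : ℂ → ℝ≥0∞ := (ball (0 : ℂ) R).indicator 1
  have ha : Measurable a := measurable_one.indicator measurableSet_ball
  have hr : IsRadial a := fun z w h => by simp [a, indicator, h]
  have h1 : ∫⁻ z, p z = lconv a p 0 := by
    refine lintegral_congr fun z => ?_
    by_cases hz : z ∈ ball (0 : ℂ) R
    · simp [a, hz]
    · simp only [a, indicator_of_notMem hz, zero_mul]
      exact hp.outside z (by simpa using hz)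
  rw [h1]
  refine ne_top_of_le_ne_top ?_ (hr.lconv_le ha hp.measurable (w := 0) fun z h0 hz => ?_)
  · refine ENNReal.mul_ne_top ?_ hp.finite
    rw [lintegral_indicator measurableSet_ball]
    simpa using (measure_ball_lt_top (μ := volume) (x := (0 : ℂ)) (r := R)).ne
  · refine hp.mean 0 _ (norm_pos_iff.2 h0) ?_
    have : z ∈ ball (0 : ℂ) R := by
      by_contra h
      exact hz (indicator_of_notMem h _)
    simpa using this

lemma lconv_lam_le (hp : IsSuperharmonicDisc p R) {w : ℂ} {r : ℝ} (hr : 0 < r) (hw : ‖w‖ + r ≤ R) :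
    lconv (lam r) p w ≤ (∫⁻ z, lam r z) * p w :=
  (isRadial_lam r).lconv_le (measurable_lam r) hp.measurable fun z h0 hz =>
    hp.mean w _ (norm_pos_iff.2 h0) (by linarith [norm_lt_of_lam_ne_zero hr hz])

end IsSuperharmonicDisc

/-- Outside the disc the logarithmic expression is nonpositive, so the Green function cut off by
zero dominates it and has larger circle means. Hence its defect is at most that of the pole. The
condition on `‖w‖` keeps `R² - w̄x` from vanishing within distance `r` of the disc. -/
lemma indicator_green_le_lmean_add {R r : ℝ} {w : ℂ} (hr : 0 < r) (hR : 0 < R) (hwR : ‖w‖ ≤ R)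
    (h : ‖w‖ * (R + r) < R ^ 2) (z : ℂ) :
    (ball (0 : ℂ) R).indicator (fun z => green R z w) z ≤
      lmean ((ball (0 : ℂ) R).indicator fun z => green R z w) z r + lam r (z - w) := by
  by_cases hz : z ∈ ball (0 : ℂ) R
  swap
  · simp [indicator_of_notMem hz]
  rw [indicator_of_mem hz]
  have hz' : ‖z‖ < R := by simpa using hz
  have h' : ‖w‖ * (‖z‖ + r) < R ^ 2 := by
    refine lt_of_le_of_lt ?_ h
    gcongr
  rcases eq_or_ne z w with rfl | hne
  · simp
  have hzw : 0 < ‖z - w‖ := norm_pos_iff.2 (sub_ne_zero.2 hne)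
  have h2 := ofReal_circleAverage_le_lmean
    (F := (ball (0 : ℂ) R).indicator fun z => green R z w) w hr
    (circleIntegrable_green (R := R) w z) (fun x hx hxz => by
      by_cases hxR : x ∈ ball (0 : ℂ) R
      · rw [indicator_of_mem hxR, green_of_ne hxz, norm_sq_sub_conj_mul_comm]
      · have hxR' : R ≤ ‖x‖ := by simpa using hxR
        have hxw : 0 < ‖x - w‖ := norm_pos_iff.2 (sub_ne_zero.2 hxz)
        have hx1 : ‖x‖ ≤ ‖z‖ + ‖x - z‖ := by simpa using norm_add_le z (x - z)
        rw [mem_sphere_iff_norm.1 hx] at hx1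
        have hpos : 0 < ‖(R : ℂ) ^ 2 - starRingEnd ℂ x * w‖ := by
          refine lt_of_lt_of_le ?_ (sub_le_norm_sq_sub_conj_mul R x w)
          have : ‖w‖ * ‖x‖ ≤ ‖w‖ * (R + r) := by gcongr; linarith
          linarith [mul_comm ‖w‖ ‖x‖]
        have h3 := Real.log_le_log hpos (norm_sq_sub_conj_mul_le hxR' hwR hR.le)
        rw [Real.log_mul hR.ne' hxw.ne', norm_sq_sub_conj_mul_comm] at h3
        rw [ENNReal.ofReal_of_nonpos (by linarith)]
        exact zero_le)
  rw [circleAverage_green hr h'] at h2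
  refine le_trans ?_ (add_le_add_left h2 _)
  rw [green_of_ne hne, lam_of_ne_zero (sub_ne_zero.2 hne), norm_sq_sub_conj_mul_comm,
    posLog_inv_mul hr hzw]
  rcases le_total (Real.log ‖z - w‖) (Real.log r) with h | h
  · refine le_trans (ENNReal.ofReal_le_ofReal ?_) ENNReal.ofReal_add_le
    rw [max_eq_left (by linarith)]; linarith
  · refine le_trans (ENNReal.ofReal_le_ofReal ?_) le_self_add
    rw [max_eq_right (by linarith)]; linarith

lemma green_le_lam_add {R s : ℝ} {z w : ℂ} (hR : 0 < R) (hz : ‖z‖ < R)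
    (hw : ‖w‖ < R) : green R z w ≤ lam s (z - w) +
      ENNReal.ofReal (Real.log (2 * R ^ 2) - Real.log R - Real.log s) := by
  rcases eq_or_ne z w with rfl | hne
  · simp
  rw [green_of_ne hne, lam_of_ne_zero (sub_ne_zero.2 hne)]
  refine le_trans (ENNReal.ofReal_le_ofReal ?_) ENNReal.ofReal_add_le
  have h1 : ‖(R : ℂ) ^ 2 - starRingEnd ℂ z * w‖ ≤ 2 * R ^ 2 := by
    refine (norm_sub_le _ _).trans ?_
    rw [norm_mul, Complex.norm_conj, norm_pow, Complex.norm_real, Real.norm_of_nonneg hR.le]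
    nlinarith [norm_nonneg z, norm_nonneg w]
  have h2 : 0 < ‖(R : ℂ) ^ 2 - starRingEnd ℂ z * w‖ := by
    refine lt_of_lt_of_le ?_ (sub_le_norm_sq_sub_conj_mul R z w)
    nlinarith [norm_nonneg z, norm_nonneg w]
  linarith [Real.log_le_log h2 h1]

@[fun_prop] lemma measurable_green_left (R : ℝ) (w : ℂ) : Measurable fun z => green R z w :=
  (measurable_green R).comp (f := fun z => (z, w)) (by fun_prop)

/-- The Green potential of the mean value defect is bounded by the superharmonic function. -/
lemma IsSuperharmonicDisc.lintegral_green_mul_defect_le {S r : ℝ} {w : ℂ}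
    (hp : IsSuperharmonicDisc p R) (hw : ‖w‖ < S) (hr : 0 < r) (hrR : S + r ≤ R)
    (h : ‖w‖ * (S + r) < S ^ 2) :
    ∫⁻ z in ball 0 S, green S z w * defect p r z ≤ (∫⁻ z, lam r z) * p w := by
  have hS : 0 < S := (norm_nonneg w).trans_lt hw
  rcases eq_or_ne (p w) ⊤ with hpw | hpw
  · rw [hpw, ENNReal.mul_top (lintegral_lam_ne_zero hr)]; exact le_top
  set φ : ℂ → ℝ≥0∞ := (ball (0 : ℂ) S).indicator fun z => green S z w
  have hpm := hp.measurable
  have hdm := hp.measurable_defect r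
  have hφm : Measurable φ := (measurable_green_left S w).indicator measurableSet_ball
  have hlw : (∫⁻ z, lam r (z - w) * p z) = lconv (lam r) p w :=
    (lconv_eq_lintegral_sub _ _ _).symm
  -- This is `∫ φ (p - A_r p) = ∫ (φ - A_r φ) p ≤ ∫ lam r (z - w) p(z)`, with the negative terms
  -- moved across.
  have h1 : ∫⁻ z, φ z * p z ≤ (∫⁻ z, φ z * lmean p z r) + (∫⁻ z, lam r z) * p w := by
    calc ∫⁻ z, φ z * p z ≤ ∫⁻ z, (lmean φ z r * p z + lam r (z - w) * p z) := by
          refine lintegral_mono fun z => ?_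
          rw [← add_mul]
          exact mul_le_mul_left (indicator_green_le_lmean_add hr hS hw.le h z) _
      _ = (∫⁻ z, lmean φ z r * p z) + ∫⁻ z, lam r (z - w) * p z :=
          lintegral_add_left (by fun_prop) _
      _ ≤ _ := by
          refine add_le_add (le_of_eq ?_) ?_
          · have := lconv_lmean_left hφm hpm 0 r
            simpa [lconv] using this
          · rw [hlw]; exact hp.lconv_lam_le hr (by linarith)
  have h2 : ∫⁻ z, φ z * p z = (∫⁻ z, φ z * defect p r z) + ∫⁻ z, φ z * lmean p z r := by
    rw [← lintegral_add_left (by fun_prop)]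
    refine lintegral_congr fun z => ?_
    by_cases hz : z ∈ ball (0 : ℂ) S
    · have hz' : ‖z‖ < S := by simpa using hz
      rw [← mul_add, hp.defect_add hr (by linarith)]
    · simp [φ, indicator_of_notMem hz]
  -- Finiteness is needed to subtract. Near `w` the Green function is compared with `lam s`, where
  -- `s = R - ‖w‖` is the largest radius allowed by `lconv_lam_le`; the remainder is a constant.
  have h3 : ∫⁻ z, φ z * p z ≠ ⊤ := by
    set s := R - ‖w‖
    set c := ENNReal.ofReal (Real.log (2 * S ^ 2) - Real.log S - Real.log s)
    have hs : 0 < s := by simp only [s]; linarith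
    refine ne_top_of_le_ne_top (b := lconv (lam s) p w + c * ∫⁻ z, p z) ?_ ?_
    · refine ENNReal.add_ne_top.2 ⟨ne_top_of_le_ne_top ?_ (hp.lconv_lam_le hs (by simp [s])),
        ENNReal.mul_ne_top (by simp [c]) hp.lintegral_ne_top⟩
      exact ENNReal.mul_ne_top (lintegral_lam_ne_top hs) hpw
    · rw [lconv_eq_lintegral_sub, ← lintegral_const_mul _ hpm, ← lintegral_add_left (by fun_prop)]
      refine lintegral_mono fun z => ?_
      rw [← add_mul]
      refine mul_le_mul_left ?_ _
      by_cases hz : z ∈ ball (0 : ℂ) S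
      · have hz' : ‖z‖ < S := by simpa using hz
        rw [show φ z = green S z w from indicator_of_mem hz _]
        exact green_le_lam_add hS hz' hw
      · simp [φ, indicator_of_notMem hz]
  have h4 : ∫⁻ z in ball 0 S, green S z w * defect p r z = ∫⁻ z, φ z * defect p r z := by
    rw [← lintegral_indicator measurableSet_ball]
    refine lintegral_congr fun z => ?_
    simp only [φ, indicator]
    split_ifs <;> simp
  rw [h4]
  have h5 : ∫⁻ z, φ z * lmean p z r ≠ ⊤ := by
    refine ne_top_of_le_ne_top h3 ?_
    rw [h2]; exact le_add_self
  rw [h2, add_comm] at h1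
  exact (ENNReal.add_le_add_iff_left h5).1 h1

/-- The mean value defect of the mollified function in terms of the local logarithmic kernel. -/
lemma IsSuperharmonicDisc.lconv_lam_moll_identity {r ρ δ : ℝ} {w : ℂ}
    (hp : IsSuperharmonicDisc p R) (hr : 0 < r) (hρ : 0 < ρ) (hδ : 0 < δ)
    (hw : ‖w‖ + ρ + δ + r ≤ R) :
    (∫⁻ x, lconv (moll δ) (lam ρ) x * defect p r (w + x)) +
      lconv (lam r) (fun x => lmean (lconv (moll δ) p) x ρ) w =
      lconv (lam r) (lconv (moll δ) p) w := by
  have hpm := hp.measurable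
  have hdm := hp.measurable_defect r
  set u := lconv (moll δ) p
  have hum : Measurable u := by fun_prop
  obtain ⟨C, hC, hub⟩ := exists_lconv_moll_le hδ hp.lintegral_ne_top
  -- All circle means pass to the kernels, where `lam_add_lmean_lam` applies. Splitting `u` into `u
  -- - A_r u` and `A_r u` in the first term then brings in the defect.
  have h1 : lconv (lam ρ) u w + lconv (lam r) (fun x => lmean u x ρ) w =
      lconv (lam ρ) (fun x => lmean u x r) w + lconv (lam r) u w := by
    rw [← lconv_lmean_left (by fun_prop) hum, ← lconv_lmean_left (by fun_prop) hum,
      ← lconv_add_left (by fun_prop) hum, ← lconv_add_left (by fun_prop) hum]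
    simp only [lam_add_lmean_lam hr hρ]
  have h2 : lconv (lam ρ) u w =
      (∫⁻ x, lconv (moll δ) (lam ρ) x * defect p r (w + x)) +
        lconv (lam ρ) (fun x => lmean u x r) w := by
    rw [← lconv_lconv_moll (by fun_prop) hdm, ← lconv_add (by fun_prop) (by fun_prop)]
    refine lconv_congr fun x hx => ?_
    have hx' := norm_lt_of_lam_ne_zero hρ hx
    rw [lmean_lconv (by fun_prop) hpm, ← lconv_add (by fun_prop) hdm]
    refine lconv_congr fun y hy => ?_
    have hy' := norm_lt_of_moll_ne_zero hδ hy
    refine (hp.defect_add hr ?_).symm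
    linarith [norm_add_le (w + x) y, norm_add_le w x]
  -- A mollification of the integrable `p` is bounded, which makes the cancellation legitimate.
  have h3 : lconv (lam ρ) u w ≠ ⊤ := by
    refine ne_top_of_le_ne_top (ENNReal.mul_ne_top (lintegral_lam_ne_top hρ) hC) ?_
    rw [← lintegral_mul_const _ (by fun_prop)]
    exact lintegral_mono fun z => mul_le_mul_right (hub _) _
  have h4 : lconv (lam ρ) (fun x => lmean u x r) w ≠ ⊤ := by
    refine ne_top_of_le_ne_top h3 ?_
    rw [h2]; exact le_add_self
  rw [h2, add_comm (∫⁻ x, _), add_assoc] at h1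
  exact (ENNReal.add_right_inj h4).1 h1

lemma IsSuperharmonicDisc.lmean_lconv_moll_le {δ t : ℝ} {w : ℂ} (hp : IsSuperharmonicDisc p R)
    (hδ : 0 < δ) (ht : 0 < t) (hw : ‖w‖ + δ + t ≤ R) :
    lmean (lconv (moll δ) p) w t ≤ lconv (moll δ) p w := by
  rw [lmean_lconv (by fun_prop) hp.measurable]
  refine lconv_mono fun z hz => hp.mean _ _ ht ?_
  linarith [norm_add_le w z, norm_lt_of_moll_ne_zero hδ hz]

end EffectiveRiesz

end

noncomputable section

namespace EffectiveRiesz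

open Set Filter Topology

variable {p : ℂ → ℝ≥0∞} {R : ℝ}

/-! ### The Riesz measure -/

/-- The normalised mean value defect at scale `r`, as a measure on the disc of radius `S`. -/
def defectMeasure (p : ℂ → ℝ≥0∞) (S r : ℝ) : Measure ℂ :=
  (∫⁻ z, lam r z)⁻¹ • (volume.restrict (closedBall 0 S)).withDensity (defect p r)

lemma lintegral_defectMeasure (hp : IsSuperharmonicDisc p R) (S r : ℝ) {f : ℂ → ℝ≥0∞}
    (hf : Measurable f) : ∫⁻ z, f z ∂defectMeasure p S r =
      (∫⁻ z, lam r z)⁻¹ * ∫⁻ z in closedBall 0 S, f z * defect p r z := by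
  rw [defectMeasure, lintegral_smul_measure,
    lintegral_withDensity_eq_lintegral_mul _ (hp.measurable_defect r) hf, smul_eq_mul]
  simp [mul_comm]

lemma inv_lintegral_lam_mul_le {r : ℝ} (hr : 0 < r) {a b : ℝ≥0∞} (h : a ≤ (∫⁻ z, lam r z) * b) :
    (∫⁻ z, lam r z)⁻¹ * a ≤ b := by
  calc (∫⁻ z, lam r z)⁻¹ * a ≤ (∫⁻ z, lam r z)⁻¹ * ((∫⁻ z, lam r z) * b) := mul_le_mul_right h _
    _ = b := by
      rw [← mul_assoc, ENNReal.inv_mul_cancel (lintegral_lam_ne_zero hr) (lintegral_lam_ne_top hr),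
        one_mul]

lemma lintegral_green_defectMeasure_le (hp : IsSuperharmonicDisc p R) {S S₁ r : ℝ} {w : ℂ}
    (hS : S₁ < S) (hw : ‖w‖ < S) (hr : 0 < r) (hrR : S + r ≤ R) (h : ‖w‖ * (S + r) < S ^ 2) :
    ∫⁻ z, green S z w ∂defectMeasure p S₁ r ≤ p w := by
  rw [lintegral_defectMeasure hp _ _ (by fun_prop)]
  refine inv_lintegral_lam_mul_le hr (le_trans ?_
    (hp.lintegral_green_mul_defect_le hw hr hrR h))
  exact lintegral_mono_set (closedBall_subset_ball hS)

lemma defectMeasure_compl (p : ℂ → ℝ≥0∞) (S r : ℝ) :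
    defectMeasure p S r (closedBall 0 S)ᶜ = 0 := by
  have : (volume.restrict (closedBall (0 : ℂ) S)).withDensity (defect p r) (closedBall 0 S)ᶜ = 0 :=
    withDensity_absolutelyContinuous _ _ (by
      rw [Measure.restrict_apply measurableSet_closedBall.compl]; simp)
  simp [defectMeasure, this]

/-- The Green function of `D_S` with pole `0` is at least `log (S / S₁)` on the carrier of the
measure, so the potential estimate at `0` bounds the mass uniformly in `r`. -/
lemma defectMeasure_univ_le (hp : IsSuperharmonicDisc p R) {S S₁ r : ℝ} (hS₁ : 0 < S₁)
    (hS : S₁ < S) (hr : 0 < r) (hrR : S + r ≤ R) :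
    defectMeasure p S₁ r univ ≤ (ENNReal.ofReal (Real.log S - Real.log S₁))⁻¹ * p 0 := by
  have hS0 : 0 < S := hS₁.trans hS
  have hlog : 0 < Real.log S - Real.log S₁ := sub_pos.2 (Real.log_lt_log hS₁ hS)
  have h1 := lintegral_green_defectMeasure_le hp (w := 0) hS (by simpa) hr hrR (by simp; positivity)
  have h2 : ENNReal.ofReal (Real.log S - Real.log S₁) * defectMeasure p S₁ r univ ≤ p 0 := by
    refine le_trans ?_ h1
    rw [← lintegral_const]
    refine lintegral_mono_ae ?_
    have h3 : ∀ᵐ z ∂defectMeasure p S₁ r, z ∈ closedBall (0 : ℂ) S₁ :=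
      defectMeasure_compl p S₁ r
    filter_upwards [h3] with z hz
    rcases eq_or_ne z 0 with rfl | h0
    · simp
    rw [green_of_ne h0]
    refine ENNReal.ofReal_le_ofReal ?_
    have h4 : Real.log ‖z‖ ≤ Real.log S₁ :=
      Real.log_le_log (norm_pos_iff.2 h0) (by simpa using hz)
    simp only [mul_zero, sub_zero, norm_pow, Complex.norm_real, Real.norm_of_nonneg hS0.le,
      Real.log_pow, Nat.cast_ofNat]
    linarith
  rw [mul_comm] at h2
  rwa [mul_comm, ← div_eq_mul_inv, ENNReal.le_div_iff_mul_le (.inl (ENNReal.ofReal_pos.2 hlog).ne') (by simp)]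

/-- A continuous compactly supported minorant of the Green function with pole `w`. -/
def greenCut (S c ε : ℝ) (w z : ℂ) : ℝ :=
  max 0 (Real.log (max ‖(S : ℂ) ^ 2 - starRingEnd ℂ z * w‖ c) - Real.log S -
    Real.log (max ‖z - w‖ ε))

lemma continuous_greenCut (S : ℝ) {c ε : ℝ} (hc : 0 < c) (hε : 0 < ε) (w : ℂ) :
    Continuous (greenCut S c ε w) := by
  unfold greenCut
  have h0 : Continuous fun z : ℂ => starRingEnd ℂ z := Complex.continuous_conj
  have h1 : Continuous fun z : ℂ => Real.log (max ‖(S : ℂ) ^ 2 - starRingEnd ℂ z * w‖ c) :=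
    Continuous.log (by fun_prop) fun z => (lt_max_of_lt_right hc).ne'
  have h2 : Continuous fun z : ℂ => Real.log (max ‖z - w‖ ε) :=
    Continuous.log (by fun_prop) fun z => (lt_max_of_lt_right hε).ne'
  fun_prop

/-- The cut-off `S (S - S₁)` is the lower bound of `mul_sub_le_norm`, so it changes nothing inside
the disc. Outside it is at most `S |z - w|`, so the kernel still vanishes there and has compact
support. -/
lemma greenCut_eq_zero {S S₁ ε : ℝ} {w z : ℂ} (hS₁ : 0 < S₁) (hS : S₁ < S) (hw : ‖w‖ ≤ S₁)
    (hz : S ≤ ‖z‖) : greenCut S (S * (S - S₁)) ε w z = 0 := by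
  have hS0 : 0 < S := hS₁.trans hS
  have h1 : S - S₁ ≤ ‖z - w‖ := by linarith [norm_sub_norm_le z w]
  have hzw : 0 < ‖z - w‖ := by linarith
  refine max_eq_left ?_
  have h2 : Real.log (max ‖(S : ℂ) ^ 2 - starRingEnd ℂ z * w‖ (S * (S - S₁))) ≤
      Real.log (S * max ‖z - w‖ ε) := by
    refine Real.log_le_log (lt_max_of_lt_right (mul_pos hS0 (by linarith))) (max_le ?_ ?_)
    · refine (norm_sq_sub_conj_mul_le hz (by linarith) hS0.le).trans ?_
      gcongr; exact le_max_left _ _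
    · gcongr; exact h1.trans (le_max_left _ _)
  rw [Real.log_mul hS0.ne' (lt_max_of_lt_left hzw).ne'] at h2
  linarith

lemma mul_sub_le_norm {S S₁ : ℝ} {z w : ℂ} (hw : ‖w‖ ≤ S₁) (hz : ‖z‖ ≤ S) :
    S * (S - S₁) ≤ ‖(S : ℂ) ^ 2 - starRingEnd ℂ z * w‖ := by
  refine le_trans ?_ (sub_le_norm_sq_sub_conj_mul S z w)
  have : ‖z‖ * ‖w‖ ≤ S * S₁ := mul_le_mul hz hw (norm_nonneg _) ((norm_nonneg _).trans hz)
  nlinarith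

lemma ofReal_greenCut_le {S S₁ ε : ℝ} {w z : ℂ} (hw : ‖w‖ ≤ S₁) (hz : ‖z‖ ≤ S) :
    ENNReal.ofReal (greenCut S (S * (S - S₁)) ε w z) ≤ green S z w := by
  rcases eq_or_ne z w with rfl | hne
  · simp
  have hzw : 0 < ‖z - w‖ := norm_pos_iff.2 (sub_ne_zero.2 hne)
  rw [green_of_ne hne, greenCut, max_eq_left (mul_sub_le_norm hw hz), ENNReal.ofReal_max]
  refine max_le (by simp) (ENNReal.ofReal_le_ofReal ?_)
  linarith [Real.log_le_log hzw (le_max_left ‖z - w‖ ε)]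

lemma green_le_liminf_greenCut {R S₁ : ℝ} {z w : ℂ} (hS₁ : 0 < S₁) (hR : S₁ < R) (hw : ‖w‖ < S₁)
    (hz : ‖z‖ < S₁) {S ε : ℕ → ℝ} (hS : Tendsto S atTop (𝓝 R)) (hε : Tendsto ε atTop (𝓝 0))
    (hε0 : ∀ n, 0 < ε n) :
    green R z w ≤ liminf (fun n => ENNReal.ofReal (greenCut (S n) (S n * (S n - S₁)) (ε n) w z))
      atTop := by
  have hR0 : 0 < R := hS₁.trans hR
  have hSz : ∀ᶠ n in atTop, S₁ < S n := hS.eventually (lt_mem_nhds hR)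
  have hn : 0 < ‖(R : ℂ) ^ 2 - starRingEnd ℂ z * w‖ :=
    lt_of_lt_of_le (mul_pos hR0 (by linarith)) (mul_sub_le_norm hw.le (hz.le.trans hR.le))
  have h1 : Tendsto (fun n => Real.log ‖(S n : ℂ) ^ 2 - starRingEnd ℂ z * w‖ - Real.log (S n))
      atTop (𝓝 (Real.log ‖(R : ℂ) ^ 2 - starRingEnd ℂ z * w‖ - Real.log R)) := by
    refine Tendsto.sub (Tendsto.log ?_ hn.ne') (hS.log hR0.ne')
    have : Tendsto (fun n => (S n : ℂ)) atTop (𝓝 (R : ℂ)) :=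
      (Complex.continuous_ofReal.tendsto R).comp hS
    exact ((this.pow 2).sub_const _).norm
  have h2 : ∀ᶠ n in atTop, greenCut (S n) (S n * (S n - S₁)) (ε n) w z = max 0
      (Real.log ‖(S n : ℂ) ^ 2 - starRingEnd ℂ z * w‖ - Real.log (S n) -
        Real.log (max ‖z - w‖ (ε n))) := by
    filter_upwards [hSz] with n hn
    rw [greenCut, max_eq_left (mul_sub_le_norm hw.le (hz.le.trans hn.le))]
  refine le_of_eq (Tendsto.liminf_eq ?_).symm
  rcases eq_or_ne z w with rfl | hne
  · rw [green_self]
    refine ENNReal.tendsto_ofReal_atTop.comp (Tendsto.congr' (h2.mono fun n hn => hn.symm) ?_)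
    refine tendsto_atTop_mono (fun n => le_max_right _ _) ?_
    simp only [sub_self, norm_zero, sub_eq_add_neg _ (Real.log (max _ _))]
    refine h1.add_atTop (tendsto_neg_atBot_atTop.comp ?_)
    have h3 : Tendsto (fun n => max 0 (ε n)) atTop (𝓝[>] 0) := by
      refine tendsto_nhdsWithin_iff.2 ⟨?_, .of_forall fun n => lt_max_of_lt_right (hε0 n)⟩
      simpa using (tendsto_const_nhds (x := (0 : ℝ))).max hε
    exact Real.tendsto_log_nhdsGT_zero.comp h3
  · have hzw : 0 < ‖z - w‖ := norm_pos_iff.2 (sub_ne_zero.2 hne)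
    rw [green_of_ne hne]
    have h3 : Tendsto (fun n => Real.log (max ‖z - w‖ (ε n))) atTop (𝓝 (Real.log ‖z - w‖)) := by
      have := (tendsto_const_nhds (x := ‖z - w‖)).max hε
      rw [max_eq_left hzw.le] at this
      exact this.log hzw.ne'
    have h4 := (h1.sub h3)
    have h5 := (tendsto_const_nhds (x := (0 : ℝ))).max h4
    have h6 := ENNReal.tendsto_ofReal (h5.congr' (h2.mono fun n hn => hn.symm))
    rwa [ENNReal.ofReal_max, ENNReal.ofReal_zero, max_eq_right zero_le] at h6

/-- Existence of the Riesz measure: its Green potential is a minorant of `p`, and it computes the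
mean value defects of the mollifications of `p`. -/
lemma exists_rieszMeasure (hp : IsSuperharmonicDisc p R) {R₁ : ℝ} (hR₁ : 0 < R₁) (hR : R₁ < R) :
    ∃ μ : Measure ℂ, IsFiniteMeasureOnCompacts μ ∧
      (∀ w, ‖w‖ < R₁ → ∫⁻ z in ball 0 R₁, green R z w ∂μ ≤ p w) ∧
      ∀ (w : ℂ) (ρ δ : ℝ), 0 < ρ → 0 < δ → ‖w‖ + ρ + δ < R₁ →
        (∫⁻ z, lconv (moll δ) (lam ρ) (z - w) ∂μ) + lmean (lconv (moll δ) p) w ρ =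
          lconv (moll δ) p w := by
  -- An intermediate radius leaves room on both sides: `log (S₀ / R₁) > 0` for the mass bound, and
  -- circles of radius `R - S₀` around points of `D_{S₀}`.
  set S₀ := (R₁ + R) / 2
  have hS₀ : R₁ < S₀ := by simp only [S₀]; linarith
  set r : ℕ → ℝ := fun n => (R - S₀) / (n + 1)
  have hr : ∀ n, 0 < r n := fun n => by
    have : 0 < R - S₀ := by simp only [S₀]; linarith
    positivity
  have hrle : ∀ n, r n ≤ R - S₀ := fun n => by
    have : 0 < R - S₀ := by simp only [S₀]; linarith
    exact div_le_self this.le (by simp)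
  have hrlim : Tendsto r atTop (𝓝 0) := by
    have := (tendsto_one_div_add_atTop_nhds_zero_nat (𝕜 := ℝ)).const_mul (R - S₀)
    simpa [r, div_eq_mul_inv] using this
  have hlog : 0 < Real.log S₀ - Real.log R₁ := sub_pos.2 (Real.log_lt_log hR₁ hS₀)
  obtain ⟨μ, U, hμ, hU, hUle, hlim⟩ := exists_weak_limit (fun n => defectMeasure p R₁ (r n))
    (C := (ENNReal.ofReal (Real.log S₀ - Real.log R₁))⁻¹ * p 0)
    (ENNReal.mul_ne_top (ENNReal.inv_ne_top.2 (ENNReal.ofReal_pos.2 hlog).ne') hp.finite)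
    (fun n => defectMeasure_univ_le hp hR₁ hS₀ (hr n) (by linarith [hrle n]))
  refine ⟨μ, hμ, fun w hw => ?_, fun w ρ δ hρ hδ hw => ?_⟩
  -- The defect estimate needs a disc strictly smaller than `D_R`. So let `r → 0` for a fixed radius
  -- `S k` and a continuous minorant, then `S k → R` with Fatou's lemma; `k + 2` keeps `S 0` above
  -- `R₁`.
  · set S : ℕ → ℝ := fun k => R - (R - R₁) / (k + 2)
    have hRR : 0 < R - R₁ := by linarith
    have hSR : ∀ k, S k < R := fun k => sub_lt_self _ (by positivity)
    have hSR₁ : ∀ k, R₁ < S k := fun k => by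
      have : (R - R₁) / (k + 2) < R - R₁ :=
        div_lt_self hRR (by have : (0 : ℝ) ≤ k := k.cast_nonneg; linarith)
      simp only [S]; linarith
    set ε : ℕ → ℝ := fun k => 1 / ((k : ℝ) + 1)
    have hε : Tendsto ε atTop (𝓝 0) := tendsto_one_div_add_atTop_nhds_zero_nat
    have hε0 : ∀ k, 0 < ε k := fun k => by positivity
    have hS : Tendsto S atTop (𝓝 R) := by
      have h1 : Tendsto (fun k : ℕ => (R - R₁) / ((k : ℝ) + 2)) atTop (𝓝 0) :=
        tendsto_const_nhds.div_atTop
          (tendsto_atTop_add_const_right _ _ tendsto_natCast_atTop_atTop)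
      simpa [S] using h1.const_sub R
    have hk : ∀ k, ∫⁻ z, ENNReal.ofReal (greenCut (S k) (S k * (S k - R₁)) (ε k) w z) ∂μ ≤
        p w := fun k => by
      have hSk : 0 < S k := hR₁.trans (hSR₁ k)
      have hc : 0 < S k * (S k - R₁) := mul_pos hSk (by linarith [hSR₁ k])
      refine le_of_tendsto (hlim _ (continuous_greenCut _ hc (hε0 k) w) ?_
        fun z => le_max_left _ _) ?_
      · refine HasCompactSupport.intro (isCompact_closedBall 0 (S k)) fun z hz => ?_
        refine greenCut_eq_zero hR₁ (hSR₁ k) hw.le ?_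
        have : S k < ‖z‖ := by simpa using hz
        exact this.le
      · refine hUle ?_
        have h1 : Tendsto (fun n => ‖w‖ * (S k + r n)) atTop (𝓝 (‖w‖ * (S k + 0))) :=
          (hrlim.const_add _).const_mul _
        have h2 : ‖w‖ * (S k + 0) < S k ^ 2 := by nlinarith [hSR₁ k]
        have h3 : ∀ᶠ n in atTop, r n < R - S k := hrlim.eventually (gt_mem_nhds (by linarith [hSR k]))
        filter_upwards [h1.eventually (gt_mem_nhds h2), h3] with n h4 h5
        refine le_trans ?_ (lintegral_green_defectMeasure_le hp (hSR₁ k)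
          (hw.trans (hSR₁ k)) (hr n) (by linarith) h4)
        have h6 : ∀ᵐ z ∂defectMeasure p R₁ (r n), z ∈ closedBall (0 : ℂ) R₁ :=
          defectMeasure_compl p R₁ (r n)
        refine lintegral_mono_ae ?_
        filter_upwards [h6] with z hz
        exact ofReal_greenCut_le hw.le ((mem_closedBall_zero_iff.1 hz).trans (hSR₁ k).le)
    calc ∫⁻ z in ball 0 R₁, green R z w ∂μ
        ≤ ∫⁻ z in ball 0 R₁, liminf (fun k => ENNReal.ofReal
            (greenCut (S k) (S k * (S k - R₁)) (ε k) w z)) atTop ∂μ := by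
          refine setLIntegral_mono' measurableSet_ball fun z hz => ?_
          exact green_le_liminf_greenCut hR₁ hR hw (by simpa using hz) hS hε hε0
      _ ≤ liminf (fun k => ∫⁻ z in ball 0 R₁, ENNReal.ofReal
            (greenCut (S k) (S k * (S k - R₁)) (ε k) w z) ∂μ) atTop := by
          refine lintegral_liminf_le fun k => ?_
          have hSk : 0 < S k := hR₁.trans (hSR₁ k)
          have hc : 0 < S k * (S k - R₁) := mul_pos hSk (by linarith [hSR₁ k])
          exact (continuous_greenCut _ hc (hε0 k) w).measurable.ennreal_ofReal
      _ ≤ p w := by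
          refine liminf_le_of_le (by isBoundedDefault) fun b hb => ?_
          obtain ⟨k, hk'⟩ := hb.exists
          exact hk'.trans ((setLIntegral_le_lintegral _ _).trans (hk k))
  · have hpm := hp.measurable
    set u := lconv (moll δ) p
    set κ : ℂ → ℝ≥0∞ := lconv (moll δ) (lam ρ)
    have hκm : Measurable κ := by fun_prop
    -- Here the mollification is indispensable: `lam ρ` is infinite at `0`, while `κ` is an
    -- admissible test function.
    have hκlim : Tendsto (fun n => ∫⁻ z, κ (z - w) ∂defectMeasure p R₁ (r n)) U
        (𝓝 (∫⁻ z, κ (z - w) ∂μ)) := by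
      have hlam := lintegral_lam_ne_top hρ
      have h1 := hlim (fun z => (κ (z - w)).toReal)
        ((contDiff_toReal_lconv_moll hδ (measurable_lam ρ) hlam).continuous.comp
          (continuous_sub_right w)) ?_ (fun z => ENNReal.toReal_nonneg)
      · simpa only [κ, ← lconv_moll_eq_ofReal hδ hlam] using h1
      · refine HasCompactSupport.intro (isCompact_closedBall w (ρ + δ)) fun z hz => ?_
        have : κ (z - w) = 0 := by
          by_contra h
          have := norm_lt_of_lconv_moll_ne_zero hδ (fun z => norm_lt_of_lam_ne_zero hρ) h
          exact hz (by simpa [dist_eq_norm] using this.le)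
        simp [this]
    -- The normalised kernels `lam (r n)` form a radial approximate identity.
    have htend : ∀ f : ℂ → ℝ≥0∞, LowerSemicontinuous f →
        (∀ t, 0 < t → t < R - R₁ → lmean f w t ≤ f w) →
        Tendsto (fun n => (∫⁻ z, lam (r n) z)⁻¹ * lconv (lam (r n)) f w) U (𝓝 (f w)) := by
      intro f hf hm
      have := tendsto_lconv (a := fun n z => (∫⁻ z, lam (r n) z)⁻¹ * lam (r n) z) hrlim
        (fun n => by fun_prop)
        (fun n z z' h => by simp only [isRadial_lam (r n) z z' h])
        (.of_forall fun n => by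
          rw [lintegral_const_mul _ (by fun_prop), ENNReal.inv_mul_cancel
            (lintegral_lam_ne_zero (hr n)) (lintegral_lam_ne_top (hr n))])
        (fun n z hz => (norm_lt_of_lam_ne_zero (hr n) (mul_ne_zero_iff.1 hz).2).le)
        hf.measurable (hf w) (ε := R - R₁) (by linarith) hm
      refine (this.mono_left hUle).congr fun n => ?_
      simp only [lconv, mul_assoc]
      have := hf.measurable
      rw [lintegral_const_mul _ (by fun_prop)]
    have hul : LowerSemicontinuous u := lowerSemicontinuous_lconv_moll δ hp.lsc
    have hum : Measurable u := hul.measurable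
    have h1 := htend u hul fun t ht htR => hp.lmean_lconv_moll_le hδ ht (by linarith)
    have h2 := htend (fun x => lmean u x ρ) (lowerSemicontinuous_lmean hul ρ) fun t ht htR => by
      rw [lmean_comm hum]
      refine lmean_mono hρ.le fun x hx => hp.lmean_lconv_moll_le hδ ht ?_
      have h6 : ‖x‖ ≤ ‖w‖ + ‖x - w‖ := by simpa using norm_add_le w (x - w)
      rw [mem_sphere_iff_norm.1 hx] at h6
      linarith
    -- The claim is the limit `r → 0` of `lconv_lam_moll_identity` divided by `∫ lam r`.
    refine tendsto_nhds_unique ((hκlim.add h2).congr fun n => ?_) h1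
    have hid := hp.lconv_lam_moll_identity (w := w) (hr n) hρ hδ (by linarith [hrle n])
    rw [← hid, mul_add, lintegral_defectMeasure hp _ _ (by fun_prop)]
    congr 2
    have h7 : ∀ z, z ∉ closedBall (0 : ℂ) R₁ → κ (z - w) * defect p (r n) z = 0 := fun z hz => by
      have : κ (z - w) = 0 := by
        by_contra h
        have h8 := norm_lt_of_lconv_moll_ne_zero hδ (fun z => norm_lt_of_lam_ne_zero hρ) h
        refine hz ?_
        have h6 : ‖z‖ ≤ ‖w‖ + ‖z - w‖ := by simpa using norm_add_le w (z - w)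
        simp only [mem_closedBall_zero_iff]
        linarith
      simp [this]
    rw [setLIntegral_eq_of_support_subset, ← lintegral_add_left_eq_self _ w]
    · simp only [add_sub_cancel_left]; rfl
    · exact fun z hz => by_contra fun h => hz (h7 z h)

end EffectiveRiesz

end

noncomputable section

namespace EffectiveRiesz

open Set Filter Topology

variable {p : ℂ → ℝ≥0∞} {R : ℝ}

/-! ### The Riesz decomposition -/

lemma lowerSemicontinuousAt_green {z x : ℂ} (hz : ‖z‖ < R) (hx : ‖x‖ < R) :
    LowerSemicontinuousAt (green R z) x := by
  have hn : ‖(R : ℂ) ^ 2 - starRingEnd ℂ z * x‖ ≠ 0 := by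
    refine (lt_of_lt_of_le ?_ (sub_le_norm_sq_sub_conj_mul R z x)).ne'
    nlinarith [norm_nonneg z, norm_nonneg x]
  have h1 : ContinuousAt (fun y => Real.log ‖(R : ℂ) ^ 2 - starRingEnd ℂ z * y‖ - Real.log R) x :=
    ContinuousAt.sub (ContinuousAt.log
      (f := fun y => ‖(R : ℂ) ^ 2 - starRingEnd ℂ z * y‖) (by fun_prop) hn) continuousAt_const
  rcases eq_or_ne x z with rfl | hne
  · have h2 : Tendsto (fun y => Real.log ‖(R : ℂ) ^ 2 - starRingEnd ℂ x * y‖ - Real.log R -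
        Real.log ‖x - y‖) (𝓝[≠] x) atTop := by
      simp only [sub_eq_add_neg _ (Real.log ‖x - _‖)]
      refine (h1.tendsto.mono_left nhdsWithin_le_nhds).add_atTop
        (tendsto_neg_atBot_atTop.comp (Real.tendsto_log_nhdsGT_zero.comp ?_))
      refine tendsto_nhdsWithin_iff.2 ⟨?_, ?_⟩
      · have : Continuous fun y => ‖x - y‖ := by fun_prop
        simpa using (this.tendsto x).mono_left nhdsWithin_le_nhds
      · filter_upwards [self_mem_nhdsWithin] with y hy
        exact norm_pos_iff.2 (sub_ne_zero.2 (Ne.symm hy))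
    intro y hy
    rw [green_self] at hy
    have h3 := (ENNReal.tendsto_ofReal_atTop.comp h2).eventually (lt_mem_nhds hy)
    rw [eventually_nhdsWithin_iff] at h3
    filter_upwards [h3] with y' hy'
    rcases eq_or_ne y' x with rfl | h
    · simpa using hy
    · rw [green_of_ne (Ne.symm h)]; exact hy' h
  · have h2 : ContinuousAt (fun y => ENNReal.ofReal (Real.log ‖(R : ℂ) ^ 2 - starRingEnd ℂ z * y‖ -
        Real.log R - Real.log ‖z - y‖)) x := by
      refine ENNReal.continuous_ofReal.continuousAt.comp (h1.sub (ContinuousAt.log (by fun_prop) ?_))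
      exact norm_ne_zero_iff.2 (sub_ne_zero.2 hne.symm)
    refine (h2.congr ?_).lowerSemicontinuousAt
    filter_upwards [isOpen_ne.mem_nhds hne] with y hy
    rw [green_of_ne (Ne.symm hy)]

/-- The Green potential of `μ` restricted to the disc of radius `S`. -/
def greenPotential (μ : Measure ℂ) (R S : ℝ) (w : ℂ) : ℝ≥0∞ :=
  ∫⁻ z in ball 0 S, green R z w ∂μ

lemma lowerSemicontinuousAt_greenPotential {μ : Measure ℂ} {S : ℝ} (hS : S < R) {w : ℂ} (hw : ‖w‖ < R) :
    LowerSemicontinuousAt (greenPotential μ R S) w := by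
  have h : greenPotential μ R S =
      fun x => ∫⁻ z, (ball (0 : ℂ) S).indicator (fun z => green R z x) z ∂μ := by
    ext x; rw [greenPotential, lintegral_indicator measurableSet_ball]
  rw [h]
  refine lowerSemicontinuousAt_lintegral
    (F := fun z x => (ball (0 : ℂ) S).indicator (fun z => green R z x) z)
    (fun x => (measurable_green_left R x).indicator measurableSet_ball) fun z => ?_
  by_cases hz : z ∈ ball (0 : ℂ) S
  · simp only [indicator_of_mem hz]
    have hz' : ‖z‖ < S := by simpa using hz
    exact lowerSemicontinuousAt_green (hz'.trans hS) hw
  · simp only [indicator_of_notMem hz]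
    exact continuousAt_const.lowerSemicontinuousAt

section potential

variable {μ : Measure ℂ} [IsFiniteMeasureOnCompacts μ] {S : ℝ}

lemma measure_ball_ne_top (μ : Measure ℂ) [IsFiniteMeasureOnCompacts μ] (S : ℝ) :
    μ (ball 0 S) ≠ ⊤ :=
  ((measure_mono ball_subset_closedBall).trans_lt
    (isCompact_closedBall (0 : ℂ) S).measure_lt_top).ne

instance isFiniteMeasure_restrict_ball : IsFiniteMeasure (μ.restrict (ball 0 S)) :=
  ⟨by simpa using (measure_ball_ne_top μ S).lt_top⟩

lemma measurable_greenPotential : Measurable (greenPotential μ R S) :=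
  Measurable.lintegral_prod_right' (f := fun q : ℂ × ℂ => green R q.2 q.1)
    ((measurable_green R).comp measurable_swap)

lemma greenPotential_eq_lmean_add (hS : S < R) {w : ℂ} {ρ : ℝ} (hρ : 0 < ρ) (hw : ‖w‖ + ρ ≤ R) :
    greenPotential μ R S w =
      lmean (greenPotential μ R S) w ρ + ∫⁻ z in ball 0 S, lam ρ (z - w) ∂μ := by
  unfold greenPotential
  rw [lmean_lintegral (measurable_green R), ← lintegral_add_right _ (by fun_prop)]
  refine setLIntegral_congr_fun measurableSet_ball fun z hz => ?_
  have hz' : ‖z‖ < S := by simpa using hz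
  exact green_eq_lmean_add hρ (hz'.trans hS) hw

lemma lconv_moll_lintegral_lam {ρ δ : ℝ} (w : ℂ) :
    lconv (moll δ) (fun x => ∫⁻ z in ball 0 S, lam ρ (z - x) ∂μ) w =
      ∫⁻ z in ball 0 S, lconv (moll δ) (lam ρ) (z - w) ∂μ := by
  simp only [lconv]
  have h1 : ∀ y : ℂ, moll δ y * ∫⁻ z in ball 0 S, lam ρ (z - (w + y)) ∂μ =
      ∫⁻ z in ball 0 S, moll δ y * lam ρ (z - (w + y)) ∂μ := fun y => by
    rw [lintegral_const_mul _ (by fun_prop)]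
  simp only [h1]
  rw [lintegral_lintegral_swap (by fun_prop)]
  refine lintegral_congr fun z => ?_
  rw [← lintegral_neg_eq_self]
  refine lintegral_congr fun y => ?_
  rw [(isRadial_moll δ).neg]
  congr 2; ring

end potential

/-- If the mollifications of `q` have the mean value property, they define a harmonic function. -/
lemma exists_harmonic_of_mean_eq {q : ℂ → ℝ≥0∞} {S : ℝ} (hq : Measurable q) (hint : ∫⁻ z, q z ≠ ⊤)
    (hmean : ∀ (w : ℂ) (ρ δ : ℝ), 0 < ρ → 0 < δ → ‖w‖ + ρ + δ < S →
      lmean (lconv (moll δ) q) w ρ = lconv (moll δ) q w) :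
    ∃ H : ℂ → ℝ, InnerProductSpace.HarmonicOnNhd H (ball 0 S) ∧ (∀ w, 0 ≤ H w) ∧
      ∀ (w : ℂ) (δ : ℝ), 0 < δ → δ < (S - ‖w‖) / 2 →
        lconv (moll δ) q w = ENNReal.ofReal (H w) := by
  -- A radial average of total weight one fixes a function with the mean value property. So each
  -- single mollification equals the double one, which is symmetric in `δ` and `δ'`; hence the scale
  -- is irrelevant.
  have hindep : ∀ (w : ℂ) (δ δ' : ℝ), 0 < δ → 0 < δ' → ‖w‖ + δ + δ' < S →
      lconv (moll δ) q w = lconv (moll δ') (lconv (moll δ) q) w := by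
    intro w δ δ' hδ hδ' hw
    rw [(isRadial_moll δ').lconv_eq_of_mean_eq (by fun_prop) (by fun_prop), lintegral_moll hδ',
      one_mul]
    intro z h0 hz
    exact hmean w _ δ (norm_pos_iff.2 h0) hδ (by linarith [norm_lt_of_moll_ne_zero hδ' hz])
  have hindep' : ∀ (w : ℂ) (δ δ' : ℝ), 0 < δ → 0 < δ' → ‖w‖ + δ + δ' < S →
      lconv (moll δ) q w = lconv (moll δ') q w := by
    intro w δ δ' hδ hδ' hw
    rw [hindep w δ δ' hδ hδ' hw, hindep w δ' δ hδ' hδ (by linarith),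
      lconv_lconv_comm (by fun_prop) (by fun_prop) hq]
  -- A third for the reference scale and less than a half for `δ` sum to less than the distance to
  -- the boundary, as `hindep'` requires.
  set H : ℂ → ℝ := fun w => (lconv (moll ((S - ‖w‖) / 3)) q w).toReal
  have hH : ∀ (w : ℂ) (δ : ℝ), 0 < δ → δ < (S - ‖w‖) / 2 →
      lconv (moll δ) q w = ENNReal.ofReal (H w) := by
    intro w δ hδ hw
    simp only [H]
    rw [← lconv_moll_eq_ofReal (by linarith) hint]
    exact hindep' w _ _ hδ (by linarith) (by linarith)
  refine ⟨H, fun w hw => ?_, fun w => ENNReal.toReal_nonneg, hH⟩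
  have hw' : ‖w‖ < S := by simpa using hw
  set δ := (S - ‖w‖) / 3
  have hδ : 0 < δ := by simp only [δ]; linarith
  have hball : ∀ᶠ x in 𝓝 w, ‖x‖ + δ / 2 < ‖w‖ + δ := by
    have : ContinuousAt (fun x : ℂ => ‖x‖ + δ / 2) w := by fun_prop
    exact this.eventually (gt_mem_nhds (by linarith))
  have hsmooth := contDiff_toReal_lconv_moll hδ hq hint
  refine (InnerProductSpace.harmonicAt_congr_nhds
    (f₂ := fun x => (lconv (moll δ) q x).toReal) ?_).2 ⟨hsmooth.contDiffAt, ?_⟩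
  · filter_upwards [hball] with x hx
    rw [hH x δ hδ (by simp only [δ] at *; linarith), ENNReal.toReal_ofReal ENNReal.toReal_nonneg]
  · filter_upwards [hball] with x hx
    refine laplacian_eq_zero_of_circleAverage_eq hsmooth.contDiffAt ?_
    have h1 : ∀ᶠ r in 𝓝[>] (0 : ℝ), r < δ / 2 :=
      nhdsWithin_le_nhds (gt_mem_nhds (by linarith))
    filter_upwards [h1, self_mem_nhdsWithin] with r hr (hr0 : 0 < r)
    have h2 := hmean x r δ hr0 hδ (by simp only [δ] at *; linarith)
    rw [lmean_lconv_moll hδ hq hint x hr0] at h2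
    rw [← h2, ENNReal.toReal_ofReal]
    rw [circleAverage_eq_integral_e]
    exact integral_nonneg fun θ => ENNReal.toReal_nonneg

/-- **Riesz decomposition** of a nonnegative superharmonic function into a Green potential and a
nonnegative harmonic function. -/
theorem exists_riesz_decomposition (hp : IsSuperharmonicDisc p R) {R₁ : ℝ} (hR₁ : 0 < R₁)
    (hR : R₁ < R) :
    ∃ (μ : Measure ℂ) (H : ℂ → ℝ), IsFiniteMeasureOnCompacts μ ∧
      InnerProductSpace.HarmonicOnNhd H (ball 0 R₁) ∧ (∀ w, 0 ≤ H w) ∧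
      ∀ w, ‖w‖ < R₁ → p w = greenPotential μ R R₁ w + ENNReal.ofReal (H w) := by
  obtain ⟨μ, hμ, hle, hid⟩ := exists_rieszMeasure hp hR₁ hR
  have hpm := hp.measurable
  set P : ℂ → ℝ≥0∞ := (ball (0 : ℂ) R₁).indicator (greenPotential μ R R₁)
  have hPm : Measurable P := measurable_greenPotential.indicator measurableSet_ball
  set p₁ : ℂ → ℝ≥0∞ := (ball (0 : ℂ) R₁).indicator p
  have hp₁m : Measurable p₁ := hpm.indicator measurableSet_ball
  -- Truncated subtraction makes `q` zero where `P` is infinite, so `q` itself carries no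
  -- information there. Only its mollifications are used, and `P` is integrable, so this set is
  -- null.
  set q : ℂ → ℝ≥0∞ := fun x => p₁ x - P x
  have hqm : Measurable q := by fun_prop
  have hmem : ∀ {x : ℂ}, ‖x‖ < R₁ → x ∈ ball (0 : ℂ) R₁ := fun h => by simpa using h
  have hPeq : ∀ {x : ℂ}, ‖x‖ < R₁ → P x = greenPotential μ R R₁ x :=
    fun h => indicator_of_mem (hmem h) _
  have hp₁eq : ∀ {x : ℂ}, ‖x‖ < R₁ → p₁ x = p x := fun h => indicator_of_mem (hmem h) _
  have hadd : ∀ x, p₁ x = P x + q x := fun x => by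
    refine (add_tsub_cancel_of_le ?_).symm
    by_cases hx : x ∈ ball (0 : ℂ) R₁
    · simp only [P, p₁, indicator_of_mem hx]
      exact hle x (by simpa using hx)
    · simp [P, p₁, indicator_of_notMem hx]
  have hp₁int : ∫⁻ z, p₁ z ≠ ⊤ := ne_top_of_le_ne_top hp.lintegral_ne_top
    (lintegral_mono fun z => indicator_le_self _ _ z)
  have hPint : ∫⁻ z, P z ≠ ⊤ := ne_top_of_le_ne_top hp₁int
    (lintegral_mono fun z => by rw [hadd z]; exact le_self_add)
  have hqint : ∫⁻ z, q z ≠ ⊤ := ne_top_of_le_ne_top hp₁int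
    (lintegral_mono fun z => tsub_le_self)
  have hnorm : ∀ {w x : ℂ} {ρ : ℝ}, x ∈ sphere w ρ → ‖x‖ ≤ ‖w‖ + ρ := fun {w x ρ} hx => by
    have h6 : ‖x‖ ≤ ‖w‖ + ‖x - w‖ := by simpa using norm_add_le w (x - w)
    rwa [mem_sphere_iff_norm.1 hx] at h6
  have hPmean : ∀ (w : ℂ) (ρ : ℝ), 0 < ρ → ‖w‖ + ρ < R₁ →
      P w = lmean P w ρ + ∫⁻ z in ball 0 R₁, lam ρ (z - w) ∂μ := by
    intro w ρ hρ hw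
    rw [hPeq (by linarith), greenPotential_eq_lmean_add hR hρ (by linarith)]
    congr 1
    exact lmean_congr hρ.le fun x hx => (hPeq (by linarith [hnorm hx])).symm
  have hmollp : ∀ (w : ℂ) (δ : ℝ), 0 < δ → ‖w‖ + δ < R₁ →
      lconv (moll δ) p w = lconv (moll δ) P w + lconv (moll δ) q w := by
    intro w δ hδ hw
    rw [← lconv_add (by fun_prop) hPm]
    refine lconv_congr fun z hz => ?_
    rw [← hadd, hp₁eq]
    linarith [norm_add_le w z, norm_lt_of_moll_ne_zero hδ hz]
  have hκ : ∀ (w : ℂ) (ρ δ : ℝ), 0 < ρ → 0 < δ → ‖w‖ + ρ + δ < R₁ →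
      ∫⁻ z, lconv (moll δ) (lam ρ) (z - w) ∂μ =
        ∫⁻ z in ball 0 R₁, lconv (moll δ) (lam ρ) (z - w) ∂μ := by
    intro w ρ δ hρ hδ hw
    refine (setLIntegral_eq_of_support_subset fun z hz => ?_).symm
    have h8 := norm_lt_of_lconv_moll_ne_zero hδ (fun z => norm_lt_of_lam_ne_zero hρ) hz
    have h6 : ‖z‖ ≤ ‖w‖ + ‖z - w‖ := by simpa using norm_add_le w (z - w)
    exact hmem (by linarith)
  have hmean : ∀ (w : ℂ) (ρ δ : ℝ), 0 < ρ → 0 < δ → ‖w‖ + ρ + δ < R₁ →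
      lmean (lconv (moll δ) q) w ρ = lconv (moll δ) q w := by
    intro w ρ δ hρ hδ hw
    -- `κ` is the defect of the mollified `p` and also of the mollified `P`, so none is left for the
    -- mollified `q`.
    set κ := ∫⁻ z, lconv (moll δ) (lam ρ) (z - w) ∂μ
    have h1 : κ + lmean (lconv (moll δ) p) w ρ = lconv (moll δ) p w := hid w ρ δ hρ hδ hw
    have h2 : lconv (moll δ) P w = lmean (lconv (moll δ) P) w ρ + κ := by
      rw [show κ = _ from hκ w ρ δ hρ hδ hw, ← lconv_moll_lintegral_lam, lmean_lconv (by fun_prop)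
        hPm, ← lconv_add (by fun_prop) (by fun_prop)]
      refine lconv_congr fun z hz => hPmean _ ρ hρ ?_
      linarith [norm_add_le w z, norm_lt_of_moll_ne_zero hδ hz]
    have h3 : lmean (lconv (moll δ) p) w ρ =
        lmean (lconv (moll δ) P) w ρ + lmean (lconv (moll δ) q) w ρ := by
      rw [← lmean_add (by fun_prop)]
      exact lmean_congr hρ.le fun x hx => hmollp x δ hδ (by linarith [hnorm hx])
    rw [hmollp w δ hδ (by linarith), h3, ← add_assoc, add_comm κ, ← h2] at h1
    exact (ENNReal.add_right_inj (lconv_moll_ne_top hδ hPint w)).1 h1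
  obtain ⟨H, hHh, hH0, hHq⟩ := exists_harmonic_of_mean_eq hqm hqint hmean
  refine ⟨μ, H, hμ, hHh, hH0, fun w hw => ?_⟩
  set D := R₁ - ‖w‖
  have hD : 0 < D := by simp only [D]; linarith
  set δ : ℕ → ℝ := fun n => D / 3 / (n + 1)
  have hδ0 : ∀ n, 0 < δ n := fun n => by positivity
  have hδle : ∀ n, δ n ≤ D / 3 := fun n => div_le_self (by positivity) (by simp)
  have hδlim : Tendsto δ atTop (𝓝 0) := by
    have := (tendsto_one_div_add_atTop_nhds_zero_nat (𝕜 := ℝ)).const_mul (D / 3)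
    simpa [δ, div_eq_mul_inv] using this
  -- The identity is obtained at every point: the mollifications of `p` and `P` converge at `w`, and
  -- that of `q` is already `H w` for these `δ`.
  have htend : ∀ f : ℂ → ℝ≥0∞, Measurable f → LowerSemicontinuousAt f w →
      (∀ t, 0 < t → t < D → lmean f w t ≤ f w) →
      Tendsto (fun n => lconv (moll (δ n)) f w) atTop (𝓝 (f w)) := fun f hf hl hm =>
    tendsto_lconv hδlim (fun n => measurable_moll _) (fun n => isRadial_moll _)
      (.of_forall fun n => lintegral_moll (hδ0 n))
      (fun n z hz => (norm_lt_of_moll_ne_zero (hδ0 n) hz).le) hf hl hD hm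
  have h1 := htend p hpm (hp.lsc w) fun t ht htD => hp.mean w t ht (by simp only [D] at htD; linarith)
  have h2 := htend P hPm ?_ fun t ht htD => by
    rw [hPmean w t ht (by simp only [D] at htD; linarith)]; exact le_self_add
  · rw [← hPeq hw]
    refine tendsto_nhds_unique h1 ((h2.add (tendsto_const_nhds (x := ENNReal.ofReal (H w)))).congr
      fun n => ?_)
    have := hδle n
    rw [hmollp w (δ n) (hδ0 n) (by simp only [D] at *; linarith),
      hHq w (δ n) (hδ0 n) (by simp only [D] at *; linarith)]
  · have h3 := lowerSemicontinuousAt_greenPotential (μ := μ) hR (hw.trans hR)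
    refine fun y hy => ?_
    replace hy : y < P w := hy
    rw [hPeq hw] at hy
    filter_upwards [h3 y hy, isOpen_ball.mem_nhds (hmem hw)] with x hx hxb
    change y < P x
    rw [hPeq (by simpa using hxb)]
    exact hx

end EffectiveRiesz

end

noncomputable section

namespace EffectiveRiesz

open Set Filter Topology InnerProductSpace

/-! ### Harnack's inequality -/

/-- Bound the Poisson kernel by its maximum on circles of radius `s < S`, up to which `g` is
harmonic, and let `s → S`. -/
lemma harmonic_le_of_nonneg {g : ℂ → ℝ} {S T : ℝ} (hg : HarmonicOnNhd g (ball 0 S))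
    (h0 : ∀ z ∈ ball (0 : ℂ) S, 0 ≤ g z) (hT : T < S) {w : ℂ} (hw : ‖w‖ ≤ T) :
    g w ≤ (S + T) / (S - T) * g 0 := by
  have hT0 : 0 ≤ T := (norm_nonneg w).trans hw
  have h00 : 0 ≤ g 0 := h0 0 (by simp; linarith)
  have key : ∀ s, T < s → s < S → g w ≤ (s + T) / (s - T) * g 0 := by
    intro s hTs hsS
    have hs : 0 < s := hT0.trans_lt hTs
    have hgs : HarmonicOnNhd g (closedBall 0 s) := hg.mono (closedBall_subset_ball hsS)
    have hwb : w ∈ ball (0 : ℂ) s := by simpa using hw.trans_lt hTs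
    have hgc : ContinuousOn g (sphere 0 |s|) := by
      rw [abs_of_pos hs]
      exact hgs.continuousOn.mono sphere_subset_closedBall
    have h1 := hgs.circleAverage_re_herglotzRieszKernel_smul hwb
    have h2 : Real.circleAverage g 0 s = g 0 := by
      refine InnerProductSpace.HarmonicOnNhd.circleAverage_eq ?_
      rwa [abs_of_pos hs]
    have h3 : Real.circleAverage (fun z => (s + T) / (s - T) * g z) 0 s =
        (s + T) / (s - T) * g 0 := by
      rw [← h2]
      exact Real.circleAverage_fun_smul (a := (s + T) / (s - T))
    rw [← h1, ← h3]
    refine Real.circleAverage_mono ?_ ?_ fun z hz => ?_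
    · refine ContinuousOn.circleIntegrable' ?_
      exact (Complex.continuous_re.comp_continuousOn
        (continuousOn_herglotzRieszKernel_sphere hwb)).smul hgc
    · exact (continuousOn_const.mul hgc).circleIntegrable'
    · rw [abs_of_pos hs] at hz
      have h4 := re_herglotzRieszKernel_le hz hwb
      have h5 : (s + ‖w - 0‖) / (s - ‖w - 0‖) ≤ (s + T) / (s - T) := by
        rw [sub_zero]
        gcongr
      simp only [Pi.smul_apply', Function.comp_apply, herglotzRieszKernel_def, smul_eq_mul]
      have hz' : z ∈ ball (0 : ℂ) S := sphere_subset_ball hsS hz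
      exact mul_le_mul_of_nonneg_right (h4.trans h5) (h0 z hz')
  have hlim : Tendsto (fun s => (s + T) / (s - T) * g 0) (𝓝[<] S)
      (𝓝 ((S + T) / (S - T) * g 0)) := by
    have : ContinuousAt (fun s => (s + T) / (s - T) * g 0) S :=
      ((continuousAt_id.add continuousAt_const).div (continuousAt_id.sub continuousAt_const)
        (sub_ne_zero.2 hT.ne')).mul continuousAt_const
    exact this.tendsto.mono_left nhdsWithin_le_nhds
  refine ge_of_tendsto hlim ?_
  filter_upwards [Ioo_mem_nhdsLT hT] with s hs using key s hs.1 hs.2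

/-! ### The Poisson kernel on the unit circle -/

/-- The Poisson kernel of the circle of radius `T`, at points of the unit circle. -/
def pk (T x : ℝ) : ℝ := (T ^ 2 - 1) / (T ^ 2 + 1 - 2 * T * Real.cos (2 * Real.pi * x))

/-- The derivative of the kernel `pk T`. -/
def pk' (T x : ℝ) : ℝ := -((T ^ 2 - 1) * (4 * Real.pi * T) * Real.sin (2 * Real.pi * x)) /
  (T ^ 2 + 1 - 2 * T * Real.cos (2 * Real.pi * x)) ^ 2

/-- The second derivative of the kernel `pk T`. -/
def pk'' (T x : ℝ) : ℝ := -((T ^ 2 - 1) * (8 * Real.pi ^ 2 * T) *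
    (2 * T * Real.cos (2 * Real.pi * x) ^ 2 + (T ^ 2 + 1) * Real.cos (2 * Real.pi * x) - 4 * T)) /
  (T ^ 2 + 1 - 2 * T * Real.cos (2 * Real.pi * x)) ^ 3

section kernel

variable {T : ℝ}

lemma pk_denom_pos (hT : 1 < T) (x : ℝ) : 0 < T ^ 2 + 1 - 2 * T * Real.cos (2 * Real.pi * x) := by
  nlinarith [Real.cos_le_one (2 * Real.pi * x)]

lemma hasDerivAt_cos_two_pi (x : ℝ) : HasDerivAt (fun x => Real.cos (2 * Real.pi * x))
    (-Real.sin (2 * Real.pi * x) * (2 * Real.pi)) x := by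
  have h := (hasDerivAt_id x).const_mul (2 * Real.pi)
  simpa using h.cos

lemma hasDerivAt_sin_two_pi (x : ℝ) : HasDerivAt (fun x => Real.sin (2 * Real.pi * x))
    (Real.cos (2 * Real.pi * x) * (2 * Real.pi)) x := by
  have h := (hasDerivAt_id x).const_mul (2 * Real.pi)
  simpa using h.sin

lemma hasDerivAt_pk_denom (x : ℝ) :
    HasDerivAt (fun x => T ^ 2 + 1 - 2 * T * Real.cos (2 * Real.pi * x))
      (4 * Real.pi * T * Real.sin (2 * Real.pi * x)) x := by
  have h := ((hasDerivAt_cos_two_pi x).const_mul (2 * T)).const_sub (T ^ 2 + 1)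
  exact h.congr_deriv (by ring)

lemma hasDerivAt_pk (hT : 1 < T) (x : ℝ) : HasDerivAt (pk T) (pk' T x) x := by
  have h := (hasDerivAt_const x (T ^ 2 - 1)).div (hasDerivAt_pk_denom x) (pk_denom_pos hT x).ne'
  refine h.congr_deriv ?_
  rw [pk']
  ring

lemma hasDerivAt_pk' (hT : 1 < T) (x : ℝ) : HasDerivAt (pk' T) (pk'' T x) x := by
  have hD := (pk_denom_pos hT x).ne'
  have h := (((hasDerivAt_sin_two_pi x).const_mul ((T ^ 2 - 1) * (4 * Real.pi * T))).neg).div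
    ((hasDerivAt_pk_denom (T := T) x).pow 2) (pow_ne_zero 2 hD)
  refine h.congr_deriv ?_
  rw [pk'']
  have hs : Real.sin (2 * Real.pi * x) ^ 2 = 1 - Real.cos (2 * Real.pi * x) ^ 2 := by
    rw [Real.sin_sq]
  simp only [Pi.neg_apply, Pi.pow_apply]
  rw [div_eq_div_iff (pow_ne_zero _ (pow_ne_zero _ hD)) (pow_ne_zero _ hD)]
  generalize Real.sin (2 * Real.pi * x) = s at *
  generalize Real.cos (2 * Real.pi * x) = c at *
  push_cast
  linear_combination (-(T ^ 2 - 1) * (4 * Real.pi * T) * (-2) * (4 * Real.pi * T) *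
    (T ^ 2 + 1 - 2 * T * c) ^ 4) * hs

lemma continuous_pk' (hT : 1 < T) : Continuous (pk' T) :=
  continuous_iff_continuousAt.2 fun x => (hasDerivAt_pk' hT x).continuousAt

lemma continuous_pk'' (hT : 1 < T) : Continuous (pk'' T) := by
  unfold pk''
  exact Continuous.div (by fun_prop) (by fun_prop) fun x => pow_ne_zero _ (pk_denom_pos hT x).ne'

lemma two_pi_mul_add_one (x : ℝ) : 2 * Real.pi * (x + 1) = 2 * Real.pi * x + 2 * Real.pi := by ring

lemma pk'_periodic (T : ℝ) : Function.Periodic (pk' T) 1 := fun x => by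
  simp only [pk', two_pi_mul_add_one, Real.cos_add_two_pi, Real.sin_add_two_pi]

lemma pk''_periodic (T : ℝ) : Function.Periodic (pk'' T) 1 := fun x => by
  simp only [pk'', two_pi_mul_add_one, Real.cos_add_two_pi]

/-- This is the total variation of `pk T` over a period. The kernel falls from `(T + 1) / (T - 1)`
at `0` to `(T - 1) / (T + 1)` at `1/2` and rises back. -/
lemma integral_abs_pk' (hT : 1 < T) : ∫ x in (0 : ℝ)..1, |pk' T x| = 8 * T / (T ^ 2 - 1) := by
  have hc := continuous_pk' hT
  have hT1 : 0 < T ^ 2 - 1 := by nlinarith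
  have hpi := Real.pi_pos
  have h1 : ∫ x in (0 : ℝ)..(1 / 2), |pk' T x| = pk T 0 - pk T (1 / 2) := by
    have h := intervalIntegral.integral_eq_sub_of_hasDerivAt
      (fun x _ => hasDerivAt_pk hT x) (hc.intervalIntegrable 0 (1 / 2))
    rw [← neg_sub (pk T (1 / 2)), ← h, ← intervalIntegral.integral_neg]
    refine intervalIntegral.integral_congr fun x hx => ?_
    rw [uIcc_of_le (by norm_num)] at hx
    refine abs_of_nonpos (div_nonpos_of_nonpos_of_nonneg (neg_nonpos.2 ?_) (sq_nonneg _))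
    refine mul_nonneg (by positivity) (Real.sin_nonneg_of_nonneg_of_le_pi ?_ ?_)
    · have := hx.1; positivity
    · nlinarith [hx.2]
  have h2 : ∫ x in (1 / 2 : ℝ)..1, |pk' T x| = pk T 1 - pk T (1 / 2) := by
    have h := intervalIntegral.integral_eq_sub_of_hasDerivAt
      (fun x _ => hasDerivAt_pk hT x) (hc.intervalIntegrable (1 / 2) 1)
    rw [← h]
    refine intervalIntegral.integral_congr fun x hx => ?_
    rw [uIcc_of_le (by norm_num)] at hx
    refine abs_of_nonneg (div_nonneg (neg_nonneg.2 ?_) (sq_nonneg _))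
    refine mul_nonpos_of_nonneg_of_nonpos (by positivity) ?_
    rw [← Real.sin_sub_two_pi]
    refine Real.sin_nonpos_of_nonpos_of_neg_pi_le ?_ ?_
    · nlinarith [hx.2]
    · nlinarith [hx.1]
  rw [← intervalIntegral.integral_add_adjacent_intervals (b := 1 / 2)
    (hc.abs.intervalIntegrable _ _) (hc.abs.intervalIntegrable _ _), h1, h2]
  have e1 : pk T 0 = (T ^ 2 - 1) / (T - 1) ^ 2 := by simp only [pk]; simp; ring
  have e2 : pk T 1 = (T ^ 2 - 1) / (T - 1) ^ 2 := by simp only [pk]; simp; ring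
  have e3 : pk T (1 / 2) = (T ^ 2 - 1) / (T + 1) ^ 2 := by
    rw [pk, show 2 * Real.pi * (1 / 2) = Real.pi by ring, Real.cos_pi]; congr 1; ring
  rw [e1, e2, e3]
  have h3 : T - 1 ≠ 0 := by linarith
  have h4 : T + 1 ≠ 0 := by linarith
  have h5 : T ^ 2 - 1 = (T - 1) * (T + 1) := by ring
  rw [h5]
  field_simp
  ring

/-- This is the total variation of `pk' T`, which is zero at `0` and `1`, odd about `1/2`, and
monotone between its extrema at `x₀` and `1 - x₀`; so it equals `4 |pk' T x₀|`. The cosine `c₀` at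
`x₀` solves a quadratic equation with discriminant `(T² + 1)² + 32 T² = T⁴ + 34 T² + 1`. -/
lemma integral_abs_pk'' (hT : 1 < T) : ∫ x in (0 : ℝ)..1, |pk'' T x| =
    16 * Real.pi * (T ^ 2 - 1) * √(16 * T ^ 2 - (√(T ^ 4 + 34 * T ^ 2 + 1) - 1 - T ^ 2) ^ 2) /
      (3 * T ^ 2 + 3 - √(T ^ 4 + 34 * T ^ 2 + 1)) ^ 2 := by
  have hT0 : 0 < T := by linarith
  have hT1 : 0 < T ^ 2 - 1 := by nlinarith
  have hpi := Real.pi_pos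
  have hc := continuous_pk'' hT
  set W := √(T ^ 4 + 34 * T ^ 2 + 1)
  have hW : W ^ 2 = T ^ 4 + 34 * T ^ 2 + 1 := Real.sq_sqrt (by positivity)
  have hW0 : 0 ≤ W := Real.sqrt_nonneg _
  have hW1 : T ^ 2 + 1 < W := by
    refine lt_of_pow_lt_pow_left₀ 2 hW0 ?_
    rw [hW]; nlinarith
  have hW2 : W < T ^ 2 + 1 + 4 * T := by
    refine lt_of_pow_lt_pow_left₀ 2 (by positivity) ?_
    rw [hW]
    nlinarith [mul_pos hT0 (pow_pos (sub_pos.2 hT) 2)]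
  set c₀ := (W - 1 - T ^ 2) / (4 * T)
  have hc₀T : 4 * T * c₀ = W - 1 - T ^ 2 := mul_div_cancel₀ _ (by positivity)
  have hc₀0 : 0 < c₀ := div_pos (by linarith) (by positivity)
  have hc₀1 : c₀ < 1 := (div_lt_one (by positivity)).2 (by linarith)
  have hroot : 2 * T * c₀ ^ 2 + (T ^ 2 + 1) * c₀ - 4 * T = 0 := by
    have h1 : 8 * T * (2 * T * c₀ ^ 2 + (T ^ 2 + 1) * c₀ - 4 * T) =
        (4 * T * c₀) ^ 2 + 2 * (T ^ 2 + 1) * (4 * T * c₀) - 32 * T ^ 2 := by ring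
    rw [hc₀T] at h1
    have h2 : 8 * T * (2 * T * c₀ ^ 2 + (T ^ 2 + 1) * c₀ - 4 * T) = 0 := by
      rw [h1]; linear_combination hW
    exact (mul_eq_zero.1 h2).resolve_left (by positivity)
  have hQ : ∀ c, 2 * T * c ^ 2 + (T ^ 2 + 1) * c - 4 * T =
      (c - c₀) * (2 * T * (c + c₀) + (T ^ 2 + 1)) := fun c => by linear_combination hroot
  -- The second root lies below `-1`, so the sign of `pk''` is decided by comparing the cosine with
  -- `c₀`.
  have hfac : ∀ c, -1 ≤ c → 0 < 2 * T * (c + c₀) + (T ^ 2 + 1) := fun c hc => by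
    nlinarith [mul_pos hT0 hc₀0]
  set a := Real.arccos c₀
  have ha0 : 0 ≤ a := Real.arccos_nonneg _
  have haπ : a ≤ Real.pi := Real.arccos_le_pi _
  have hcosa : Real.cos a = c₀ := Real.cos_arccos (by linarith) hc₀1.le
  set x₀ := a / (2 * Real.pi)
  have hx₀ : 2 * Real.pi * x₀ = a := mul_div_cancel₀ _ (by positivity)
  have hx₀0 : 0 ≤ x₀ := by positivity
  have hx₀h : x₀ ≤ 1 / 2 := by
    rw [div_le_iff₀ (by positivity)]; linarith
  have hnonpos : ∀ x, c₀ ≤ Real.cos (2 * Real.pi * x) → pk'' T x ≤ 0 := fun x hx => by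
    refine div_nonpos_of_nonpos_of_nonneg (neg_nonpos.2 (mul_nonneg (by positivity) ?_))
      (pow_pos (pk_denom_pos hT x) _).le
    rw [hQ]
    exact mul_nonneg (by linarith) (hfac _ (Real.neg_one_le_cos _)).le
  have hnonneg : ∀ x, Real.cos (2 * Real.pi * x) ≤ c₀ → 0 ≤ pk'' T x := fun x hx => by
    refine div_nonneg (neg_nonneg.2 (mul_nonpos_of_nonneg_of_nonpos (by positivity) ?_))
      (pow_pos (pk_denom_pos hT x) _).le
    rw [hQ]
    exact mul_nonpos_of_nonpos_of_nonneg (by linarith) (hfac _ (Real.neg_one_le_cos _)).le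
  have hFTC : ∀ s t, ∫ x in s..t, pk'' T x = pk' T t - pk' T s := fun s t =>
    intervalIntegral.integral_eq_sub_of_hasDerivAt (fun x _ => hasDerivAt_pk' hT x)
      (hc.intervalIntegrable s t)
  have hcos_refl : ∀ x, Real.cos (2 * Real.pi * x) = Real.cos (2 * Real.pi * (1 - x)) := fun x => by
    rw [show 2 * Real.pi * (1 - x) = 2 * Real.pi - 2 * Real.pi * x by ring, Real.cos_two_pi_sub]
  have hup : ∀ x, 0 ≤ x → x ≤ x₀ → c₀ ≤ Real.cos (2 * Real.pi * x) := fun x h0 h1 => by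
    rw [← hcosa]
    refine Real.cos_le_cos_of_nonneg_of_le_pi (by positivity) haπ ?_
    rw [← hx₀]; gcongr
  have hdown : ∀ x, x₀ ≤ x → x ≤ 1 / 2 → Real.cos (2 * Real.pi * x) ≤ c₀ := fun x h0 h1 => by
    rw [← hcosa]
    refine Real.cos_le_cos_of_nonneg_of_le_pi ha0 (by nlinarith) ?_
    rw [← hx₀]; gcongr
  have i1 : ∫ x in (0 : ℝ)..x₀, |pk'' T x| = -(pk' T x₀ - pk' T 0) := by
    rw [← hFTC, ← intervalIntegral.integral_neg]
    refine intervalIntegral.integral_congr fun x hx => ?_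
    rw [uIcc_of_le hx₀0] at hx
    exact abs_of_nonpos (hnonpos x (hup x hx.1 hx.2))
  have i2 : ∫ x in x₀..(1 - x₀), |pk'' T x| = pk' T (1 - x₀) - pk' T x₀ := by
    rw [← hFTC]
    refine intervalIntegral.integral_congr fun x hx => ?_
    rw [uIcc_of_le (by linarith)] at hx
    refine abs_of_nonneg (hnonneg x ?_)
    rcases le_total x (1 / 2) with h | h
    · exact hdown x hx.1 h
    · rw [hcos_refl]; exact hdown _ (by linarith [hx.2]) (by linarith)
  have i3 : ∫ x in (1 - x₀)..1, |pk'' T x| = -(pk' T 1 - pk' T (1 - x₀)) := by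
    rw [← hFTC, ← intervalIntegral.integral_neg]
    refine intervalIntegral.integral_congr fun x hx => ?_
    rw [uIcc_of_le (by linarith)] at hx
    refine abs_of_nonpos (hnonpos x ?_)
    rw [hcos_refl]
    exact hup _ (by linarith [hx.2]) (by linarith [hx.1])
  have k0 : pk' T 0 = 0 := by simp [pk']
  have k1 : pk' T 1 = 0 := by simp [pk']
  have k2 : pk' T (1 - x₀) = -pk' T x₀ := by
    simp only [pk']
    rw [← hcos_refl, show 2 * Real.pi * (1 - x₀) = 2 * Real.pi - 2 * Real.pi * x₀ by ring,
      Real.sin_two_pi_sub]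
    ring
  have hci := hc.abs.intervalIntegrable (μ := volume)
  rw [← intervalIntegral.integral_add_adjacent_intervals (b := 1 - x₀) (hci _ _) (hci _ _),
    ← intervalIntegral.integral_add_adjacent_intervals (b := x₀) (hci _ _) (hci _ _), i1, i2, i3,
    k0, k1, k2, pk', hx₀, hcosa, Real.sin_arccos]
  have hsq : √(16 * T ^ 2 - (W - 1 - T ^ 2) ^ 2) = 4 * T * √(1 - c₀ ^ 2) := by
    rw [← hc₀T, show 16 * T ^ 2 - (4 * T * c₀) ^ 2 = (4 * T) ^ 2 * (1 - c₀ ^ 2) by ring,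
      Real.sqrt_mul (by positivity), Real.sqrt_sq (by positivity)]
  have hden : 3 * T ^ 2 + 3 - W = 2 * (T ^ 2 + 1 - 2 * T * c₀) := by linear_combination hc₀T
  have hD : T ^ 2 + 1 - 2 * T * c₀ ≠ 0 := by nlinarith
  rw [hsq, hden]
  field_simp
  ring

end kernel

end EffectiveRiesz

end

noncomputable section

namespace EffectiveRiesz

open Set Filter Topology InnerProductSpace

/-! ### Derivative bounds on the unit circle -/

lemma hasDerivAt_convolution_interval {k k' g : ℝ → ℝ} (hk : ∀ x, HasDerivAt k (k' x) x)
    (hk' : Continuous k') (hper : Function.Periodic k' 1) (hg : Continuous g) (φ : ℝ) :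
    HasDerivAt (fun φ => ∫ t in (0 : ℝ)..1, k (φ - t) * g t)
      (∫ t in (0 : ℝ)..1, k' (φ - t) * g t) φ := by
  have hkc : Continuous k := continuous_iff_continuousAt.2 fun x => (hk x).continuousAt
  obtain ⟨C, hC⟩ : ∃ C, ∀ x, ‖k' x‖ ≤ C := by
    obtain ⟨C, hC⟩ := (isCompact_Icc (a := (0 : ℝ)) (b := 1)).exists_bound_of_continuousOn
      hk'.continuousOn
    refine ⟨C, fun x => ?_⟩
    obtain ⟨y, hy, hxy⟩ := hper.exists_mem_Ico₀ one_pos x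
    rw [hxy]
    exact hC y (Ico_subset_Icc_self hy)
  refine (intervalIntegral.hasDerivAt_integral_of_dominated_loc_of_deriv_le
    (F := fun φ t => k (φ - t) * g t) (F' := fun φ t => k' (φ - t) * g t)
    (bound := fun t => C * ‖g t‖) univ_mem ?_ ?_ ?_ ?_ ?_ ?_).2
  · exact Eventually.of_forall fun x => (by fun_prop : Continuous _).aestronglyMeasurable
  · exact (by fun_prop : Continuous _).intervalIntegrable _ _
  · exact (by fun_prop : Continuous _).aestronglyMeasurable
  · refine Eventually.of_forall fun t _ x _ => ?_
    rw [norm_mul]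
    exact mul_le_mul_of_nonneg_right (hC _) (norm_nonneg _)
  · exact (by fun_prop : Continuous _).intervalIntegrable _ _
  · refine Eventually.of_forall fun t _ x _ => ?_
    exact ((hk (x - t)).comp_sub_const x t).mul_const (g t)

/-- Young's inequality on the circle; periodicity of `k` removes the shift by `φ`. -/
lemma abs_convolution_interval_le {k g : ℝ → ℝ} (hk : Continuous k)
    (hper : Function.Periodic k 1) (hg : Continuous g) {A : ℝ} (hA : ∀ t, |g t| ≤ A) (φ : ℝ) :
    |∫ t in (0 : ℝ)..1, k (φ - t) * g t| ≤ A * ∫ t in (0 : ℝ)..1, |k t| := by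
  have h1 : ∫ t in (0 : ℝ)..1, |k (φ - t)| = ∫ t in (0 : ℝ)..1, |k t| := by
    rw [intervalIntegral.integral_comp_sub_left (fun t => |k t|) φ]
    have hp : Function.Periodic (fun t => |k t|) 1 := fun x => by simp only [hper x]
    have := hp.intervalIntegral_add_eq (φ - 1) 0
    simpa using this
  rw [← h1, ← intervalIntegral.integral_const_mul]
  refine (intervalIntegral.abs_integral_le_integral_abs zero_le_one).trans ?_
  refine intervalIntegral.integral_mono_on zero_le_one
    ((by fun_prop : Continuous _).intervalIntegrable _ _)
    ((by fun_prop : Continuous _).intervalIntegrable _ _) fun t _ => ?_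
  rw [abs_mul, mul_comm A]
  exact mul_le_mul_of_nonneg_left (hA t) (abs_nonneg _)

lemma norm_mul_e_sub_e_sq (T t φ : ℝ) :
    ‖(T : ℂ) * e t - e φ‖ ^ 2 = T ^ 2 + 1 - 2 * T * Real.cos (2 * Real.pi * (φ - t)) := by
  rw [← Complex.normSq_eq_norm_sq, e_eq_exp_mul_I, e_eq_exp_mul_I, Complex.normSq_apply]
  simp only [Complex.sub_re, Complex.sub_im, Complex.re_ofReal_mul, Complex.im_ofReal_mul,
    Complex.exp_ofReal_mul_I_re, Complex.exp_ofReal_mul_I_im]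
  rw [show 2 * Real.pi * (φ - t) = 2 * Real.pi * φ - 2 * Real.pi * t by ring, Real.cos_sub]
  linear_combination T ^ 2 * Real.sin_sq_add_cos_sq (2 * Real.pi * t) +
    Real.sin_sq_add_cos_sq (2 * Real.pi * φ)

lemma poisson_formula_e {f : ℂ → ℝ} {T : ℝ} (hT : 1 < T)
    (hf : HarmonicOnNhd f (closedBall 0 T)) (φ : ℝ) :
    f (e φ) = ∫ t in (0 : ℝ)..1, pk T (φ - t) * f (T * e t) := by
  have h := hf.circleAverage_poissonKernel_smul (w := e φ) (by simpa [norm_e] using hT)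
  rw [circleAverage_eq_integral_e, ← intervalIntegral.integral_of_le zero_le_one] at h
  rw [← h]
  refine intervalIntegral.integral_congr fun t _ => ?_
  have h0 : ‖(T : ℂ) * e t‖ = T := by
    rw [norm_mul, norm_e, mul_one, Complex.norm_real, Real.norm_of_nonneg (by linarith)]
  simp only [Pi.smul_apply', smul_eq_mul, poissonKernel_def, zero_add, sub_zero, h0, norm_e,
    norm_mul_e_sub_e_sq, pk]
  norm_num

/-- Poisson's formula is applied to `h - c`: derivatives do not see the constant, so only the
deviation from `c` on `|w| = T` enters. -/
theorem abs_iteratedDeriv_comp_e_le {h : ℂ → ℝ} {S T A c : ℝ} (hT : 1 < T) (hTS : T < S)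
    (hh : HarmonicOnNhd h (ball 0 S)) (hA : ∀ w : ℂ, ‖w‖ ≤ T → |h w - c| ≤ A) (φ : ℝ) :
    |iteratedDeriv 1 (fun t : ℝ => h (e t)) φ| ≤ A * (8 * T / (T ^ 2 - 1)) ∧
    |iteratedDeriv 2 (fun t : ℝ => h (e t)) φ| ≤ A * (16 * Real.pi * (T ^ 2 - 1) *
        √(16 * T ^ 2 - (√(T ^ 4 + 34 * T ^ 2 + 1) - 1 - T ^ 2) ^ 2) /
      (3 * T ^ 2 + 3 - √(T ^ 4 + 34 * T ^ 2 + 1)) ^ 2) := by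
  have hnorm : ∀ t, ‖(T : ℂ) * e t‖ = T := fun t => by
    rw [norm_mul, norm_e, mul_one, Complex.norm_real, Real.norm_of_nonneg (by linarith)]
  have hcl : HarmonicOnNhd (fun w => h w - c) (closedBall 0 T) :=
    (hh.mono (closedBall_subset_ball hTS)).sub (harmonicOnNhd_const c)
  set g : ℝ → ℝ := fun t => h (T * e t) - c
  have hg : Continuous g := by
    refine hcl.continuousOn.comp_continuous (f := fun t : ℝ => (T : ℂ) * e t)
      (continuous_const.mul continuous_e) fun t => ?_
    rw [mem_closedBall_zero_iff, hnorm]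
  have hgA : ∀ t, |g t| ≤ A := fun t => hA _ (hnorm t).le
  have h0 : (fun t : ℝ => h (e t)) = fun φ => (∫ t in (0 : ℝ)..1, pk T (φ - t) * g t) + c := by
    funext φ
    rw [← poisson_formula_e hT hcl φ]
    ring
  have h1 : ∀ φ, HasDerivAt (fun t : ℝ => h (e t)) (∫ t in (0 : ℝ)..1, pk' T (φ - t) * g t) φ := by
    intro φ
    rw [h0]
    exact (hasDerivAt_convolution_interval (hasDerivAt_pk hT) (continuous_pk' hT)
      (pk'_periodic T) hg φ).add_const c
  have h2 : deriv (fun t : ℝ => h (e t)) = fun φ => ∫ t in (0 : ℝ)..1, pk' T (φ - t) * g t :=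
    funext fun φ => (h1 φ).deriv
  constructor
  · rw [iteratedDeriv_one, h2, ← integral_abs_pk' hT]
    exact abs_convolution_interval_le (continuous_pk' hT) (pk'_periodic T) hg hgA φ
  · rw [iteratedDeriv_succ, iteratedDeriv_one, h2, (hasDerivAt_convolution_interval
      (hasDerivAt_pk' hT) (continuous_pk'' hT) (pk''_periodic T) hg φ).deriv,
      ← integral_abs_pk'' hT]
    exact abs_convolution_interval_le (continuous_pk'' hT) (pk''_periodic T) hg hgA φ

end EffectiveRiesz

end

noncomputable section

namespace EffectiveRiesz

open Set Filter Topology InnerProductSpace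

/-! ### Extended integrals of functions bounded above -/

lemma ofReal_sub_add_ofReal {a b : ℝ} (h : a ≤ b) :
    ENNReal.ofReal (b - a) + ENNReal.ofReal a + ENNReal.ofReal (-b) =
      ENNReal.ofReal b + ENNReal.ofReal (-a) := by
  rw [← ENNReal.toReal_eq_toReal_iff' (by finiteness) (by finiteness),
    ENNReal.toReal_add (by finiteness) (by finiteness),
    ENNReal.toReal_add (by finiteness) (by finiteness),
    ENNReal.toReal_add (by finiteness) (by finiteness)]
  simp only [ENNReal.toReal_ofReal']
  grind

lemma toENNReal_sub_add_toENNReal {x : EReal} {b : ℝ} (h : x ≤ b) :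
    (b - x).toENNReal + x.toENNReal + ENNReal.ofReal (-b) =
      ENNReal.ofReal b + (-x).toENNReal := by
  induction x with
  | bot => simp
  | top => simp at h
  | coe a =>
    rw [← EReal.coe_sub, ← EReal.coe_neg]
    simp only [EReal.real_coe_toENNReal]
    exact ofReal_sub_add_ofReal (EReal.coe_le_coe_iff.1 h)

/-- Pointwise, `(b - f) + f⁺ + b⁻ = b⁺ + f⁻`, an identity of nonnegative terms that holds also for
`f = -∞`. After integration only the terms with `b - f` and `f⁻` can be infinite, and they are so
together. It serves for circle means, with constant `b`, and for the logarithmic potential. -/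
lemma extIntegral_eq_sub {α : Type*} [MeasurableSpace α] {ν : Measure α} {f : α → EReal}
    {b : α → ℝ} (hf : Measurable f) (hb : Measurable b) (hbi : Integrable b ν)
    (hfb : ∀ᵐ x ∂ν, f x ≤ b x) :
    extIntegral ν f = ((∫ x, b x ∂ν : ℝ) : EReal) -
      ((∫⁻ x, (b x - f x).toENNReal ∂ν : ℝ≥0∞) : EReal) := by
  have hm1 : Measurable fun x => (f x).toENNReal := hf.ereal_toENNReal
  have hpos : ∫⁻ x, ENNReal.ofReal (b x) ∂ν ≠ ⊤ := hbi.lintegral_lt_top.ne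
  have hneg : ∫⁻ x, ENNReal.ofReal (-b x) ∂ν ≠ ⊤ := hbi.neg.lintegral_lt_top.ne
  have hint := integral_eq_lintegral_pos_part_sub_lintegral_neg_part hbi
  have hle : ∫⁻ x, (f x).toENNReal ∂ν ≤ ∫⁻ x, ENNReal.ofReal (b x) ∂ν := by
    refine lintegral_mono_ae ?_
    filter_upwards [hfb] with x hx
    rw [← EReal.real_coe_toENNReal]
    exact EReal.toENNReal_le_toENNReal hx
  have key : ∫⁻ x, (b x - f x).toENNReal ∂ν + ∫⁻ x, (f x).toENNReal ∂ν +
      ∫⁻ x, ENNReal.ofReal (-b x) ∂ν =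
      ∫⁻ x, ENNReal.ofReal (b x) ∂ν + ∫⁻ x, (-f x).toENNReal ∂ν := by
    rw [← lintegral_add_right _ hm1, ← lintegral_add_right _ (by fun_prop),
      ← lintegral_add_left (by fun_prop)]
    refine lintegral_congr_ae ?_
    filter_upwards [hfb] with x hx using toENNReal_sub_add_toENNReal hx
  rw [extIntegral, hint]
  generalize ∫⁻ x, (b x - f x).toENNReal ∂ν = G at *
  generalize ∫⁻ x, ENNReal.ofReal (-b x) ∂ν = c at *
  generalize ∫⁻ x, (-f x).toENNReal ∂ν = d at *
  have ha := ne_top_of_le_ne_top hpos hle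
  clear hle
  generalize ∫⁻ x, (f x).toENNReal ∂ν = a at *
  generalize ∫⁻ x, ENNReal.ofReal (b x) ∂ν = b' at *
  lift a to NNReal using ha
  lift b' to NNReal using hpos
  lift c to NNReal using hneg
  induction G with
  | top =>
    have hd : d = ⊤ := by simpa [eq_comm] using key
    subst hd
    simp
  | coe G =>
    have hd : d ≠ ⊤ := by
      rintro rfl
      simp [← ENNReal.coe_add] at key
    lift d to NNReal using hd
    norm_cast at key
    have key' : (G : ℝ) + a + c = b' + d := by exact_mod_cast key
    simp only [EReal.coe_nnreal_eq_coe_real, ENNReal.coe_toReal]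
    rw [← EReal.coe_sub, ← EReal.coe_sub]
    congr 1
    linarith

/-! ### Reduction to superharmonic functions -/

/-- The defect `B - v`, extended by zero outside the open disc of radius `R`. -/
def superPart (v : ℂ → EReal) (B R : ℝ) : ℂ → ℝ≥0∞ :=
  (ball (0 : ℂ) R).indicator fun z => ((B : EReal) - v z).toENNReal

lemma superPart_of_norm_lt {v : ℂ → EReal} {B R : ℝ} {z : ℂ} (hz : ‖z‖ < R) :
    superPart v B R z = ((B : EReal) - v z).toENNReal :=
  indicator_of_mem (by simpa using hz) _

lemma continuous_coe_sub_toENNReal (B : ℝ) :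
    Continuous fun x : EReal => ((B : EReal) - x).toENNReal := by
  refine EReal.continuous_toENNReal.comp (continuous_iff_continuousAt.2 fun x => ?_)
  change ContinuousAt (fun x : EReal => (B : EReal) + -x) x
  exact ContinuousAt.comp (f := fun x : EReal => ((B : EReal), -x))
    (EReal.continuousAt_add (Or.inl (EReal.coe_ne_top B)) (Or.inl (EReal.coe_ne_bot B)))
    (continuousAt_const.prodMk continuous_neg.continuousAt)

lemma antitone_coe_sub_toENNReal (B : ℝ) :
    Antitone fun x : EReal => ((B : EReal) - x).toENNReal := fun _ _ h =>
  EReal.toENNReal_le_toENNReal (EReal.sub_le_sub le_rfl h)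

theorem SubharmonicOn.isSuperharmonicDisc {v : ℂ → EReal} {B R m : ℝ}
    (hv : SubharmonicOn v (closedBall 0 R)) (hB : ∀ z ∈ closedBall (0 : ℂ) R, v z ≤ (B : EReal))
    (hm : v 0 = (m : EReal)) (hR : 0 < R) : IsSuperharmonicDisc (superPart v B R) R where
  lsc z y hy := by
    by_cases hz : z ∈ ball (0 : ℂ) R
    swap
    · rw [superPart, indicator_of_notMem hz] at hy
      exact absurd hy not_lt_zero
    · have h1 : UpperSemicontinuousWithinAt v (closedBall 0 R) z :=
        hv.upperSemicontinuousOn z (ball_subset_closedBall hz)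
      have h2 := (continuous_coe_sub_toENNReal B).continuousAt.comp_upperSemicontinuousWithinAt_antitone
        h1 (antitone_coe_sub_toENNReal B)
      rw [superPart, indicator_of_mem hz] at hy
      have h3 := h2 y hy
      rw [nhdsWithin_eq_nhds.2 (mem_of_superset (isOpen_ball.mem_nhds hz) ball_subset_closedBall)]
        at h3
      filter_upwards [h3, isOpen_ball.mem_nhds hz] with x hx hxb
      rw [superPart, indicator_of_mem hxb]
      exact hx
  mean z r hr hzr := by
    have hmem : ∀ θ : ℝ, z + r * e θ ∈ ball (0 : ℂ) R := fun θ => by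
      rw [mem_ball_zero_iff]
      refine (norm_add_le _ _).trans_lt ?_
      simpa [abs_of_pos hr] using hzr
    have hsub : closedBall z r ⊆ closedBall (0 : ℂ) R := fun x hx => by
      rw [mem_closedBall_iff_norm] at hx
      rw [mem_closedBall_zero_iff]
      have : ‖x‖ ≤ ‖z‖ + ‖x - z‖ := by simpa using norm_add_le z (x - z)
      linarith
    have hcont : Continuous fun θ : ℝ => z + r * e θ := by
      have := continuous_e
      fun_prop
    have hmeas : Measurable fun θ : ℝ => v (z + r * e θ) := by
      refine UpperSemicontinuous.measurable (upperSemicontinuousOn_univ_iff.1 ?_)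
      exact hv.upperSemicontinuousOn.comp hcont.continuousOn
        fun θ _ => ball_subset_closedBall (hmem θ)
    have h1 := hv.le_circleMean z r hr hsub
    rw [circleMean, extIntegral_eq_sub (b := fun _ => B) hmeas measurable_const
      (integrable_const _) (.of_forall fun θ => hB _ (ball_subset_closedBall (hmem θ)))] at h1
    have h2 : ∫⁻ θ in Ioc (0 : ℝ) 1, ((B : EReal) - v (z + r * e θ)).toENNReal =
        lmean (superPart v B R) z r :=
      lintegral_congr fun θ => (superPart_of_norm_lt (by simpa using hmem θ)).symm
    rw [h2] at h1
    rw [superPart_of_norm_lt (by linarith)]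
    simp only [integral_const, measureReal_restrict_apply_univ, Real.volume_real_Ioc, smul_eq_mul,
      sub_zero, zero_le_one, sup_of_le_left, one_mul] at h1
    generalize lmean (superPart v B R) z r = L at *
    have hvz := hv.lt_top z (hsub (mem_closedBall_self hr.le))
    generalize v z = x at *
    induction x with
    | bot => simp
    | top => exact absurd hvz (lt_irrefl _)
    | coe x =>
      induction L with
      | top => simp at h1
      | coe L =>
        rw [EReal.coe_nnreal_eq_coe_real, ← EReal.coe_sub, EReal.coe_le_coe_iff] at h1
        rw [← EReal.coe_sub, EReal.real_coe_toENNReal, ← ENNReal.ofReal_coe_nnreal]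
        exact ENNReal.ofReal_le_ofReal (by linarith)
  outside z hz := indicator_of_notMem (by simpa using hz) _
  finite := by
    rw [superPart_of_norm_lt (by simpa using hR), hm, ← EReal.coe_sub, EReal.real_coe_toENNReal]
    exact ENNReal.ofReal_ne_top

/-! ### The harmonic part of the Green kernel -/

/-- The function `log |R² - z̄ w| - log R`, equal to `green R z w + log |z - w|` off the diagonal. -/
def greenRegular (R : ℝ) (z w : ℂ) : ℝ := Real.log ‖(R : ℂ) ^ 2 - starRingEnd ℂ z * w‖ - Real.log R

lemma greenRegular_zero {R : ℝ} (hR : 0 < R) (z : ℂ) : greenRegular R z 0 = Real.log R := by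
  rw [greenRegular, mul_zero, sub_zero, norm_pow, Complex.norm_real, Real.norm_of_nonneg hR.le,
    Real.log_pow]
  push_cast; ring

section regular

variable {R S : ℝ} {z w : ℂ}

lemma le_greenRegular (hSR : S < R) (hz : ‖z‖ < S) (hw : ‖w‖ < S) :
    Real.log (R ^ 2 - S ^ 2) - Real.log R ≤ greenRegular R z w := by
  have hS : 0 < S := (norm_nonneg z).trans_lt hz
  refine sub_le_sub_right (Real.log_le_log (by nlinarith) ?_) _
  refine le_trans ?_ (sub_le_norm_sq_sub_conj_mul R z w)
  nlinarith [norm_nonneg z, norm_nonneg w]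

lemma norm_conj_mul_div_le (hSR : S < R) (hz : ‖z‖ < S) (hw : ‖w‖ < S) :
    ‖-(starRingEnd ℂ z * w / (R : ℂ) ^ 2)‖ ≤ S ^ 2 / R ^ 2 := by
  have hS : 0 < S := (norm_nonneg z).trans_lt hz
  rw [norm_neg, norm_div, norm_mul, Complex.norm_conj, norm_pow, Complex.norm_real,
    Real.norm_of_nonneg (by linarith)]
  gcongr
  nlinarith [norm_nonneg z, norm_nonneg w]

lemma sq_div_sq_lt_one (hS : 0 < S) (hSR : S < R) : S ^ 2 / R ^ 2 < 1 := by
  rw [div_lt_one (by nlinarith)]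
  nlinarith

/-- Exhibits the regular part as the real part of a function of `w` that is holomorphic when `|z̄w|
< R²`, since then `1 - z̄w/R²` lies in the slit plane. Its integral over `z` is therefore harmonic.
-/
lemma greenRegular_eq_re_log (hR : 0 < R)
    (hn : 1 + -(starRingEnd ℂ z * w / (R : ℂ) ^ 2) ≠ 0) :
    greenRegular R z w = Real.log R +
      (Complex.log (1 + -(starRingEnd ℂ z * w / (R : ℂ) ^ 2))).re := by
  have hRc : (R : ℂ) ≠ 0 := by exact_mod_cast hR.ne'
  have h1 : (R : ℂ) ^ 2 - starRingEnd ℂ z * w =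
      (R : ℂ) ^ 2 * (1 + -(starRingEnd ℂ z * w / (R : ℂ) ^ 2)) := by
    field_simp
    ring
  rw [greenRegular, h1, norm_mul, Real.log_mul (by simpa using hR.ne') (norm_ne_zero_iff.2 hn),
    norm_pow, Complex.norm_real, Real.norm_of_nonneg hR.le, Real.log_pow, Complex.log_re]
  push_cast; ring

lemma measurable_greenRegular (R : ℝ) (w : ℂ) : Measurable fun z => greenRegular R z w := by
  unfold greenRegular
  have : Measurable fun z : ℂ => starRingEnd ℂ z := Complex.continuous_conj.measurable
  fun_prop

variable {μ : Measure ℂ} [IsFiniteMeasureOnCompacts μ]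

lemma integrable_log_one_add (hSR : S < R) (hw : ‖w‖ < S) :
    Integrable (fun z => Complex.log (1 + -(starRingEnd ℂ z * w / (R : ℂ) ^ 2)))
      (μ.restrict (ball 0 S)) := by
  have hS : 0 < S := (norm_nonneg w).trans_lt hw
  have hq := sq_div_sq_lt_one hS hSR
  have hc : Measurable fun z : ℂ => starRingEnd ℂ z := Complex.continuous_conj.measurable
  refine Integrable.of_bound (C := (1 - S ^ 2 / R ^ 2)⁻¹ / 2 + 1)
    (Measurable.aestronglyMeasurable (by fun_prop)) ?_
  filter_upwards [ae_restrict_mem measurableSet_ball] with z hz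
  have hz' : ‖z‖ < S := by simpa using hz
  have h1 := norm_conj_mul_div_le hSR hz' hw
  have h2 := h1.trans_lt hq
  refine (Complex.norm_log_one_add_le h2).trans ?_
  have h3 := norm_nonneg (-(starRingEnd ℂ z * w / (R : ℂ) ^ 2))
  generalize ‖-(starRingEnd ℂ z * w / (R : ℂ) ^ 2)‖ = x at *
  have hx : x ^ 2 * (1 - x)⁻¹ ≤ 1 * (1 - S ^ 2 / R ^ 2)⁻¹ := by
    refine mul_le_mul ?_ (inv_anti₀ (by linarith) (by linarith))
      (inv_nonneg.2 (by linarith)) zero_le_one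
    nlinarith
  linarith

lemma integrable_greenRegular (hSR : S < R) (hw : ‖w‖ < S) :
    Integrable (fun z => greenRegular R z w) (μ.restrict (ball 0 S)) := by
  have hS : 0 < S := (norm_nonneg w).trans_lt hw
  refine ((integrable_const (Real.log R)).add (integrable_log_one_add (μ := μ) hSR hw).re).congr ?_
  filter_upwards [ae_restrict_mem measurableSet_ball] with z hz
  have hz' : ‖z‖ < S := by simpa using hz
  exact (greenRegular_eq_re_log (hS.trans hSR) (Complex.slitPlane_ne_zero
    (Complex.mem_slitPlane_of_norm_lt_one ((norm_conj_mul_div_le hSR hz' hw).trans_lt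
      (sq_div_sq_lt_one hS hSR))))).symm

lemma differentiableAt_integral_log (hSR : S < R) (hw : ‖w‖ < S) :
    DifferentiableAt ℂ (fun w => ∫ z in ball 0 S,
      Complex.log (1 + -(starRingEnd ℂ z * w / (R : ℂ) ^ 2)) ∂μ) w := by
  have hS : 0 < S := (norm_nonneg w).trans_lt hw
  have hq := sq_div_sq_lt_one hS hSR
  have hc : Measurable fun z : ℂ => starRingEnd ℂ z := Complex.continuous_conj.measurable
  have hwb : ball (0 : ℂ) S ∈ 𝓝 w := isOpen_ball.mem_nhds (by simpa using hw)
  refine (hasDerivAt_integral_of_dominated_loc_of_deriv_le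
    (F' := fun w z => -(starRingEnd ℂ z / (R : ℂ) ^ 2) /
      (1 + -(starRingEnd ℂ z * w / (R : ℂ) ^ 2)))
    (bound := fun _ => S / R ^ 2 / (1 - S ^ 2 / R ^ 2)) hwb
    (.of_forall fun x => Measurable.aestronglyMeasurable (by fun_prop))
    (integrable_log_one_add hSR hw) (Measurable.aestronglyMeasurable (by fun_prop)) ?_
    (integrable_const _) ?_).2.differentiableAt
  · filter_upwards [ae_restrict_mem measurableSet_ball] with z hz x hx
    have hz' : ‖z‖ < S := by simpa using hz
    have hx' : ‖x‖ < S := by simpa using hx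
    rw [norm_div]
    refine div_le_div₀ (by positivity) ?_ (by linarith) ?_
    · rw [norm_neg, norm_div, Complex.norm_conj, norm_pow, Complex.norm_real,
        Real.norm_of_nonneg (by linarith)]
      gcongr
    · have h1 := norm_conj_mul_div_le hSR hz' hx'
      have h2 := norm_sub_le_norm_add (1 : ℂ) (-(starRingEnd ℂ z * x / (R : ℂ) ^ 2))
      rw [norm_one] at h2
      linarith
  · filter_upwards [ae_restrict_mem measurableSet_ball] with z hz x hx
    have hz' : ‖z‖ < S := by simpa using hz
    have hx' : ‖x‖ < S := by simpa using hx
    have h1 : HasDerivAt (fun x => 1 + -(starRingEnd ℂ z * x / (R : ℂ) ^ 2))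
        (-(starRingEnd ℂ z / (R : ℂ) ^ 2)) x := by
      have := ((((hasDerivAt_id x).const_mul (starRingEnd ℂ z)).div_const
        ((R : ℂ) ^ 2)).neg).const_add 1
      simpa using this
    exact h1.clog (Complex.mem_slitPlane_of_norm_lt_one
      ((norm_conj_mul_div_le hSR hz' hx').trans_lt hq))

lemma harmonicOnNhd_integral_greenRegular (hSR : S < R) :
    HarmonicOnNhd (fun w => ∫ z in ball 0 S, greenRegular R z w ∂μ) (ball 0 S) := by
  have hd : DifferentiableOn ℂ (fun w => ∫ z in ball 0 S,
      Complex.log (1 + -(starRingEnd ℂ z * w / (R : ℂ) ^ 2)) ∂μ) (ball 0 S) := fun w hw =>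
    (differentiableAt_integral_log hSR (by simpa using hw)).differentiableWithinAt
  intro w hw
  have h1 := (harmonicAt_const (x := w) ((μ.restrict (ball 0 S)).real univ * Real.log R)).add
    (hd.analyticAt (isOpen_ball.mem_nhds hw)).harmonicAt_re
  refine (harmonicAt_congr_nhds ?_).2 h1
  filter_upwards [isOpen_ball.mem_nhds hw] with x hx
  have hx' : ‖x‖ < S := by simpa using hx
  have hS : 0 < S := (norm_nonneg x).trans_lt hx'
  have hlog := integrable_log_one_add (μ := μ) hSR hx'
  have hre : Integrable (fun z => (Complex.log (1 + -(starRingEnd ℂ z * x / (R : ℂ) ^ 2))).re)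
      (μ.restrict (ball 0 S)) := hlog.re
  have h2 := integral_re hlog
  simp only [RCLike.re_to_complex] at h2
  simp only [Pi.add_apply]
  rw [← h2, ← smul_eq_mul, ← integral_const, ← integral_add (integrable_const _) hre]
  refine setIntegral_congr_fun measurableSet_ball fun z hz => ?_
  have hz' : ‖z‖ < S := by simpa using hz
  exact greenRegular_eq_re_log (hS.trans hSR) (Complex.slitPlane_ne_zero
    (Complex.mem_slitPlane_of_norm_lt_one ((norm_conj_mul_div_le hSR hz' hx').trans_lt
      (sq_div_sq_lt_one hS hSR))))

lemma coe_sub_log_eq_green (hSR : S < R) (hz : ‖z‖ < S) (hw : ‖w‖ < S) :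
    ENNReal.log ‖z - w‖ₑ ≤ greenRegular R z w ∧
      ((greenRegular R z w : EReal) - ENNReal.log ‖z - w‖ₑ).toENNReal = green R z w := by
  have hS : 0 < S := (norm_nonneg z).trans_lt hz
  rcases eq_or_ne z w with rfl | hne
  · simp
  have hpos : 0 < ‖z - w‖ := norm_pos_iff.2 (sub_ne_zero.2 hne)
  rw [← ofReal_norm, ENNReal.log_ofReal_of_pos hpos, ← EReal.coe_sub, EReal.real_coe_toENNReal,
    green_of_ne hne, EReal.coe_le_coe_iff]
  have := green_real_nonneg (hS.trans hSR) (hz.trans hSR).le (hw.trans hSR).le hne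
  exact ⟨by unfold greenRegular; linarith, rfl⟩

/-- The logarithmic potential in terms of the Green potential. -/
lemma logPotential_eq_sub (hSR : S < R) (hw : ‖w‖ < S) :
    logPotential μ (ball 0 S) w = ((∫ z in ball 0 S, greenRegular R z w ∂μ : ℝ) : EReal) -
      (greenPotential μ R S w : EReal) := by
  have hmem : ∀ᵐ z ∂μ.restrict (ball 0 S), ‖z‖ < S := by
    filter_upwards [ae_restrict_mem measurableSet_ball] with z hz
    simpa using hz
  rw [logPotential, extIntegral_eq_sub (f := fun z => ENNReal.log ‖z - w‖ₑ)
    (b := fun z => greenRegular R z w)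
    (ENNReal.measurable_log.comp (by fun_prop : Measurable fun z : ℂ => ‖z - w‖ₑ)) (measurable_greenRegular R w)
    (integrable_greenRegular hSR hw) (hmem.mono fun z hz => (coe_sub_log_eq_green hSR hz hw).1),
    greenPotential]
  congr 2
  exact lintegral_congr_ae (hmem.mono fun z hz => (coe_sub_log_eq_green hSR hz hw).2)

end regular

end EffectiveRiesz

end

noncomputable section

namespace EffectiveRiesz

open Set Filter Topology InnerProductSpace

/-! ### Bounds for the harmonic part -/

/-- Bound for `max |h - c|` in terms of the one-sided bound `h - h(0) ≤ K`. -/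
lemma exists_abs_sub_le_of_le {h : ℂ → ℝ} {S T K : ℝ} (hTS : T < S)
    (hh : HarmonicOnNhd h (ball 0 S)) (hK : ∀ w ∈ ball (0 : ℂ) S, h w - h 0 ≤ K) :
    ∃ c : ℝ, ∀ w : ℂ, ‖w‖ ≤ T → |h w - c| ≤ (S + T) / (S - T) * K / 2 := by
  -- `h 0 + K - h` is nonnegative with value `K` at `0`, so Harnack's inequality confines `h` to an
  -- interval of length `(S + T) / (S - T) * K` with upper end `h 0 + K`. The constant is its
  -- midpoint, whence the factor `1/2` in `B₀`.
  refine ⟨h 0 + K - (S + T) / (S - T) * K / 2, fun w hw => ?_⟩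
  have hg : HarmonicOnNhd (fun w => h 0 + K - h w) (ball 0 S) :=
    (harmonicOnNhd_const (h 0 + K)).sub hh
  have h1 := harmonic_le_of_nonneg hg (fun z hz => by linarith [hK z hz]) hTS hw
  have h2 := hK w (by simpa using hw.trans_lt hTS)
  rw [add_sub_cancel_left] at h1
  rw [abs_le]
  constructor <;> linarith

lemma log_div_le_greenRadial {R S : ℝ} {z : ℂ} (hS : 0 < S) (hSR : S < R) (hz : ‖z‖ < S) :
    ENNReal.ofReal (Real.log (R / S)) ≤ green R z 0 := by
  rcases eq_or_ne z 0 with rfl | hne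
  · simp
  have hR := hS.trans hSR
  have h0 := greenRegular_zero hR z
  rw [greenRegular] at h0
  rw [green_of_ne hne, h0, sub_zero, Real.log_div hR.ne' hS.ne']
  exact ENNReal.ofReal_le_ofReal
    (sub_le_sub_left (Real.log_le_log (norm_pos_iff.2 hne) hz.le) _)

/-- The growth constant of the harmonic part. -/
lemma growth_le {R R₁ D M H : ℝ} (hR₁ : 1 < R₁) (hR : R₁ < R) (hH : 0 ≤ H) (hM : 0 ≤ M)
    (hD : M * Real.log (R / R₁) + H ≤ D) :
    H + M * Real.log (R ^ 2 / (R ^ 2 - R₁ ^ 2)) ≤ D / Real.log (R / R₁) *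
      (if R < R ^ 2 - R₁ ^ 2 then Real.log R else Real.log (R ^ 2 / (R ^ 2 - R₁ ^ 2))) := by
  have hsq : 0 < R ^ 2 - R₁ ^ 2 := by nlinarith
  have hR0 : 0 < R := by linarith
  have hT : 0 < Real.log (R / R₁) := Real.log_pos ((one_lt_div (by linarith)).2 hR)
  have hTR : Real.log (R / R₁) ≤ Real.log R := by
    refine Real.log_le_log (by positivity) (div_le_self hR0.le hR₁.le)
  set T := Real.log (R / R₁)
  set L := Real.log (R ^ 2 / (R ^ 2 - R₁ ^ 2)) with hL
  -- Under `M T + H ≤ D` with `M, H ≥ 0`, the quantity `H + M L` is at most `D max(1, L / T)`.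
  have key : ∀ N, T ≤ N → L ≤ N → H + M * L ≤ D / T * N := fun N h1 h2 => by
    have h3 : 1 ≤ N / T := (one_le_div hT).2 h1
    have h4 : D / T * N = D * (N / T) := by ring
    have h5 : (M * T + H) * (N / T) = M * N + H * (N / T) := by field_simp
    rw [h4]
    refine le_trans ?_ (mul_le_mul_of_nonneg_right hD (by linarith))
    rw [h5]
    nlinarith
  -- `R < R² - R₁²` means `L < log R`, so the branches take for `N` the larger of `log R` and `L`;
  -- and `T ≤ log R` because `R₁ > 1`.
  split_ifs with h
  · refine key _ hTR (Real.log_le_log (by positivity) ?_)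
    rw [div_le_iff₀ hsq]
    nlinarith
  · refine key _ (hTR.trans (Real.log_le_log hR0 ?_)) le_rfl
    rw [le_div_iff₀ hsq]
    nlinarith

end EffectiveRiesz

end

/-! ### Assembly of the effective Riesz representation -/

open EffectiveRiesz in
theorem mainTheorem4 (R R₁ R₂ B m : ℝ) (hR₂ : 1 < R₂) (hR₂₁ : R₂ < R₁) (hR₁ : R₁ < R)
    (v : ℂ → EReal) (hv : EffectiveRiesz.SubharmonicOn v (Metric.closedBall 0 R))
    (hB : ∀ z ∈ Metric.closedBall (0 : ℂ) R, v z ≤ (B : EReal)) (hm : v 0 = (m : EReal)) :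
    ∃ (μ : MeasureTheory.Measure ℂ) (h : ℂ → ℝ),
      (∀ w ∈ Metric.ball (0 : ℂ) R₁,
        v w = EffectiveRiesz.logPotential μ (Metric.ball 0 R₁) w + (h w : EReal)) ∧
      μ (Metric.ball 0 R₁) ≤ ENNReal.ofReal ((B - m) / Real.log (R / R₁)) ∧
      InnerProductSpace.HarmonicOnNhd h (Metric.ball 0 R₁) ∧
      (∃ c : ℝ, ∀ w : ℂ, ‖w‖ ≤ R₂ → |h w - c| ≤ EffectiveRiesz.B₀ R R₁ R₂ * (B - m)) ∧
      (∀ φ : ℝ, |iteratedDeriv 1 (fun t : ℝ => h (EffectiveRiesz.e t)) φ| ≤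
        EffectiveRiesz.B₁ R R₁ R₂ * (B - m)) ∧
      (∀ φ : ℝ, |iteratedDeriv 2 (fun t : ℝ => h (EffectiveRiesz.e t)) φ| ≤
        EffectiveRiesz.B₂ R R₁ R₂ * (B - m)) := by
  have hR₁0 : 0 < R₁ := by linarith
  have hR0 : 0 < R := by linarith
  have hT : 0 < Real.log (R / R₁) := Real.log_pos ((one_lt_div hR₁0).2 hR₁)
  obtain ⟨μ, H, hμ, hHh, hH0, hdec⟩ :=
    exists_riesz_decomposition (hv.isSuperharmonicDisc hB hm hR0) hR₁0 hR₁
  set I : ℂ → ℝ := fun w => ∫ z in ball 0 R₁, greenRegular R z w ∂μ with hI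
  set M : ℝ := μ.real (ball 0 R₁) with hM
  have hMtop := measure_ball_ne_top μ R₁
  -- The decomposition at `0`, where `p 0 = B - m`, controls both the mass and `H 0`.
  have hcentre : M * Real.log (R / R₁) + H 0 ≤ B - m := by
    have h1 := hdec 0 (by simpa using hR₁0)
    have h2 : ENNReal.ofReal (M * Real.log (R / R₁)) ≤ greenPotential μ R R₁ 0 := by
      rw [ENNReal.ofReal_mul measureReal_nonneg, ofReal_measureReal hMtop, mul_comm,
        ← setLIntegral_const]
      exact setLIntegral_mono' measurableSet_ball fun z hz =>
        log_div_le_greenRadial hR₁0 hR₁ (by simpa using hz)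
    rw [superPart_of_norm_lt (by simpa using hR0), hm, ← EReal.coe_sub,
      EReal.real_coe_toENNReal] at h1
    have h3 : ENNReal.ofReal (M * Real.log (R / R₁) + H 0) ≤ ENNReal.ofReal (B - m) := by
      rw [h1, ENNReal.ofReal_add (mul_nonneg measureReal_nonneg hT.le) (hH0 0)]
      gcongr
    have h4 : 0 ≤ B - m := by
      have := hB 0 (by simpa using hR0.le)
      rw [hm, EReal.coe_le_coe_iff] at this
      linarith
    exact (ENNReal.ofReal_le_ofReal_iff h4).1 h3
  have hharm : InnerProductSpace.HarmonicOnNhd (fun w => B - H w - I w) (ball 0 R₁) :=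
    ((InnerProductSpace.harmonicOnNhd_const B).sub hHh).sub
      (harmonicOnNhd_integral_greenRegular hR₁)
  have hI0 : I 0 = M * Real.log R := by
    simp only [hI, greenRegular_zero hR0, integral_const, measureReal_restrict_apply_univ,
      smul_eq_mul, hM]
  -- The increment is `(H 0 - H w) + (I 0 - I w)`. Drop `H w ≥ 0` and bound `I w` below; what
  -- remains is the left side of `growth_le`.
  have hgrowth : ∀ w ∈ ball (0 : ℂ) R₁, (B - H w - I w) - (B - H 0 - I 0) ≤
      (B - m) / Real.log (R / R₁) * (if R < R ^ 2 - R₁ ^ 2 then Real.log R else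
        Real.log (R ^ 2 / (R ^ 2 - R₁ ^ 2))) := by
    intro w hw
    refine le_trans ?_ (growth_le (hR₂.trans hR₂₁) hR₁ (hH0 0) measureReal_nonneg hcentre)
    have h1 : M * (Real.log (R ^ 2 - R₁ ^ 2) - Real.log R) ≤ I w := by
      rw [hM, ← measureReal_restrict_apply_univ, ← smul_eq_mul, ← integral_const]
      refine setIntegral_mono_on (integrable_const _)
        (integrable_greenRegular hR₁ (by simpa using hw)) measurableSet_ball fun z hz => ?_
      exact le_greenRegular hR₁ (by simpa using hz) (by simpa using hw)
    rw [Real.log_div (by positivity) (by nlinarith), Real.log_pow, hI0]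
    push_cast
    linarith [hH0 w]
  obtain ⟨c, hc⟩ := exists_abs_sub_le_of_le hR₂₁ hharm hgrowth
  have hc' : ∀ w : ℂ, ‖w‖ ≤ R₂ → |B - H w - I w - c| ≤ B₀ R R₁ R₂ * (B - m) := fun w hw => by
    refine (hc w hw).trans_eq ?_
    rw [B₀]
    ring
  have hder := abs_iteratedDeriv_comp_e_le hR₂ hR₂₁ hharm hc'
  refine ⟨μ, fun w => B - H w - I w, fun w hw => ?_, ?_, hharm, ⟨c, hc'⟩, fun φ => ?_, fun φ => ?_⟩
  · have hw' : ‖w‖ < R₁ := by simpa using hw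
    have h1 := hdec w hw'
    have hvw := hB w (by simpa using (hw'.trans hR₁).le)
    rw [superPart_of_norm_lt (hw'.trans hR₁)] at h1
    rw [logPotential_eq_sub hR₁ hw']
    -- The real quantities cancel to `v = B - P - H`; the case `v w = -∞` is the case `P w = ∞`.
    change _ = ((I w : ℝ) : EReal) - _ + _
    generalize greenPotential μ R R₁ w = G at *
    generalize v w = x at *
    induction x with
    | top => simp at hvw
    | bot =>
      have hG : G = ⊤ := by simpa [eq_comm] using h1
      simp [hG]
    | coe x =>
      rw [← EReal.coe_sub, EReal.real_coe_toENNReal] at h1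
      induction G with
      | top => simp at h1
      | coe G =>
        rw [EReal.coe_le_coe_iff] at hvw
        rw [← ENNReal.ofReal_coe_nnreal, ← ENNReal.ofReal_add G.coe_nonneg (hH0 w),
          ENNReal.ofReal_eq_ofReal_iff (by linarith) (add_nonneg G.coe_nonneg (hH0 w))] at h1
        rw [EReal.coe_nnreal_eq_coe_real, ← EReal.coe_sub, ← EReal.coe_add]
        congr 1
        linarith
  · rw [← ofReal_measureReal hMtop]
    refine ENNReal.ofReal_le_ofReal ((le_div_iff₀ hT).2 ?_)
    linarith [hH0 0]
  · rw [B₁, mul_right_comm]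
    exact (hder φ).1
  · rw [B₂, mul_right_comm]
    exact (hder φ).2
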